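/- Let $\Gamma$ be a (countable) graph with vertex set $V$, on which a finitely generated abelian group $G$ of free rank $n$ acts freely by automorphisms with a finite quotient graph $\Gamma/G$. Fix an identification of $G$ modulo torsion with $\mathbb Z^n$, i.e. a surjective homomorphism $g\mapsto(g_1,\dots,g_n)\in\mathbb Z^n$ with finite kernel, and put $|g|=|g_1|+\dots+|g_n|$. Let $P$ be a $G$-periodic difference operator of finite order $m$ on $\Gamma$: $(Pu)(v)=\sum_{w} a(v,w)u(w)$ for $u:V\to\mathbb C$, where $a(v,w)=0$ if the distance of $v$ and $w$ exceeds $m$, and $P$ commutes with the action of $G$. For $N=0,1,2,\dots$ let $V_N(P)$ be the space of solutions $u$ of $Pu=0$ such that for each vertex $v$ there is $C$ with $|u(gv)|\le C(1+|g|)^N$ for all $g\in G$, and let $d_N=\dim V_N(P)$. The Liouville theorem of order $N$ holds if $d_N<\infty$; the Liouville theorem holds if this is so for every $N\ge 0$. For a character $\chi$ of $G$, a function $u$ is $\chi$-automorphic if $u(gv)=\chi(g)u(v)$. The real Fermi surface $F_{P,\mathbb R}$ is the set of unitary characters $\chi$ for which $Pu=0$ has a nonzero $\chi$-automorphic solution.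 Fix real functions $\xi_1,\dots,\xi_n$ on $V$ with $\xi_j(gv)=\xi_j(v)+g_j$. A Floquet solution of order (at most) $N$ with character $\chi$ is a solution of $Pu=0$ of the form $u(v)=e(v)\sum_{|j|\le N}\xi(v)^j p_j(v)$, where $e$ is a nowhere vanishing $\chi$-automorphic function and the $p_j$ are $G$-periodic. Then: (1) If the Liouville theorem of some order $N\ge0$ holds, then it holds for any order. (2) The Liouville theorem holds if and only if $F_{P,\mathbb R}$ is finite. (3) Suppose that the Liouville theorem holds. (a) Each $u\in V_N(P)$ is a finite sum of Floquet solutions of order at most $N$ with characters in $F_{P,\mathbb R}$. (b) $d_N\le d_0\,q_{n,N}<\infty$ for all $N\ge 0$, where $q_{n,N}$ is the dimension of the space of polynomials of degree at most $N$ in $n$ variables. (c) For $\chi\in F_{P,\mathbb R}$ and $k\in\mathbb C^n$ near $0$, let $A_\chi(k)$ be the restriction of the dual operator $P^*$ (with coefficients $a(w,v)$) to the automorphic functions with character $g\mapsto \chi(g)^{-1}e^{-ik\cdot g}$, these being identified with functions on the vertices of $\Gamma/G$ by means of representatives of the orbits. Let $r_\chi$ be the algebraic multiplicity of the eigenvalue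 $0$ of $A_\chi(0)$, let $\Pi_\chi(k)$ be the spectral projector of $A_\chi(k)$ for the eigenvalues inside a circle $|\zeta|=\delta$ that separates $0$ from the other eigenvalues of $A_\chi(0)$, let $e_1,\dots,e_{r_\chi}$ be an orthonormal basis of the range of $\Pi_\chi(0)$, and let $\lambda^\chi(k)$ be the $r_\chi\times r_\chi$ matrix function $\lambda^\chi(k)_{ij}=\langle e_j,A_\chi(k)\Pi_\chi(k)e_i\rangle$, with Taylor expansion $\lambda^\chi(k)=\sum_{l\ge0}\lambda^\chi_l(k)$ at $k=0$ into homogeneous terms. Assume that for each $\chi\in F_{P,\mathbb R}$ there is a first nonzero term $\lambda^\chi_{l_0(\chi)}$ and that $\det\lambda^\chi_{l_0(\chi)}$ is not identically zero. Then for each $N\ge 0$ $$d_N=\sum_{\chi\in F_{P,\mathbb R}} r_\chi\left[\binom{n+N}{N}-\binom{n+N-l_0(\chi)}{N-l_0(\chi)}\right],$$ where the second binomial coefficient is $0$ if $l_0(\chi)>N$. The terms of this sum are the dimensions of the spaces of $\lambda^\chi_{l_0(\chi)}$-harmonic polynomials of degree at most $N$, i.e. of $\mathbb C^{r_\chi}$-valued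 polynomials $p$ of degree at most $N$ on $\mathbb R^n$ with $\lambda^\chi_{l_0(\chi)}(D)p=0$, $D=-i\partial$. The operator $\lambda^\chi_{l_0(\chi)}(D)$ on $\mathbb C^{r_\chi}$-valued polynomials has linear right inverses that preserve homogeneity. For each $\chi\in F_{P,\mathbb R}$ there is a linear map $T$ that, for every $N$, maps the Floquet solutions of order at most $N$ with character $\chi$ bijectively onto the polynomials $\psi$ of degree at most $N$ with $\sum_l\lambda^\chi_l(D)\psi=0$; and for each such right inverse $R$ and every $N$, the map $u\mapsto Tu+R\sum_{l>l_0(\chi)}\lambda^\chi_l(D)Tu$ is a bijection of the Floquet solutions of order at most $N$ with character $\chi$ onto the $\lambda^\chi_{l_0(\chi)}$-harmonic polynomials of degree at most $N$. -/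

import Mathlib

namespace PeriodicGraph

noncomputable section

open scoped Classical

variable {G V : Type*} [AddCommGroup G] [AddAction G V] {n : ℕ}

/-! ### Graphs, difference operators -/

/-- `G` acts on the graph `Γ` freely, by graph automorphisms, and with finitely many orbits of
edges. (That there are finitely many orbits of vertices is a separate `Fintype` instance on the
orbit space in the definitions and results below.) -/
structure IsFreeCocompact (G : Type*) {V : Type*} [AddCommGroup G] [AddAction G V]
    (Γ : SimpleGraph V) : Prop where
  adj_vadd : ∀ (g : G) (v w : V), Γ.Adj (g +ᵥ v) (g +ᵥ w) ↔ Γ.Adj v w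
  free : ∀ (g : G) (v : V), g +ᵥ v = v → g = 0
  finite_edges : ∃ S : Set (Sym2 V), S.Finite ∧
    ∀ e ∈ Γ.edgeSet, ∃ g : G, ∃ e' ∈ S, e = Sym2.map (fun v => g +ᵥ v) e'

/-- `P` is a difference operator of order at most `m`: `(P u)(v)` is a linear combination of the
values of `u` at the vertices at distance at most `m` from `v`. -/
def IsDifferenceOperator (Γ : SimpleGraph V) (m : ℕ) (P : (V → ℂ) →ₗ[ℂ] (V → ℂ)) : Prop :=
  ∃ a : V → V → ℂ, (∀ v w, a v w ≠ 0 → Γ.edist v w ≤ m) ∧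
    ∀ u v, P u v = ∑ᶠ w, a v w * u w

/-- `P` commutes with the action of `G` on functions. -/
def IsPeriodicOperator (G : Type*) {V : Type*} [AddCommGroup G] [AddAction G V]
    (P : (V → ℂ) →ₗ[ℂ] (V → ℂ)) : Prop :=
  ∀ (g : G) (u : V → ℂ), P (fun v => u (g +ᵥ v)) = fun v => P u (g +ᵥ v)

/-- The dual (formally adjoint) operator with respect to the bilinear pairing
`∑ v, f v * h v`: its coefficients are the transposed coefficients of `P`. -/
def dualOp (P : (V → ℂ) →ₗ[ℂ] (V → ℂ)) (u : V → ℂ) : V → ℂ :=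
  fun v => ∑ᶠ w, P (Pi.single v 1) w * u w

/-! ### Polynomially growing solutions and the real Fermi surface -/

/-- The size `|g| = |g₁| + ⋯ + |gₙ|` of `g ∈ G`, where `c` gives the coordinates
of `g` modulo torsion. -/
def size (c : G →+ (Fin n → ℤ)) (g : G) : ℝ := ∑ i, |(c g i : ℝ)|

/-- The space `V_N(P)` of solutions of `P u = 0` of polynomial growth of order `N`. Since there are
finitely many orbits of vertices, it is enough to bound `u` along each orbit. -/
def polySol (c : G →+ (Fin n → ℤ)) (P : (V → ℂ) →ₗ[ℂ] (V → ℂ)) (N : ℕ) :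
    Submodule ℂ (V → ℂ) where
  carrier := {u | P u = 0 ∧ ∀ v, ∃ C : ℝ, ∀ g : G, ‖u (g +ᵥ v)‖ ≤ C * (1 + size c g) ^ N}
  add_mem' := by
    rintro u w ⟨hu, hu'⟩ ⟨hw, hw'⟩
    refine ⟨by rw [map_add, hu, hw, add_zero], fun v => ?_⟩
    obtain ⟨C, hC⟩ := hu' v
    obtain ⟨D, hD⟩ := hw' v
    refine ⟨C + D, fun g => ?_⟩
    rw [add_mul]
    exact (norm_add_le _ _).trans (add_le_add (hC g) (hD g))
  zero_mem' := ⟨map_zero P, fun _ => ⟨0, fun _ => by simp⟩⟩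
  smul_mem' := by
    rintro a u ⟨hu, hu'⟩
    refine ⟨by rw [map_smul, hu, smul_zero], fun v => ?_⟩
    obtain ⟨C, hC⟩ := hu' v
    refine ⟨‖a‖ * C, fun g => ?_⟩
    rw [Pi.smul_apply, norm_smul, mul_assoc]
    exact mul_le_mul_of_nonneg_left (hC g) (norm_nonneg a)

/-- The Liouville theorem of order `N` for `P u = 0`. -/
def LiouvilleOfOrder (c : G →+ (Fin n → ℤ)) (P : (V → ℂ) →ₗ[ℂ] (V → ℂ)) (N : ℕ) : Prop :=
  FiniteDimensional ℂ (polySol c P N)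

/-- The Liouville theorem for `P u = 0`: it holds for any order. -/
def Liouville (c : G →+ (Fin n → ℤ)) (P : (V → ℂ) →ₗ[ℂ] (V → ℂ)) : Prop :=
  ∀ N, LiouvilleOfOrder c P N

/-- `u` is automorphic with respect to the character `χ`. -/
def IsAutomorphic (χ : G → ℂ) (u : V → ℂ) : Prop :=
  ∀ (g : G) (v : V), u (g +ᵥ v) = χ g * u v

/-- The real Fermi surface: the unitary characters `χ` of `G` for which `P u = 0` has a nonzero
`χ`-automorphic solution. -/
def fermi (G : Type*) {V : Type*} [AddCommGroup G] [AddAction G V]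
    (P : (V → ℂ) →ₗ[ℂ] (V → ℂ)) : Set (AddChar G Circle) :=
  {χ | ∃ u : V → ℂ, u ≠ 0 ∧ P u = 0 ∧ IsAutomorphic (fun g => (χ g : ℂ)) u}

/-- `q_{n,N}`: the dimension of the space of polynomials of degree at most `N` in `n` variables. -/
def polyDim (n N : ℕ) : ℕ :=
  Module.finrank ℂ (MvPolynomial.restrictTotalDegree (Fin n) ℂ N)

/-! ### Floquet functions -/

/-- `ξ` is an analog on the graph of the coordinate functions: `ξ (g x) = ξ x + g`
(an example is `ξ = log h` with the positive functions
`h_j x = ∑ g, f (g x) * exp (-g_j)`). -/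
def IsCoordinates (c : G →+ (Fin n → ℤ)) (ξ : V → Fin n → ℝ) : Prop :=
  ∀ (g : G) (v : V) (i : Fin n), ξ (g +ᵥ v) i = ξ v i + c g i

/-- The multi-indices `j` with `|j| ≤ N`. -/
def multiIndices (n N : ℕ) : Finset (Fin n → ℕ) :=
  (Fintype.piFinset fun _ => Finset.range (N + 1)).filter fun j => ∑ i, j i ≤ N

/-- `u` is a Floquet function of order (at most) `N` with character `χ`: it has the form
`u(x) = e(x) ∑_{|j| ≤ N} [x]^j p_j(x)` with a nowhere vanishing `χ`-automorphic function `e`,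
`G`-periodic functions `p_j`, and `[x]^j = ξ₁(x)^{j₁} ⋯ ξₙ(x)^{jₙ}`. -/
def IsFloquet (ξ : V → Fin n → ℝ) (χ : AddChar G Circle) (N : ℕ) (u : V → ℂ) : Prop :=
  ∃ (e : V → ℂ) (p : (Fin n → ℕ) → V → ℂ),
    (∀ v, e v ≠ 0) ∧ IsAutomorphic (fun g => (χ g : ℂ)) e ∧
    (∀ (j : Fin n → ℕ) (g : G) (v : V), p j (g +ᵥ v) = p j v) ∧
    ∀ v, u v = e v * ∑ j ∈ multiIndices n N, (∏ i, (ξ v i : ℂ) ^ j i) * p j v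

/-- The Floquet solutions of `P u = 0` with character `χ` and order at most `N`. -/
def floquetSol (P : (V → ℂ) →ₗ[ℂ] (V → ℂ)) (ξ : V → Fin n → ℝ) (χ : AddChar G Circle) (N : ℕ) :
    Set (V → ℂ) :=
  {u | P u = 0 ∧ IsFloquet ξ χ N u}

/-! ### The operators on the quotient graph and the dispersion relation -/

/-- The orbit space, i.e. the set of vertices of the quotient graph. -/
abbrev Orbits (G V : Type*) [AddCommGroup G] [AddAction G V] : Type _ :=
  AddAction.orbitRel.Quotient G V

/-- Every vertex is a translate of the chosen representative of its orbit. -/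
lemma exists_shift (v : V) :
    ∃ g : G, g +ᵥ (Quotient.out (Quotient.mk _ v : Orbits G V) : V) = v := by
  have h : (AddAction.orbitRel G V) v (Quotient.out (Quotient.mk _ v : Orbits G V)) :=
    (AddAction.orbitRel G V).symm (Quotient.mk_out v)
  exact AddAction.orbitRel_apply.1 h

/-- The group element moving the representative of the orbit of `v` to `v`. -/
def shift (G : Type*) {V : Type*} [AddCommGroup G] [AddAction G V] (v : V) : G :=
  (exists_shift (G := G) v).choose

/-- The automorphic function with character `χ` whose values at the representatives of the orbits
are given by `f`. This identifies automorphic functions with functions on the quotient graph. -/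
def autoExt (χ : G → ℂ) (f : Orbits G V → ℂ) : V → ℂ :=
  fun v => χ (shift G v) * f (Quotient.mk _ v)

/-- The matrix of the restriction `L(χ)` of a periodic operator `L` to the space of
`χ`-automorphic functions, these being identified with functions on the quotient graph. -/
def blochMatrix (L : (V → ℂ) → (V → ℂ)) (χ : G → ℂ) : Matrix (Orbits G V) (Orbits G V) ℂ :=
  Matrix.of fun p q => L (autoExt χ (Pi.single q 1)) (Quotient.out p)

/-- The character `χ γ_k`, where `γ_k(g) = exp(i k·g)` for a complex quasimomentum `k`. -/
def twist (c : G →+ (Fin n → ℤ)) (χ : AddChar G Circle) (k : Fin n → ℂ) : G → ℂ :=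
  fun g => (χ g : ℂ) * Complex.exp (Complex.I * ∑ i, k i * (c g i : ℂ))

/-- The dual operator `P*` on automorphic functions with the character inverse to `χ γ_k`
(written `P*(-k₀-k)` when `χ = γ_{k₀}`). -/
def dualBloch (c : G →+ (Fin n → ℤ)) (P : (V → ℂ) →ₗ[ℂ] (V → ℂ)) (χ : AddChar G Circle)
    (k : Fin n → ℂ) : Matrix (Orbits G V) (Orbits G V) ℂ :=
  blochMatrix (dualOp P) (twist c χ⁻¹ (-k))

section finite

variable [Fintype (Orbits G V)]

/-- The spectral subspace of `P*(-k₀)` for the eigenvalue `0`, where `χ = γ_{k₀}`. -/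
def spectralSubspace (c : G →+ (Fin n → ℤ)) (P : (V → ℂ) →ₗ[ℂ] (V → ℂ)) (χ : AddChar G Circle) :
    Submodule ℂ (Orbits G V → ℂ) :=
  Module.End.maxGenEigenspace (Matrix.toLin' (dualBloch c P χ 0)) 0

/-- The algebraic multiplicity `r` of the eigenvalue `0` of `P*(-k₀)`, where `χ = γ_{k₀}`. -/
def mult (c : G →+ (Fin n → ℤ)) (P : (V → ℂ) →ₗ[ℂ] (V → ℂ)) (χ : AddChar G Circle) : ℕ :=
  Module.finrank ℂ (spectralSubspace c P χ)

/-- The spectral projector `(2πi)⁻¹ ∮ (ζ - A)⁻¹ dζ` of a matrix `A` for the part of its spectrum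
inside of the circle `|ζ| = δ`. -/
def rieszProjector {ι : Type*} [Fintype ι] (A : Matrix ι ι ℂ) (δ : ℝ) : Matrix ι ι ℂ :=
  Matrix.of fun p q =>
    (2 * (Real.pi : ℂ) * Complex.I)⁻¹ *
      ∮ ζ in C(0, δ), ((ζ • (1 : Matrix ι ι ℂ) - A)⁻¹ : Matrix ι ι ℂ) p q

/-- The matrix function `λ(k)_{ij} = ⟨e_j, P*(-k₀-k) Π(k) e_i⟩` near `k = 0`, where `χ = γ_{k₀}`
and `Π(k)` is the spectral projector of `P*(-k₀-k)` for the part of its spectrum inside of the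
circle of radius `δ`. -/
def dispersion (c : G →+ (Fin n → ℤ)) (P : (V → ℂ) →ₗ[ℂ] (V → ℂ)) (χ : AddChar G Circle)
    (δ : ℝ) {r : ℕ} (e : Fin r → Orbits G V → ℂ) (k : Fin n → ℂ) : Matrix (Fin r) (Fin r) ℂ :=
  Matrix.of fun i j =>
    star (e j) ⬝ᵥ
      ((dualBloch c P χ k * rieszProjector (dualBloch c P χ k) δ).mulVec (e i))

end finite

/-- The homogeneous term of degree `l` in the Taylor expansion of `f` at `0`. -/
def taylorTerm (f : (Fin n → ℂ) → ℂ) (l : ℕ) : MvPolynomial (Fin n) ℂ :=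
  ∑ s : Fin l → Fin n,
    MvPolynomial.C ((l.factorial : ℂ)⁻¹ *
      iteratedFDeriv ℂ l f 0 (fun i => Pi.single (s i) 1)) * ∏ i, MvPolynomial.X (s i)

/-- The homogeneous term of degree `l` in the Taylor expansion at `0` of a matrix function. -/
def taylorMatrix {r : ℕ} (F : (Fin n → ℂ) → Matrix (Fin r) (Fin r) ℂ) (l : ℕ) :
    Matrix (Fin r) (Fin r) (MvPolynomial (Fin n) ℂ) :=
  Matrix.of fun i j => taylorTerm (fun k => F k i j) l

/-- The conditions at a character `χ` in the real Fermi surface: the circle of radius `δ` separates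
the eigenvalue `0` of `P*(-k₀)` from the rest of its spectrum, `e` is an orthonormal basis of the
spectral subspace for the eigenvalue `0`, the term of degree `l₀` in the Taylor expansion of the
matrix function `λ` is the first nonzero one, and its determinant is not identically zero. -/
structure IsNondegenerate [Fintype (Orbits G V)] (c : G →+ (Fin n → ℤ))
    (P : (V → ℂ) →ₗ[ℂ] (V → ℂ)) (χ : AddChar G Circle) (δ : ℝ)
    (e : Fin (mult c P χ) → Orbits G V → ℂ) (l₀ : ℕ) : Prop where
  radius_pos : 0 < δ
  separates : ∀ μ : ℂ, Module.End.HasEigenvalue (Matrix.toLin' (dualBloch c P χ 0)) μ →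
    μ ≠ 0 → δ < ‖μ‖
  orthonormal : ∀ i j, star (e i) ⬝ᵥ e j = if i = j then 1 else 0
  span_eq : Submodule.span ℂ (Set.range e) = spectralSubspace c P χ
  vanishing : ∀ l < l₀, taylorMatrix (dispersion c P χ δ e) l = 0
  ne_zero : taylorMatrix (dispersion c P χ δ e) l₀ ≠ 0
  det_ne_zero : (taylorMatrix (dispersion c P χ δ e) l₀).det ≠ 0

/-! ### Differential operators on vector-valued polynomials -/

/-- The partial derivative `∂^α` on polynomials. -/
def partialDeriv (α : Fin n →₀ ℕ) : Module.End ℂ (MvPolynomial (Fin n) ℂ) :=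
  (List.ofFn fun i =>
    (((MvPolynomial.pderiv i : Derivation ℂ (MvPolynomial (Fin n) ℂ) (MvPolynomial (Fin n) ℂ)) :
      MvPolynomial (Fin n) ℂ →ₗ[ℂ] MvPolynomial (Fin n) ℂ) :
        Module.End ℂ (MvPolynomial (Fin n) ℂ)) ^ α i).prod

/-- The differential operator `Q(D)`, `D = -i∂`, with symbol `Q`, acting on polynomials. -/
def symbolOp (Q : MvPolynomial (Fin n) ℂ) : Module.End ℂ (MvPolynomial (Fin n) ℂ) :=
  ∑ α ∈ Q.support, (Q.coeff α * (-Complex.I) ^ α.degree) • partialDeriv α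

/-- The matrix differential operator `Q(D)` with matrix symbol `Q`, acting on vector-valued
polynomials. -/
def matrixOp {r : ℕ} (Q : Matrix (Fin r) (Fin r) (MvPolynomial (Fin n) ℂ)) :
    (Fin r → MvPolynomial (Fin n) ℂ) →ₗ[ℂ] (Fin r → MvPolynomial (Fin n) ℂ) :=
  LinearMap.pi fun i => ∑ j, (symbolOp (Q i j)).comp (LinearMap.proj j)

/-- The `ℂ^r`-valued polynomials of degree at most `N`. -/
def polyLE (n r N : ℕ) : Submodule ℂ (Fin r → MvPolynomial (Fin n) ℂ) :=
  Submodule.pi Set.univ fun _ => MvPolynomial.restrictTotalDegree (Fin n) ℂ N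

/-- The `Q`-harmonic `ℂ^r`-valued polynomials of degree at most `N`. -/
def harmonic {r : ℕ} (Q : Matrix (Fin r) (Fin r) (MvPolynomial (Fin n) ℂ)) (N : ℕ) :
    Submodule ℂ (Fin r → MvPolynomial (Fin n) ℂ) :=
  LinearMap.ker (matrixOp Q) ⊓ polyLE n r N

/-- The `ℂ^r`-valued polynomials `p` of degree at most `N` with `∑ l, Λ_l(D) p = 0`, where `Λ_l` is
homogeneous of degree `l` (so that the terms with `l > N` do not contribute). -/
def seriesKer {r : ℕ} (Λ : ℕ → Matrix (Fin r) (Fin r) (MvPolynomial (Fin n) ℂ)) (N : ℕ) :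
    Submodule ℂ (Fin r → MvPolynomial (Fin n) ℂ) :=
  LinearMap.ker (∑ l ∈ Finset.range (N + 1), matrixOp (Λ l)) ⊓ polyLE n r N

/-- `R` is a linear right inverse of `Q(D)`, `Q` homogeneous of degree `s`, which preserves the
homogeneity of polynomials. -/
def IsHomogeneousRightInverse {r : ℕ} (Q : Matrix (Fin r) (Fin r) (MvPolynomial (Fin n) ℂ))
    (s : ℕ) (R : (Fin r → MvPolynomial (Fin n) ℂ) →ₗ[ℂ] (Fin r → MvPolynomial (Fin n) ℂ)) :
    Prop :=
  (∀ p, matrixOp Q (R p) = p) ∧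
    ∀ (p : Fin r → MvPolynomial (Fin n) ℂ) (l : ℕ), (∀ i, (p i).IsHomogeneous l) →
      ∀ i, (R p i).IsHomogeneous (l + s)

/-- The number `r [C(n+N, N) - C(n+N-l, N-l)]`, the second binomial coefficient being zero
for `l > N`. -/
def dimFormula (n N r l : ℕ) : ℤ :=
  r * (((n + N).choose N : ℤ) - if l ≤ N then ((n + N - l).choose (N - l) : ℤ) else 0)

end

end PeriodicGraph

/-! ### Elements of a Banach algebra with polynomially bounded powers and finite spectrum -/

namespace PeriodicGraph

/-! Finite dimensionality. In terms of orbit representatives, `P` is a square matrix `D` over the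
commutative group algebra of `G`, and Cramer's rule shows that `D.det` annihilates every solution.
Dividing by the weight `(1 + |g|)^N` turns `V_N(P)` into a closed subspace of the bounded functions,
on which `G` acts with norms of polynomial growth. In the commutative Banach algebra generated by
this action, every Gelfand character restricts to a unitary character of `G` at which `D.det`
vanishes, that is, to a point of the real Fermi surface. If that surface is finite, each translation
thus has finite spectrum on the unit circle. An invertible element with such a spectrum and with
powers of polynomial growth is algebraic (`exists_prod_sub_pow_eq_zero`, applied in
`exists_aeval_rep_eq_zero`): a suitable Laurent polynomial in it is quasinilpotent and generates a
group of polynomial growth, so Phragmén-Lindelöf and the Cauchy estimates make it nilpotent. As `G`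
is finitely generated, the image of the group algebra is finite dimensional, and so is `V_N(P)`
(`finiteDimensional_of_aeval_transl`). Conversely, automorphic solutions with distinct unitary
characters are independent elements of `V_0(P)`, so the Liouville theorem of a single order makes
the Fermi surface finite.

Structure of solutions. A finite dimensional translation invariant space splits into joint
generalized eigenspaces of the translations, and only characters in the Fermi surface occur. Divided
by its character, a generalized automorphic function is unipotent under translation along each
orbit, hence a polynomial in the coordinates (`exists_eval_eq_of_unipotent`). Translation by `a`
acts on polynomials as `exp(i a·D)`, so `P` acts on these polynomial vectors as the Bloch matrix
with the quasimomentum `k` replaced by `D` (`HasSymbol.apply_polyFn`). Growth of order `N` means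
degree at most `N`, and such functions are exactly the Floquet functions. The upper bound follows
because modulo the kernel of `M(0)` the equation `M(D)φ = 0` expresses `φ` through terms of lower
degree (`finrank_polySolSpace_le`).

Dimension formula. Since `f ↦ f(D)` is multiplicative on germs of analytic functions at `0`,
analytic matrix identities near `k = 0` become identities of operators on polynomials. The Riesz
projector therefore reduces the Bloch system to the system with symbol `λ`
(`exists_bijOn_compression`). When the leading term has nonzero determinant, its operator is
surjective (Fischer duality in `exists_symbolHom_eq`, and the adjugate). A homogeneous right inverse
`R` makes `1 + R ∑_{l > l₀} λ_l(D)` unipotent in the degree, and this map carries the solutions of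
the full system to the harmonic polynomials (`bijOn_add_higher`), which rank-nullity counts. -/

open Polynomial in
-- Parseval: the sum of the squared moduli of the coefficients is the mean of `‖p‖ ^ 2` over the
-- unit circle.
lemma norm_coeff_le_of_norm_eval_le {p : ℂ[X]} {C : ℝ}
    (h : ∀ z : ℂ, ‖z‖ = 1 → ‖p.eval z‖ ≤ C) (j : ℕ) : ‖p.coeff j‖ ≤ C := by
  have hC : 0 ≤ C := (norm_nonneg _).trans (h 1 (by simp))
  by_cases hj : j ∈ p.support
  · have h1 := Polynomial.sum_sq_norm_coeff_eq_circleAverage (p := p)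
    have h2 : Real.circleAverage (fun z => ‖p.eval z‖ ^ 2) 0 1 ≤ C ^ 2 := by
      apply Real.circleAverage_mono_on_of_le_circle
      · apply ContinuousOn.circleIntegrable'
        fun_prop
      · intro z hz
        have : ‖z‖ = 1 := by simpa using hz
        exact pow_le_pow_left₀ (norm_nonneg _) (h z this) 2
    have h3 : ‖p.coeff j‖ ^ 2 ≤ ∑ i ∈ p.support, ‖p.coeff i‖ ^ 2 :=
      Finset.single_le_sum (f := fun i => ‖p.coeff i‖ ^ 2) (fun i _ => by positivity) hj
    exact le_of_sq_le_sq (h3.trans (h1.le.trans h2)) hC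
  · simpa [Polynomial.notMem_support_iff.1 hj] using hC

section BanachAlgebra

variable {B : Type*} [NormedRing B] [NormOneClass B] [NormedAlgebra ℂ B] [CompleteSpace B]

/-- From index `K` on, the terms are at most `e^(-K)` times those of the series for `exp(e ρ)`, so
the tail is at most `e^(e ρ - K)`, and `e < 3`. What matters is that the number of terms needed is
linear in the norm. -/
lemma norm_exp_sub_sum_le_one (x : B) {ρ : ℝ} {K : ℕ} (hx : ‖x‖ ≤ ρ) (hK : 3 * ρ ≤ K) :
    ‖NormedSpace.exp x - ∑ k ∈ Finset.range K, ((k.factorial : ℂ)⁻¹) • x ^ k‖ ≤ 1 := by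
  have hρ : 0 ≤ ρ := (norm_nonneg _).trans hx
  have hs : HasSum (fun k : ℕ => ((k.factorial : ℂ)⁻¹) • x ^ k) (NormedSpace.exp x) :=
    NormedSpace.exp_series_hasSum_exp' (𝕂 := ℂ) x
  have hr : HasSum (fun k : ℕ => ((k.factorial : ℝ)⁻¹) • (Real.exp 1 * ρ) ^ k)
      (Real.exp (Real.exp 1 * ρ)) := by
    rw [Real.exp_eq_exp_ℝ]
    exact NormedSpace.exp_series_hasSum_exp' (𝕂 := ℝ) _
  have h1 := (hasSum_nat_add_iff' K).2 hs
  have h2 := (hasSum_nat_add_iff' K).2 hr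
  have h3 := h2.mul_left (Real.exp (-K))
  rw [← h1.tsum_eq]
  have hb : ∀ k : ℕ, ‖(((k + K).factorial : ℂ)⁻¹) • x ^ (k + K)‖ ≤
      Real.exp (-K) * (((k + K).factorial : ℝ)⁻¹ • (Real.exp 1 * ρ) ^ (k + K)) := by
    intro k
    rw [norm_smul, norm_inv, Complex.norm_natCast, smul_eq_mul, mul_pow, ← Real.exp_nat_mul,
      mul_left_comm]
    refine mul_le_mul_of_nonneg_left ?_ (by positivity)
    rw [← mul_assoc, ← Real.exp_add]
    calc ‖x ^ (k + K)‖ ≤ ‖x‖ ^ (k + K) := norm_pow_le _ _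
      _ ≤ ρ ^ (k + K) := pow_le_pow_left₀ (norm_nonneg _) hx _
      _ ≤ Real.exp (-K + (k + K : ℕ) * 1) * ρ ^ (k + K) := by
        refine le_mul_of_one_le_left (by positivity) (Real.one_le_exp ?_)
        push_cast
        have : (0 : ℝ) ≤ k := by positivity
        linarith
  refine (tsum_of_norm_bounded h3 hb).trans ?_
  have h4 : (0 : ℝ) ≤ ∑ i ∈ Finset.range K, ((i.factorial : ℝ)⁻¹) • (Real.exp 1 * ρ) ^ i :=
    Finset.sum_nonneg fun i _ => by rw [smul_eq_mul]; positivity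
  calc Real.exp (-K) * (Real.exp (Real.exp 1 * ρ) -
        ∑ i ∈ Finset.range K, ((i.factorial : ℝ)⁻¹) • (Real.exp 1 * ρ) ^ i)
      ≤ Real.exp (-K) * Real.exp (Real.exp 1 * ρ) := by
        refine mul_le_mul_of_nonneg_left ?_ (by positivity)
        linarith
    _ ≤ 1 := by
        rw [← Real.exp_add, Real.exp_le_one_iff]
        have := Real.exp_one_lt_three
        nlinarith

open Polynomial in
-- On the circle `z^(-s) q(z)` is real, so its exponential times `it` has modulus one. Truncating
-- the series after `K ~ |t|` terms gives a Laurent polynomial with exponents in `[-sK, sK]` that is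
-- bounded by `2` on the circle. By Parseval its coefficients are at most `2`, and substituting `T`
-- costs only the polynomially bounded norms of the powers of `T`.
lemma exists_norm_exp_le (T : Bˣ) {C : ℝ} {N : ℕ}
    (hT : ∀ k : ℤ, ‖((T ^ k : Bˣ) : B)‖ ≤ C * (1 + |(k : ℝ)|) ^ N)
    (q : ℂ[X]) (s : ℕ) (hq : q.natDegree ≤ 2 * s)
    (hreal : ∀ z : ℂ, ‖z‖ = 1 → ∃ r : ℝ, q.eval z = z ^ s * r) :
    ∃ (C' : ℝ) (M : ℕ), 0 ≤ C' ∧ ∀ t : ℝ,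
      ‖NormedSpace.exp ((t * Complex.I) • (((T⁻¹ ^ s : Bˣ) : B) * aeval (T : B) q))‖
        ≤ C' * (1 + |t|) ^ M := by
  set A : B := ((T⁻¹ ^ s : Bˣ) : B) * aeval (T : B) q with hA
  have hC : 0 ≤ C := by simpa using (norm_nonneg _).trans (hT 0)
  obtain ⟨R, hR⟩ : ∃ R : ℝ, ∀ z : ℂ, ‖z‖ = 1 → ‖q.eval z‖ ≤ R := by
    obtain ⟨R, hR⟩ := (isCompact_sphere (0 : ℂ) 1).exists_bound_of_continuousOn
      (f := fun z => q.eval z) (by fun_prop)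
    exact ⟨R, fun z hz => hR z (by simpa using hz)⟩
  set ρ : ℝ := max ‖A‖ R with hρ
  have hρ0 : 0 ≤ ρ := (norm_nonneg _).trans (le_max_left _ _)
  obtain ⟨κ, hκ⟩ := exists_nat_ge (3 * ρ)
  have hcomm : Commute (((T⁻¹ ^ s : Bˣ) : B)) (aeval (T : B) q) := by
    refine (Polynomial.aeval_eq_sum_range (p := q) (T : B)) ▸ Commute.sum_right _ _ _ fun i _ => ?_
    refine Commute.smul_right ?_ _
    rw [← Units.val_pow_eq_pow_val]
    exact Commute.units_val (((Commute.refl T).inv_left.pow_left s).pow_right i)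
  -- the polynomial `Q` with `Q(T) = T^(sK) E_K(itA)`
  have key : ∀ (t : ℝ) (K : ℕ), 3 * (|t| * ρ) ≤ K →
      ‖∑ k ∈ Finset.range K, ((k.factorial : ℂ)⁻¹) • ((t * Complex.I) • A) ^ k‖
        ≤ (2 * s * K + 1) * (2 * (C * (1 + s * K) ^ N)) := by
    intro t K hK
    let Q : ℂ[X] := ∑ k ∈ Finset.range K,
      Polynomial.C ((k.factorial : ℂ)⁻¹ * (t * Complex.I) ^ k) * (X ^ (s * (K - k)) * q ^ k)
    -- The truncated series is within `1` of the exponential of an imaginary number, which has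
    -- modulus `1`.
    have hQeval : ∀ z : ℂ, ‖z‖ = 1 → ‖Q.eval z‖ ≤ 2 := by
      intro z hz
      obtain ⟨r, hr⟩ := hreal z hz
      have hrR : |r| ≤ R := by
        have := hR z hz
        rw [hr, norm_mul, norm_pow, hz, one_pow, one_mul, Complex.norm_real] at this
        exact this
      have h1 : Q.eval z = z ^ (s * K) * ∑ k ∈ Finset.range K,
          ((k.factorial : ℂ)⁻¹) • ((t * Complex.I) * r) ^ k := by
        simp only [Q, Polynomial.eval_finsetSum, Finset.mul_sum]
        refine Finset.sum_congr rfl fun k hk => ?_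
        have hk' : s * K = s * (K - k) + s * k := by
          rw [← mul_add, Nat.sub_add_cancel (Finset.mem_range.1 hk).le]
        simp only [eval_mul, eval_C, eval_pow, eval_X, hr, smul_eq_mul]
        rw [hk', pow_add, pow_mul z s k]
        ring
      have h2 := norm_exp_sub_sum_le_one (B := ℂ) ((t * Complex.I) * r) (ρ := |t| * ρ) (K := K)
        (by
          rw [norm_mul, norm_mul, Complex.norm_I, mul_one, Complex.norm_real, Complex.norm_real]
          exact mul_le_mul_of_nonneg_left (hrR.trans (le_max_right _ _)) (abs_nonneg _)) hK
      have h3 : ‖NormedSpace.exp ((t * Complex.I) * r : ℂ)‖ = 1 := by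
        rw [← Complex.exp_eq_exp_ℂ]
        have : (t * Complex.I) * r = ((t * r : ℝ) : ℂ) * Complex.I := by push_cast; ring
        rw [this, Complex.norm_exp_ofReal_mul_I]
      rw [h1, norm_mul, norm_pow, hz, one_pow, one_mul]
      have := norm_le_norm_add_norm_sub' (∑ k ∈ Finset.range K,
          ((k.factorial : ℂ)⁻¹) • ((t * Complex.I) * r) ^ k) (NormedSpace.exp ((t * Complex.I) * r))
      rw [norm_sub_rev] at h2
      linarith
    have hQdeg : Q.natDegree < 2 * s * K + 1 := by
      refine Nat.lt_succ_of_le (Polynomial.natDegree_sum_le_of_forall_le _ _ fun k hk => ?_)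
      refine (Polynomial.natDegree_C_mul_le _ _).trans (Polynomial.natDegree_mul_le.trans ?_)
      refine (add_le_add (Polynomial.natDegree_X_pow_le _) (Polynomial.natDegree_pow_le.trans
        (Nat.mul_le_mul_left k hq))).trans ?_
      obtain ⟨d, rfl⟩ := Nat.exists_eq_add_of_le (Finset.mem_range.1 hk).le
      rw [Nat.add_sub_cancel_left]
      nlinarith
    have hQT : ∑ k ∈ Finset.range K, ((k.factorial : ℂ)⁻¹) • ((t * Complex.I) • A) ^ k =
        ((T⁻¹ ^ (s * K) : Bˣ) : B) * aeval (T : B) Q := by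
      simp only [Q, map_sum, Finset.mul_sum]
      refine Finset.sum_congr rfl fun k hk => ?_
      have hk' : s * K = s * k + s * (K - k) := by
        rw [← mul_add, Nat.add_sub_cancel' (Finset.mem_range.1 hk).le]
      have hx : ((T⁻¹ ^ (s * K) : Bˣ) : B) * (T : B) ^ (s * (K - k)) =
          ((T⁻¹ ^ s : Bˣ) : B) ^ k := by
        rw [← Units.val_pow_eq_pow_val, ← Units.val_pow_eq_pow_val, ← Units.val_mul, hk', pow_add,
          ← pow_mul, mul_assoc, inv_pow, inv_pow T, inv_mul_cancel, mul_one]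
      rw [← Polynomial.smul_eq_C_mul]
      simp only [map_smul, map_mul, map_pow, aeval_X]
      rw [_root_.smul_pow, smul_smul, mul_smul_comm, ← mul_assoc, hx, hA, hcomm.mul_pow]
    rw [hQT, Polynomial.aeval_eq_sum_range' hQdeg, Finset.mul_sum]
    refine (norm_sum_le _ _).trans ?_
    calc ∑ i ∈ Finset.range (2 * s * K + 1), ‖((T⁻¹ ^ (s * K) : Bˣ) : B) * (Q.coeff i • (T : B) ^ i)‖
        ≤ ∑ i ∈ Finset.range (2 * s * K + 1), 2 * (C * (1 + s * K) ^ N) := by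
          refine Finset.sum_le_sum fun i hi => ?_
          have hx : ((T⁻¹ ^ (s * K) : Bˣ) : B) * (T : B) ^ i = ((T ^ ((i : ℤ) - s * K) : Bˣ) : B) := by
            rw [← Units.val_pow_eq_pow_val, ← Units.val_mul, sub_eq_neg_add, zpow_add, zpow_neg,
              inv_pow]
            norm_cast
          rw [mul_smul_comm, hx, norm_smul]
          refine mul_le_mul (norm_coeff_le_of_norm_eval_le hQeval i) ((hT _).trans ?_)
            (norm_nonneg _) (by norm_num)
          refine mul_le_mul_of_nonneg_left (pow_le_pow_left₀ (by positivity) ?_ _) hC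
          have hi' : (i : ℝ) ≤ 2 * s * K := by
            exact_mod_cast Nat.lt_succ_iff.1 (Finset.mem_range.1 hi)
          have hi0 : (0 : ℝ) ≤ i := by positivity
          push_cast
          have : |(i : ℝ) - s * K| ≤ s * K := by rw [abs_le]; constructor <;> linarith
          linarith
      _ = (2 * s * K + 1) * (2 * (C * (1 + s * K) ^ N)) := by
          rw [Finset.sum_const, Finset.card_range, nsmul_eq_mul]; push_cast; ring
  -- The bound of `key` at `K = ⌈κ|t|⌉ ≤ (κ + 1)(1 + |t|)`. The summand `1` pays for the truncation
  -- error, and the extra power of `1 + |t|` for the number of coefficients.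
  refine ⟨1 + (2 * s * (κ + 1) + 1) * (2 * (C * (1 + s * (κ + 1)) ^ N)), N + 1, by positivity,
    fun t => ?_⟩
  obtain ⟨K, hK1, hK2⟩ : ∃ K : ℕ, 3 * (|t| * ρ) ≤ K ∧ (K : ℝ) ≤ (κ + 1) * (1 + |t|) := by
    refine ⟨⌈κ * |t|⌉₊, ?_, ?_⟩
    · refine le_trans ?_ (Nat.le_ceil _)
      nlinarith [abs_nonneg t]
    · refine (Nat.ceil_lt_add_one (by positivity)).le.trans ?_
      have : (0 : ℝ) ≤ κ := by positivity
      nlinarith [abs_nonneg t]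
  have h1 := norm_exp_sub_sum_le_one ((t * Complex.I) • A) (ρ := |t| * ρ) (K := K) (by
    rw [norm_smul, norm_mul, Complex.norm_I, mul_one, Complex.norm_real]
    exact mul_le_mul_of_nonneg_left (le_max_left _ _) (abs_nonneg _)) hK1
  have h2 := key t K hK1
  have h3 := norm_le_norm_add_norm_sub' (NormedSpace.exp ((t * Complex.I) • A))
    (∑ k ∈ Finset.range K, ((k.factorial : ℂ)⁻¹) • ((t * Complex.I) • A) ^ k)
  have ht : (1 : ℝ) ≤ 1 + |t| := by linarith [abs_nonneg t]
  have hs0 : (0 : ℝ) ≤ s := by positivity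
  have h4 : (2 * s * K + 1 : ℝ) ≤ (2 * s * (κ + 1) + 1) * (1 + |t|) := by
    have := mul_le_mul_of_nonneg_left hK2 hs0
    nlinarith
  have h5 : (1 + s * K : ℝ) ≤ (1 + s * (κ + 1)) * (1 + |t|) := by
    have := mul_le_mul_of_nonneg_left hK2 hs0
    nlinarith
  have h6 : (2 * s * K + 1) * (2 * (C * (1 + s * K) ^ N)) ≤
      ((2 * s * (κ + 1) + 1) * (1 + |t|)) * (2 * (C * ((1 + s * (κ + 1)) * (1 + |t|)) ^ N)) := by
    gcongr
  have h7 : (1 : ℝ) ≤ (1 + |t|) ^ (N + 1) := one_le_pow₀ ht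
  calc ‖NormedSpace.exp ((t * Complex.I) • A)‖
      ≤ ((2 * s * (κ + 1) + 1) * (1 + |t|)) * (2 * (C * ((1 + s * (κ + 1)) * (1 + |t|)) ^ N)) + 1 := by
        linarith
    _ = ((2 * s * (κ + 1) + 1) * (2 * (C * (1 + s * (κ + 1)) ^ N))) * (1 + |t|) ^ (N + 1) + 1 := by
        rw [mul_pow]; ring
    _ ≤ _ := by linarith

omit [NormOneClass B] in
-- Gelfand's formula: the spectral radius is zero, so `‖A ^ k‖^(1/k)` tends to `0`. The constant
-- absorbs the finitely many initial powers.
lemma exists_norm_pow_le_of_spectrum_subset_zero {A : B} (hA : spectrum ℂ A ⊆ {0}) {ε : ℝ}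
    (hε : 0 < ε) : ∃ C : ℝ, ∀ k : ℕ, ‖A ^ k‖ ≤ C * ε ^ k := by
  have h0 : spectralRadius ℂ A = 0 := by
    rw [spectralRadius]
    refine le_antisymm (iSup₂_le fun k hk => ?_) bot_le
    simp [Set.mem_singleton_iff.1 (hA hk)]
  have h1 := spectrum.pow_nnnorm_pow_one_div_tendsto_nhds_spectralRadius A
  rw [h0] at h1
  have h2 : ∀ᶠ k : ℕ in Filter.atTop, ‖A ^ k‖ ≤ ε ^ k := by
    filter_upwards [h1.eventually_lt_const (ENNReal.ofReal_pos.2 hε), Filter.eventually_gt_atTop 0]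
      with k hk hk0
    have hk0' : (0 : ℝ) < k := by exact_mod_cast hk0
    have h3 := ENNReal.rpow_le_rpow hk.le hk0'.le
    rw [← ENNReal.rpow_mul, one_div, inv_mul_cancel₀ hk0'.ne', ENNReal.rpow_one,
      ENNReal.rpow_natCast, ← ENNReal.ofReal_pow hε.le] at h3
    rw [← enorm_eq_nnnorm, ← ofReal_norm] at h3
    exact (ENNReal.ofReal_le_ofReal_iff (by positivity)).1 h3
  obtain ⟨k₀, hk₀⟩ := Filter.eventually_atTop.1 h2
  refine ⟨1 + ∑ i ∈ Finset.range k₀, ‖A ^ i‖ / ε ^ i, fun k => ?_⟩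
  have hs : 0 ≤ ∑ i ∈ Finset.range k₀, ‖A ^ i‖ / ε ^ i :=
    Finset.sum_nonneg fun i _ => by positivity
  by_cases hk : k₀ ≤ k
  · refine (hk₀ k hk).trans (le_mul_of_one_le_left (by positivity) (by linarith))
  · have := Finset.single_le_sum (f := fun i => ‖A ^ i‖ / ε ^ i) (fun i _ => by positivity)
      (Finset.mem_range.2 (not_le.1 hk))
    rw [← div_le_iff₀ (by positivity)]
    linarith

omit [NormOneClass B] in
-- Termwise comparison with `exp(ε‖z‖)`: the entire function `z ↦ exp(zA)` has exponential type
-- zero.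
lemma exists_norm_exp_smul_le {A : B} (hA : ∀ ε : ℝ, 0 < ε → ∃ C : ℝ, ∀ k : ℕ, ‖A ^ k‖ ≤ C * ε ^ k)
    {ε : ℝ} (hε : 0 < ε) :
    ∃ C : ℝ, ∀ z : ℂ, ‖NormedSpace.exp (z • A)‖ ≤ C * Real.exp (ε * ‖z‖) := by
  obtain ⟨C, hC⟩ := hA ε hε
  refine ⟨C, fun z => ?_⟩
  have hs : HasSum (fun k : ℕ => ((k.factorial : ℂ)⁻¹) • (z • A) ^ k) (NormedSpace.exp (z • A)) :=
    NormedSpace.exp_series_hasSum_exp' (𝕂 := ℂ) (z • A)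
  have hr : HasSum (fun k : ℕ => ((k.factorial : ℝ)⁻¹) • (ε * ‖z‖) ^ k)
      (Real.exp (ε * ‖z‖)) := by
    rw [Real.exp_eq_exp_ℝ]
    exact NormedSpace.exp_series_hasSum_exp' (𝕂 := ℝ) _
  rw [← hs.tsum_eq]
  refine tsum_of_norm_bounded (hr.mul_left C) (fun k => ?_)
  rw [_root_.smul_pow, norm_smul, norm_smul, norm_inv, Complex.norm_natCast, smul_eq_mul, mul_pow,
    norm_pow]
  calc (k.factorial : ℝ)⁻¹ * (‖z‖ ^ k * ‖A ^ k‖) ≤ (k.factorial : ℝ)⁻¹ * (‖z‖ ^ k * (C * ε ^ k)) := by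
        gcongr; exact hC k
    _ = _ := by ring

omit [NormOneClass B] in
/-- An exponential of type zero in the right half-plane, polynomially bounded on the imaginary
axis, is polynomially bounded. -/
lemma norm_exp_smul_le_of_re_nonneg {A : B}
    (hA : ∀ ε : ℝ, 0 < ε → ∃ C : ℝ, ∀ k : ℕ, ‖A ^ k‖ ≤ C * ε ^ k) {C : ℝ} {M : ℕ}
    (hC : ∀ t : ℝ, ‖NormedSpace.exp ((t * Complex.I) • A)‖ ≤ C * (1 + |t|) ^ M)
    {w : ℂ} (hw : 0 ≤ w.re) :
    ‖NormedSpace.exp (w • A)‖ ≤ C * 2 ^ M * ‖1 + w‖ ^ M := by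
  have hC0 : 0 ≤ C := by simpa using (norm_nonneg _).trans (hC 0)
  have hne : ∀ z : ℂ, 0 ≤ z.re → 1 ≤ ‖1 + z‖ := fun z hz => by
    have := (Complex.re_le_norm (1 + z))
    simp only [Complex.add_re, Complex.one_re] at this
    linarith
  have hne' : ∀ z : ℂ, 0 ≤ z.re → (1 + z) ≠ 0 := fun z hz h => by
    have := hne z hz
    rw [h, norm_zero] at this
    linarith
  have hexp : Differentiable ℂ fun z : ℂ => NormedSpace.exp (z • A) :=
    fun z => (hasDerivAt_exp_smul_const (𝕂 := ℂ) A z).differentiableAt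
  -- The factor `e^(-εw)` compensates the growth of type zero along the positive axis and has
  -- modulus one on the imaginary axis, where division by `(1 + w)^M` leaves a bound independent of
  -- `ε`. Phragmén-Lindelöf extends that bound to the half-plane, and then `ε → 0`.
  suffices H : ∀ ε : ℝ, 0 < ε →
      ‖Complex.exp (-(ε * w)) • ((1 + w) ^ M)⁻¹ • NormedSpace.exp (w • A)‖ ≤ C * 2 ^ M by
    have h1 : Filter.Tendsto (fun ε : ℝ =>
        ‖Complex.exp (-(ε * w)) • ((1 + w) ^ M)⁻¹ • NormedSpace.exp (w • A)‖)
        (nhdsWithin 0 (Set.Ioi 0))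
        (nhds ‖((1 + w) ^ M)⁻¹ • NormedSpace.exp (w • A)‖) := by
      refine Filter.Tendsto.mono_left ?_ nhdsWithin_le_nhds
      exact Continuous.tendsto' (by fun_prop) _ _ (by simp)
    have h2 := le_of_tendsto h1 (Filter.eventually_of_mem self_mem_nhdsWithin fun ε hε => H ε hε)
    rw [norm_smul, norm_inv, norm_pow, inv_mul_le_iff₀ (by have := hne w hw; positivity)] at h2
    linarith
  intro ε hε
  have hd : DiffContOnCl ℂ (fun z : ℂ => Complex.exp (-(ε * z)) • ((1 + z) ^ M)⁻¹ •
      NormedSpace.exp (z • A)) {z | 0 < z.re} := by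
    apply DifferentiableOn.diffContOnCl
    rw [Complex.closure_setOfPred_lt_re]
    intro z hz
    refine DifferentiableAt.differentiableWithinAt ?_
    refine DifferentiableAt.smul (c := fun z : ℂ => Complex.exp (-(ε * z))) (by fun_prop)
      (DifferentiableAt.smul (c := fun z : ℂ => ((1 + z) ^ M)⁻¹) ?_ (hexp z))
    exact DifferentiableAt.inv (by fun_prop) (pow_ne_zero _ (hne' z hz))
  have hnorm : ∀ z : ℂ, 0 ≤ z.re → ‖Complex.exp (-(ε * z)) • ((1 + z) ^ M)⁻¹ •
      NormedSpace.exp (z • A)‖ ≤ Real.exp (-(ε * z.re)) * ‖NormedSpace.exp (z • A)‖ := by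
    intro z hz
    rw [norm_smul, norm_smul, Complex.norm_exp]
    simp only [Complex.neg_re, Complex.re_ofReal_mul]
    refine mul_le_mul_of_nonneg_left (mul_le_of_le_one_left (norm_nonneg _) ?_) (by positivity)
    rw [norm_inv, norm_pow]
    exact inv_le_one_of_one_le₀ (one_le_pow₀ (hne z hz))
  obtain ⟨D, hD⟩ := exists_norm_exp_smul_le hA hε
  have hD0 : 0 ≤ D := by simpa using (norm_nonneg _).trans (hD 0)
  refine PhragmenLindelof.right_half_plane_of_bounded_on_real hd
    ⟨1, by norm_num, ε, ?_⟩ ?_ ?_ hw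
  · refine Asymptotics.IsBigO.of_bound D ?_
    refine Filter.eventually_inf_principal.2 (Filter.Eventually.of_forall fun z hz => ?_)
    have hz' : 0 ≤ z.re := le_of_lt hz
    refine (hnorm z hz').trans ?_
    rw [Real.rpow_one, Real.norm_of_nonneg (Real.exp_pos _).le]
    refine (mul_le_of_le_one_left (norm_nonneg _) (Real.exp_le_one_iff.2 ?_)).trans (hD z)
    have := mul_nonneg hε.le hz'
    linarith
  · refine ⟨D, Filter.eventually_map.2 ?_⟩
    filter_upwards [Filter.eventually_ge_atTop 0] with x hx
    refine (hnorm x (by simpa using hx)).trans ?_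
    have h3 := hD x
    rw [Complex.norm_real, Real.norm_of_nonneg hx] at h3
    calc Real.exp (-(ε * (x : ℂ).re)) * ‖NormedSpace.exp ((x : ℂ) • A)‖
        ≤ Real.exp (-(ε * x)) * (D * Real.exp (ε * x)) := by
          rw [Complex.ofReal_re]; gcongr
      _ = D := by rw [mul_left_comm, ← Real.exp_add]; simp
  · intro y
    refine (norm_smul _ _).le.trans ?_
    have h1 : ‖Complex.exp (-(ε * (y * Complex.I)))‖ = 1 := by
      rw [Complex.norm_exp]; simp
    rw [h1, one_mul, norm_smul, norm_inv, norm_pow]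
    -- The source of the factor `2 ^ M` in the bound.
    have h2 : (1 + |y|) / 2 ≤ ‖1 + y * Complex.I‖ := by
      have ha := Complex.abs_re_le_norm (1 + y * Complex.I)
      have hb := Complex.abs_im_le_norm (1 + y * Complex.I)
      simp at ha hb
      linarith
    have h3 : ((1 + |y|) / 2) ^ M ≤ ‖1 + y * Complex.I‖ ^ M :=
      pow_le_pow_left₀ (by positivity) h2 M
    rw [inv_mul_le_iff₀ (by have := hne (y * Complex.I) (by simp); positivity)]
    refine (hC y).trans ?_
    calc C * (1 + |y|) ^ M = ((1 + |y|) / 2) ^ M * (C * 2 ^ M) := by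
          rw [div_pow]; field_simp
      _ ≤ _ := mul_le_mul_of_nonneg_right h3 (by positivity)

omit [NormOneClass B] in
lemma iteratedDeriv_exp_smul (A : B) (k : ℕ) :
    iteratedDeriv k (fun z : ℂ => NormedSpace.exp (z • A)) =
      fun z => NormedSpace.exp (z • A) * A ^ k := by
  induction k with
  | zero => simp
  | succ k ih =>
    rw [iteratedDeriv_succ, ih]
    funext z
    have := (hasDerivAt_exp_smul_const (𝕂 := ℂ) A z).mul_const (A ^ k)
    rw [this.deriv, mul_assoc, pow_succ']

omit [NormOneClass B] in
/-- A quasinilpotent element generating a group of polynomial growth is nilpotent. -/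
lemma isNilpotent_of_norm_exp_le {A : B}
    (hA : ∀ ε : ℝ, 0 < ε → ∃ C : ℝ, ∀ k : ℕ, ‖A ^ k‖ ≤ C * ε ^ k) {C : ℝ} {M : ℕ}
    (hC : ∀ t : ℝ, ‖NormedSpace.exp ((t * Complex.I) • A)‖ ≤ C * (1 + |t|) ^ M) :
    IsNilpotent A := by
  have hC0 : 0 ≤ C := by simpa using (norm_nonneg _).trans (hC 0)
  have hexp : Differentiable ℂ fun z : ℂ => NormedSpace.exp (z • A) :=
    fun z => (hasDerivAt_exp_smul_const (𝕂 := ℂ) A z).differentiableAt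
  -- The left half-plane is the right one for `-A`.
  have hb : ∀ w : ℂ, ‖NormedSpace.exp (w • A)‖ ≤ C * 2 ^ M * (1 + ‖w‖) ^ M := by
    intro w
    rcases le_total 0 w.re with hw | hw
    · refine (norm_exp_smul_le_of_re_nonneg hA hC hw).trans ?_
      gcongr
      simpa using norm_add_le 1 w
    · have h1 := norm_exp_smul_le_of_re_nonneg (A := -A) (C := C) (M := M) (w := -w)
        (fun ε hε => by
          obtain ⟨C, hC⟩ := hA ε hε
          refine ⟨C, fun k => ?_⟩
          rcases Nat.even_or_odd k with hk | hk
          · rw [hk.neg_pow]; exact hC k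
          · rw [hk.neg_pow, norm_neg]; exact hC k)
        (fun t => by
          have := hC (-t)
          rw [abs_neg] at this
          convert this using 3
          push_cast
          rw [smul_neg, neg_mul, neg_smul]) (by simpa using hw)
      rw [smul_neg, neg_smul, neg_neg] at h1
      refine h1.trans ?_
      gcongr
      simpa using norm_add_le 1 (-w)
  refine ⟨M + 1, ?_⟩
  rw [← norm_le_zero_iff]
  -- Cauchy's estimate: `A ^ (M + 1)` is the derivative of order `M + 1` at `0` of an entire
  -- function of growth `R ^ M`, hence `O(1/R)`.
  have h2 : ∀ R : ℝ, 1 ≤ R → ‖A ^ (M + 1)‖ ≤ ((M + 1).factorial * (C * 2 ^ M) * 2 ^ M) / R := by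
    intro R hR
    have hR0 : 0 < R := by linarith
    have h3 := Complex.norm_iteratedDeriv_le_of_forall_mem_sphere_norm_le (M + 1) hR0
      (hexp.diffContOnCl (s := Metric.ball 0 R)) (C := C * 2 ^ M * (2 * R) ^ M) (fun z hz => by
        have hz' : ‖z‖ = R := by simpa using hz
        refine (hb z).trans ?_
        rw [hz']
        gcongr
        linarith)
    rw [iteratedDeriv_exp_smul] at h3
    simp only [zero_smul, NormedSpace.exp_zero, one_mul] at h3
    refine h3.trans (le_of_eq ?_)
    rw [mul_pow, pow_succ]
    field_simp
  refine ge_of_tendsto' (x := Filter.atTop)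
    (f := fun k : ℕ => ((M + 1).factorial * (C * 2 ^ M) * 2 ^ M) / ((k : ℝ) + 1)) ?_ fun k => ?_
  · exact tendsto_const_nhds.div_atTop
      (Filter.tendsto_atTop_add_const_right _ _ tendsto_natCast_atTop_atTop)
  · exact h2 _ (by have : (0 : ℝ) ≤ k := by positivity
                   linarith)

open Polynomial in
/-- An invertible element of a Banach algebra with powers of polynomial growth whose spectrum is
contained in a finite subset of the unit circle is algebraic, with roots in this set. -/
theorem exists_prod_sub_pow_eq_zero (T : Bˣ) {C : ℝ} {N : ℕ}
    (hT : ∀ k : ℤ, ‖((T ^ k : Bˣ) : B)‖ ≤ C * (1 + |(k : ℝ)|) ^ N)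
    (S : Finset ℂ) (hS : ∀ z ∈ S, ‖z‖ = 1) (hspec : spectrum ℂ (T : B) ⊆ S) :
    ∃ M : ℕ, aeval (T : B) ((∏ z ∈ S, (X - Polynomial.C z)) ^ M) = 0 := by
  set p : ℂ[X] := ∏ z ∈ S, (X - Polynomial.C z) with hp
  -- For `z`, `w` on the unit circle, `-w̄ (z - w)² = z |z - w|²`. Squaring `p` and multiplying by
  -- `γ` thus makes `q(z) = z^|S|` times a real number.
  set γ : ℂ := ∏ z ∈ S, (-star z) with hγ
  have hγ0 : γ ≠ 0 := by
    refine Finset.prod_ne_zero_iff.2 fun z hz => ?_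
    rw [neg_ne_zero, star_ne_zero]
    rintro rfl
    simpa using hS 0 hz
  set q : ℂ[X] := Polynomial.C γ * p ^ 2 with hq
  have hpdeg : p.natDegree = S.card := by
    rw [hp, Polynomial.natDegree_prod_of_monic _ _ fun z _ => Polynomial.monic_X_sub_C z]
    simp
  have hqdeg : q.natDegree ≤ 2 * S.card := by
    refine (Polynomial.natDegree_C_mul_le _ _).trans (Polynomial.natDegree_pow_le.trans ?_)
    rw [hpdeg]
  have hreal : ∀ z : ℂ, ‖z‖ = 1 → ∃ r : ℝ, q.eval z = z ^ S.card * r := by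
    intro z hz
    refine ⟨∏ w ∈ S, ‖z - w‖ ^ 2, ?_⟩
    have : q.eval z = ∏ w ∈ S, (-star w) * (z - w) ^ 2 := by
      rw [hq, hγ, hp, Finset.prod_mul_distrib, Finset.prod_pow]
      simp [Polynomial.eval_prod]
    rw [this, ← Finset.prod_const, Complex.ofReal_prod, ← Finset.prod_mul_distrib]
    refine Finset.prod_congr rfl fun w hw => ?_
    have h1 : z * star z = 1 := by
      rw [Complex.star_def, Complex.mul_conj, Complex.normSq_eq_norm_sq, hz]; simp
    have h2 : w * star w = 1 := by
      rw [Complex.star_def, Complex.mul_conj, Complex.normSq_eq_norm_sq, hS w hw]; simp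
    have h3 : ((‖z - w‖ ^ 2 : ℝ) : ℂ) = (z - w) * (star z - star w) := by
      rw [← Complex.normSq_eq_norm_sq, ← Complex.mul_conj, map_sub]; rfl
    rw [h3]
    linear_combination (-(z - w)) * h1 + (z - w) * h2
  obtain ⟨C', M, hC', hM⟩ := exists_norm_exp_le T hT q S.card hqdeg hreal
  have : Nontrivial B := NormOneClass.nontrivial
  have hspecq : spectrum ℂ (aeval (T : B) q) ⊆ {0} := by
    rw [spectrum.map_polynomial_aeval]
    rintro _ ⟨z, hz, rfl⟩
    have : p.eval z = 0 := by
      rw [hp, Polynomial.eval_prod]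
      exact Finset.prod_eq_zero (hspec hz) (by simp)
    simp [hq, this]
  have hcomm : Commute (((T⁻¹ ^ S.card : Bˣ) : B)) (aeval (T : B) q) := by
    refine (Polynomial.aeval_eq_sum_range (p := q) (T : B)) ▸ Commute.sum_right _ _ _ fun i _ => ?_
    refine Commute.smul_right ?_ _
    rw [← Units.val_pow_eq_pow_val]
    exact Commute.units_val (((Commute.refl T).inv_left.pow_left _).pow_right i)
  have hC0 : 0 ≤ C := by simpa using (norm_nonneg _).trans (hT 0)
  -- Multiplying the quasinilpotent `q(T)` by a commuting power of `T` keeps it quasinilpotent,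
  -- since the powers of `T` grow only polynomially.
  have hA : ∀ ε : ℝ, 0 < ε → ∃ D : ℝ, ∀ k : ℕ,
      ‖(((T⁻¹ ^ S.card : Bˣ) : B) * aeval (T : B) q) ^ k‖ ≤ D * ε ^ k := by
    intro ε hε
    -- the polynomial factor is absorbed by halving `ε`
    obtain ⟨D, hD⟩ := exists_norm_pow_le_of_spectrum_subset_zero hspecq (half_pos hε)
    have hD0 : 0 ≤ D := by simpa using (norm_nonneg _).trans (hD 0)
    obtain ⟨E, hE⟩ : ∃ E : ℝ, ∀ k : ℕ, (1 + S.card * (k : ℝ)) ^ N * (1 / 2) ^ k ≤ E := by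
      have h1 := (tendsto_pow_const_mul_const_pow_of_abs_lt_one N
        (r := (1 / 2 : ℝ)) (by rw [abs_of_pos] <;> norm_num)).comp (Filter.tendsto_add_atTop_nat 1)
      obtain ⟨E, hE⟩ := h1.bddAbove_range
      refine ⟨(1 + S.card) ^ N * (2 * E), fun k => ?_⟩
      have h2 := hE (Set.mem_range_self k)
      simp only [Function.comp] at h2
      have h3 : (1 + S.card * (k : ℝ)) ≤ (1 + S.card) * ((k + 1 : ℕ) : ℝ) := by
        push_cast
        have : (0 : ℝ) ≤ k := by positivity
        have : (0 : ℝ) ≤ S.card := by positivity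
        nlinarith
      calc (1 + S.card * (k : ℝ)) ^ N * (1 / 2) ^ k
          ≤ ((1 + S.card) * ((k + 1 : ℕ) : ℝ)) ^ N * (1 / 2) ^ k := by gcongr
        _ = (1 + S.card) ^ N * (2 * (((k + 1 : ℕ) : ℝ) ^ N * (1 / 2) ^ (k + 1))) := by
            rw [mul_pow, pow_succ (1 / 2 : ℝ)]; ring
        _ ≤ _ := by gcongr
    refine ⟨C * E * D, fun k => ?_⟩
    rw [hcomm.mul_pow, ← Units.val_pow_eq_pow_val]
    refine (norm_mul_le _ _).trans ?_
    have h1 : ‖(((T⁻¹ ^ S.card) ^ k : Bˣ) : B)‖ ≤ C * (1 + S.card * (k : ℝ)) ^ N := by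
      have := hT (-(S.card * k : ℕ))
      rw [zpow_neg, zpow_natCast, ← inv_pow, pow_mul] at this
      simpa using this
    calc ‖(((T⁻¹ ^ S.card) ^ k : Bˣ) : B)‖ * ‖aeval (T : B) q ^ k‖
        ≤ (C * (1 + S.card * (k : ℝ)) ^ N) * (D * (ε / 2) ^ k) :=
          mul_le_mul h1 (hD k) (norm_nonneg _) (by positivity)
      _ = C * ((1 + S.card * (k : ℝ)) ^ N * (1 / 2) ^ k) * D * ε ^ k := by
          rw [div_pow, div_pow]; ring
      _ ≤ C * E * D * ε ^ k := by gcongr; exact hE k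
  obtain ⟨k, hk⟩ := isNilpotent_of_norm_exp_le hA hM
  refine ⟨2 * k, ?_⟩
  rw [hcomm.mul_pow, ← Units.val_pow_eq_pow_val] at hk
  have h1 : aeval (T : B) q ^ k = 0 := by
    rwa [Units.mul_right_eq_zero] at hk
  have h2 : aeval (T : B) q ^ k = γ ^ k • aeval (T : B) (p ^ (2 * k)) := by
    rw [← map_pow, hq, mul_pow, ← pow_mul, ← Polynomial.C_pow, ← Polynomial.smul_eq_C_mul, map_smul]
  rw [h2] at h1
  exact (smul_eq_zero.1 h1).resolve_left (pow_ne_zero _ hγ0)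

end BanachAlgebra

end PeriodicGraph

/-! ### The symbol of a periodic operator over the group algebra -/

namespace PeriodicGraph

noncomputable section

open scoped Classical

variable {G V : Type*} [AddCommGroup G] [AddAction G V] {n : ℕ}

/-! ### Orbits and shifts -/

lemma shift_vadd_out (v : V) : shift G v +ᵥ (Quotient.out (Quotient.mk _ v : Orbits G V) : V) = v :=
  (exists_shift (G := G) v).choose_spec

lemma mk_vadd (g : G) (v : V) : (Quotient.mk _ (g +ᵥ v) : Orbits G V) = Quotient.mk _ v :=
  Quotient.sound (AddAction.orbitRel_apply.2 ⟨g, rfl⟩)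

lemma mk_vadd_out (g : G) (q : Orbits G V) :
    (Quotient.mk _ (g +ᵥ (Quotient.out q : V)) : Orbits G V) = q := by
  rw [mk_vadd, Quotient.out_eq]

lemma vadd_left_cancel_of_free (hfree : ∀ (g : G) (v : V), g +ᵥ v = v → g = 0) {g h : G} {v : V}
    (H : g +ᵥ v = h +ᵥ v) : g = h := by
  have : (-h + g) +ᵥ v = v := by rw [add_vadd, H, neg_vadd_vadd]
  have := hfree _ _ this
  rw [neg_add_eq_zero] at this
  exact this.symm

lemma shift_vadd (hfree : ∀ (g : G) (v : V), g +ᵥ v = v → g = 0) (g : G) (v : V) :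
    shift G (g +ᵥ v) = g + shift G v := by
  have h1 := shift_vadd_out (G := G) (g +ᵥ v)
  rw [mk_vadd] at h1
  refine vadd_left_cancel_of_free hfree (v := (Quotient.out (Quotient.mk _ v : Orbits G V) : V)) ?_
  rw [h1, add_vadd, shift_vadd_out]

lemma shift_vadd_out_eq (hfree : ∀ (g : G) (v : V), g +ᵥ v = v → g = 0) (g : G)
    (q : Orbits G V) : shift G (g +ᵥ (Quotient.out q : V)) = g := by
  have h1 := shift_vadd_out (G := G) (Quotient.out q : V)
  rw [Quotient.out_eq] at h1
  rw [shift_vadd hfree, hfree _ _ h1, add_zero]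

lemma funext_orbits {α : Type*} {u w : V → α}
    (h : ∀ (g : G) (q : Orbits G V), u (g +ᵥ (Quotient.out q : V)) = w (g +ᵥ (Quotient.out q : V))) :
    u = w := by
  funext v
  rw [← shift_vadd_out (G := G) v]
  exact h _ _

/-! ### Local finiteness and the coefficients of a periodic operator -/

/-- An edge at `v` is a translate `g e` with `e` in the finite set `S`. By freeness `g` is
determined by the endpoint of `e` that it moves to `v`, so only finitely many `g` occur. -/
lemma finite_neighbors {Γ : SimpleGraph V} (hΓ : IsFreeCocompact G Γ) (v : V) :
    {w | Γ.Adj v w}.Finite := by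
  obtain ⟨S, hS, hcov⟩ := hΓ.finite_edges
  have hg : {g : G | ∃ e ∈ S, ∃ x ∈ e, g +ᵥ x = v}.Finite := by
    have hx : {x : V | ∃ e ∈ S, x ∈ e}.Finite := by
      have : {x : V | ∃ e ∈ S, x ∈ e} = ⋃ e ∈ S, (e.toFinset : Set V) := by
        ext x; simp
      rw [this]
      exact hS.biUnion fun e _ => Finset.finite_toSet _
    refine Set.Finite.of_finite_fibers (f := fun g : G => (-g) +ᵥ v) (hx.subset ?_) ?_
    · rintro _ ⟨g, ⟨e, he, x, hxe, rfl⟩, rfl⟩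
      exact ⟨e, he, by simpa using hxe⟩
    · intro x _
      refine Set.Subsingleton.finite ?_
      rintro g ⟨-, hg⟩ h ⟨-, hh⟩
      have : (-g) +ᵥ v = (-h) +ᵥ v := by
        rw [Set.mem_preimage, Set.mem_singleton_iff] at hg hh
        rw [hg, hh]
      exact neg_injective (vadd_left_cancel_of_free hΓ.free this)
  have : {w | Γ.Adj v w} ⊆ ⋃ g ∈ {g : G | ∃ e ∈ S, ∃ x ∈ e, g +ᵥ x = v}, ⋃ e ∈ S,
      ((Sym2.map (fun x => g +ᵥ x) e).toFinset : Set V) := by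
    intro w hw
    obtain ⟨g, e, he, h⟩ := hcov s(v, w) hw
    have hv : v ∈ Sym2.map (fun x => g +ᵥ x) e := h ▸ Sym2.mem_mk_left v w
    obtain ⟨x, hx, hxv⟩ := Sym2.mem_map.1 hv
    simp only [Set.mem_iUnion]
    refine ⟨g, ⟨e, he, x, hx, hxv⟩, e, he, ?_⟩
    simp only [Finset.mem_coe, Sym2.mem_toFinset]
    exact h ▸ Sym2.mem_mk_right v w
  exact (hg.biUnion fun g _ => hS.biUnion fun e _ => Finset.finite_toSet _).subset this

lemma finite_ball {Γ : SimpleGraph V} (hΓ : IsFreeCocompact G Γ) (m : ℕ) (v : V) :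
    {w | Γ.edist v w ≤ m}.Finite := by
  have key : ∀ (m : ℕ) (v : V), {w | ∃ p : Γ.Walk v w, p.length ≤ m}.Finite := by
    intro m
    induction m with
    | zero =>
      intro v
      refine (Set.finite_singleton v).subset ?_
      rintro w ⟨p, hp⟩
      exact (SimpleGraph.Walk.eq_of_length_eq_zero (Nat.le_zero.1 hp)).symm
    | succ m ih =>
      intro v
      refine ((Set.finite_singleton v).union
        ((finite_neighbors hΓ v).biUnion fun x _ => ih x)).subset ?_
      rintro w ⟨p, hp⟩
      cases p with
      | nil => exact Or.inl rfl
      | cons h p =>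
        refine Or.inr (Set.mem_biUnion h ⟨p, ?_⟩)
        simpa using hp
  refine (key m v).subset fun w hw => ?_
  have hw' : Γ.edist v w ≤ m := hw
  have hne : Γ.edist v w ≠ ⊤ := ne_top_of_le_ne_top (ENat.natCast_ne_top m) hw'
  obtain ⟨p, hp⟩ := SimpleGraph.exists_walk_of_edist_ne_top hne
  exact ⟨p, by rw [← hp] at hw'; exact_mod_cast hw'⟩

/-- The coefficients of a linear operator on functions. -/
def kernelCoeff (P : (V → ℂ) →ₗ[ℂ] (V → ℂ)) (v w : V) : ℂ := P (Pi.single w 1) v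

/-- Testing `P` on indicator functions recovers the coefficients. They are therefore intrinsic to
`P`, with finite rows because balls are finite. -/
lemma IsDifferenceOperator.finite_and_apply {Γ : SimpleGraph V} (hΓ : IsFreeCocompact G Γ) {m : ℕ}
    {P : (V → ℂ) →ₗ[ℂ] (V → ℂ)} (hP : IsDifferenceOperator Γ m P) :
    (∀ v, (Function.support (kernelCoeff P v)).Finite) ∧
      ∀ u v, P u v = ∑ᶠ w, kernelCoeff P v w * u w := by
  obtain ⟨a, ha, hPa⟩ := hP
  have hk : ∀ v w, kernelCoeff P v w = a v w := by
    intro v w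
    rw [kernelCoeff, hPa, finsum_eq_single _ w fun x hx => by rw [Pi.single_eq_of_ne hx, mul_zero]]
    simp
  refine ⟨fun v => (finite_ball hΓ m v).subset fun w hw => ha v w ?_, fun u v => ?_⟩
  · rwa [← hk]
  · simp only [hPa, hk]

lemma kernelCoeff_vadd {P : (V → ℂ) →ₗ[ℂ] (V → ℂ)} (hP : IsPeriodicOperator G P) (g : G) (v w : V) :
    kernelCoeff P (g +ᵥ v) (g +ᵥ w) = kernelCoeff P v w := by
  have h := congrFun (hP g (Pi.single (g +ᵥ w) 1)) v
  rw [kernelCoeff, ← h, kernelCoeff]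
  refine congrFun (congrArg P (funext fun x => ?_)) v
  by_cases hx : x = w
  · simp [hx]
  · rw [Pi.single_eq_of_ne hx, Pi.single_eq_of_ne fun h => hx (vadd_left_cancel g h)]

variable [Fintype (Orbits G V)]

/-- `D` is the matrix over the group algebra describing the periodic operator `P` in terms of the
chosen representatives of the orbits. -/
structure HasSymbol (P : (V → ℂ) →ₗ[ℂ] (V → ℂ))
    (D : Matrix (Orbits G V) (Orbits G V) (AddMonoidAlgebra ℂ G)) : Prop where
  coeff_eq : ∀ p q h, (D p q).coeff h = kernelCoeff P (Quotient.out p) (h +ᵥ Quotient.out q)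
  apply_eq : ∀ (u : V → ℂ) (g : G) (p : Orbits G V), P u (g +ᵥ (Quotient.out p : V)) =
    ∑ q, (D p q).coeff.sum fun h a => a * u (h +ᵥ g +ᵥ (Quotient.out q : V))
  kernel_vadd : ∀ (g : G) (v w : V), kernelCoeff P (g +ᵥ v) (g +ᵥ w) = kernelCoeff P v w

/-- The parametrization of the vertices by the group and the orbits. -/
def vertexEquiv (hfree : ∀ (g : G) (v : V), g +ᵥ v = v → g = 0) : Orbits G V × G ≃ V where
  toFun x := x.2 +ᵥ (Quotient.out x.1 : V)
  invFun v := (Quotient.mk _ v, shift G v)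
  left_inv _ := Prod.ext (mk_vadd_out _ _) (shift_vadd_out_eq hfree _ _)
  right_inv v := shift_vadd_out v

lemma finsum_orbits (hfree : ∀ (g : G) (v : V), g +ᵥ v = v → g = 0) {f : V → ℂ}
    (hf : (Function.support f).Finite) :
    ∑ᶠ v, f v = ∑ q : Orbits G V, ∑ᶠ g : G, f (g +ᵥ (Quotient.out q : V)) := by
  rw [← finsum_comp_equiv (vertexEquiv hfree), finsum_curry _ (hf.preimage
    (vertexEquiv hfree).injective.injOn), finsum_eq_sum_of_fintype]
  rfl

/-- By freeness `h ↦ h +ᵥ out q` is injective, so a finite row of coefficients becomes one finitely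
supported element of the group algebra for each orbit. -/
lemma exists_hasSymbol {Γ : SimpleGraph V} (hΓ : IsFreeCocompact G Γ) {m : ℕ}
    {P : (V → ℂ) →ₗ[ℂ] (V → ℂ)} (hP : IsDifferenceOperator Γ m P) (hPper : IsPeriodicOperator G P) :
    ∃ D : Matrix (Orbits G V) (Orbits G V) (AddMonoidAlgebra ℂ G), HasSymbol P D := by
  obtain ⟨hfin, happ⟩ := hP.finite_and_apply hΓ
  have hf : ∀ p q : Orbits G V, (Function.support fun h : G =>
      kernelCoeff P (Quotient.out p) (h +ᵥ Quotient.out q)).Finite := fun p q =>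
    (hfin (Quotient.out p)).preimage (f := fun h : G => h +ᵥ Quotient.out q)
      fun g _ h _ H => vadd_left_cancel_of_free hΓ.free H
  refine ⟨Matrix.of fun p q => AddMonoidAlgebra.ofCoeff (Finsupp.ofSupportFinite _ (hf p q)),
    fun p q h => rfl, fun u g p => ?_, kernelCoeff_vadd hPper⟩
  have h1 : P u (g +ᵥ (Quotient.out p : V)) = P (fun v => u (g +ᵥ v)) (Quotient.out p) :=
    (congrFun (hPper g u) _).symm
  rw [h1, happ, finsum_orbits hΓ.free
    ((hfin (Quotient.out p)).subset (Function.support_mul_subset_left _ _))]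
  refine Finset.sum_congr rfl fun q _ => ?_
  rw [Finsupp.sum, ← finsum_eq_sum_of_support_subset]
  · refine finsum_congr fun h => ?_
    rw [vadd_comm h g]
    rfl
  · intro h hh
    rw [Finset.mem_coe, Finsupp.mem_support_iff]
    exact left_ne_zero_of_mul hh

/-! ### The action of the group algebra -/

/-- Translations of functions. -/
def translHom : Multiplicative G →* Module.End ℂ (V → ℂ) where
  toFun g := LinearMap.funLeft ℂ ℂ fun v => Multiplicative.toAdd g +ᵥ v
  map_one' := by ext u v; simp [LinearMap.funLeft_apply]
  map_mul' g h := by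
    ext u v
    simp only [LinearMap.funLeft_apply, toAdd_mul, Module.End.mul_apply, ← add_vadd]
    rw [add_comm]

/-- The translation of functions by a group element. -/
abbrev transl (g : G) : Module.End ℂ (V → ℂ) := translHom (Multiplicative.ofAdd g)

omit [Fintype (Orbits G V)] in
lemma transl_apply (g : G) (u : V → ℂ) (v : V) : transl g u v = u (g +ᵥ v) := rfl

/-- The action of the group algebra on functions. -/
def groupAct : AddMonoidAlgebra ℂ G →ₐ[ℂ] Module.End ℂ (V → ℂ) :=
  AddMonoidAlgebra.lift ℂ _ G translHom

omit [Fintype (Orbits G V)] in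
lemma groupAct_apply (r : AddMonoidAlgebra ℂ G) (u : V → ℂ) (v : V) :
    groupAct r u v = r.coeff.sum fun h a => a * u (h +ᵥ v) := by
  rw [groupAct, AddMonoidAlgebra.lift_apply, Finsupp.sum, LinearMap.sum_apply, Finset.sum_apply]
  rfl

omit [Fintype (Orbits G V)] in
lemma groupAct_orbit (r : AddMonoidAlgebra ℂ G) (u : V → ℂ) (v : V) :
    (fun g : G => groupAct r u (g +ᵥ v)) = groupAct r fun g : G => u (g +ᵥ v) := by
  funext g
  rw [groupAct_apply, groupAct_apply]
  refine Finsupp.sum_congr fun h _ => ?_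
  rw [vadd_eq_add, add_vadd]

/-- Solutions are annihilated by the determinant of the symbol. -/
lemma HasSymbol.groupAct_det {P : (V → ℂ) →ₗ[ℂ] (V → ℂ)}
    {D : Matrix (Orbits G V) (Orbits G V) (AddMonoidAlgebra ℂ G)} (hD : HasSymbol P D) {u : V → ℂ}
    (hu : P u = 0) : groupAct D.det u = 0 := by
  have h1 : ∀ p, ∑ q, groupAct (D p q) (fun g : G => u (g +ᵥ (Quotient.out q : V))) = 0 := by
    intro p
    funext g
    have := congrFun hu (g +ᵥ (Quotient.out p : V))
    rw [hD.apply_eq] at this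
    rw [Finset.sum_apply]
    refine Eq.trans (Finset.sum_congr rfl fun q _ => ?_) this
    rw [← groupAct_orbit]
    exact groupAct_apply _ _ _
  have h2 : ∀ q : Orbits G V, groupAct D.det (fun g : G => u (g +ᵥ (Quotient.out q : V))) = 0 := by
    intro q'
    -- Cramer's rule: the adjugate is applied to the system satisfied by the restrictions of `u` to
    -- the orbits.
    have h3 : ∑ p, groupAct (D.adjugate q' p)
        (∑ q, groupAct (D p q) (fun g : G => u (g +ᵥ (Quotient.out q : V)))) = 0 := by
      simp [h1]
    simp only [map_sum, ← Module.End.mul_apply, ← map_mul] at h3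
    rw [Finset.sum_comm] at h3
    have h4 : ∀ q : Orbits G V, ∑ p, groupAct (D.adjugate q' p * D p q)
        (fun g : G => u (g +ᵥ (Quotient.out q : V))) =
        groupAct ((D.det • (1 : Matrix (Orbits G V) (Orbits G V) (AddMonoidAlgebra ℂ G))) q' q)
          (fun g : G => u (g +ᵥ (Quotient.out q : V))) := by
      intro q
      rw [← Matrix.adjugate_mul, Matrix.mul_apply, map_sum, LinearMap.sum_apply]
    simp only [h4] at h3
    rw [Finset.sum_eq_single q' (fun q _ hq => by simp [Matrix.one_apply_ne hq.symm])
      (by simp)] at h3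
    simpa using h3
  refine funext_orbits (G := G) fun g q => ?_
  have := congrFun (groupAct_orbit D.det u (Quotient.out q : V)) g
  rw [this, h2 q]
  rfl

/-! ### Characters and the Bloch matrices -/

/-- The character `χ γ_k` as a homomorphism. -/
def twistHom (c : G →+ (Fin n → ℤ)) (χ : AddChar G Circle) (k : Fin n → ℂ) :
    Multiplicative G →* ℂ where
  toFun g := twist c χ k (Multiplicative.toAdd g)
  map_one' := by simp [twist]
  map_mul' g h := by
    simp only [twist, toAdd_mul, AddChar.map_add_eq_mul, map_add, Pi.add_apply, Int.cast_add,
      mul_add, Finset.sum_add_distrib, Complex.exp_add, Circle.coe_mul]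
    ring

/-- The matrix of `P` on the automorphic functions with character `χ γ_k`. -/
def bloch (c : G →+ (Fin n → ℤ)) (D : Matrix (Orbits G V) (Orbits G V) (AddMonoidAlgebra ℂ G))
    (χ : AddChar G Circle) (k : Fin n → ℂ) : Matrix (Orbits G V) (Orbits G V) ℂ :=
  D.map (AddMonoidAlgebra.lift ℂ ℂ G (twistHom c χ k))

omit [Fintype (Orbits G V)] in
lemma bloch_apply (c : G →+ (Fin n → ℤ))
    (D : Matrix (Orbits G V) (Orbits G V) (AddMonoidAlgebra ℂ G))
    (χ : AddChar G Circle) (k : Fin n → ℂ) (p q : Orbits G V) :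
    bloch c D χ k p q = (D p q).coeff.sum fun h a => a * twist c χ k h := by
  rw [bloch, Matrix.map_apply, AddMonoidAlgebra.lift_apply]
  rfl

omit [Fintype (Orbits G V)] in
lemma twist_inv_neg (c : G →+ (Fin n → ℤ)) (χ : AddChar G Circle) (k : Fin n → ℂ) (g : G) :
    twist c χ⁻¹ (-k) (-g) = twist c χ k g := by
  simp [twist, AddChar.inv_apply, map_neg]

/-- Transposing the coefficients replaces the group element `h` by `-h`, and inverting the character
undoes this sign. Only the exchange of the two orbits remains. -/
lemma HasSymbol.dualBloch_eq {P : (V → ℂ) →ₗ[ℂ] (V → ℂ)}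
    {D : Matrix (Orbits G V) (Orbits G V) (AddMonoidAlgebra ℂ G)} (hD : HasSymbol P D)
    (hfree : ∀ (g : G) (v : V), g +ᵥ v = v → g = 0) (c : G →+ (Fin n → ℤ)) (χ : AddChar G Circle)
    (k : Fin n → ℂ) : dualBloch c P χ k = (bloch c D χ k).transpose := by
  ext p q
  rw [Matrix.transpose_apply, bloch_apply, dualBloch, blochMatrix, Matrix.of_apply, dualOp]
  have hx : ∀ h : G, kernelCoeff P ((-h) +ᵥ (Quotient.out q : V)) (Quotient.out p) =
      (D q p).coeff h := by
    intro h
    rw [hD.coeff_eq, ← hD.kernel_vadd h, vadd_neg_vadd]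
  have hsupp : (Function.support fun w => P (Pi.single (Quotient.out p : V) 1) w *
      autoExt (twist c χ⁻¹ (-k)) (Pi.single q 1) w).Finite := by
    refine ((D q p).coeff.support.finite_toSet.image
      fun h : G => (-h) +ᵥ (Quotient.out q : V)).subset fun w hw => ?_
    have h1 : (Quotient.mk _ w : Orbits G V) = q := by
      by_contra hne
      apply hw
      simp [autoExt, Pi.single_eq_of_ne hne]
    refine ⟨-shift G w, ?_, ?_⟩
    · rw [Finset.mem_coe, Finsupp.mem_support_iff, ← hx, neg_neg, ← h1, shift_vadd_out]
      exact left_ne_zero_of_mul hw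
    · simp only
      rw [neg_neg, ← h1, shift_vadd_out]
  rw [finsum_orbits hfree hsupp, Finset.sum_eq_single q]
  · rw [← finsum_comp_equiv (Equiv.neg G), Finsupp.sum, ← finsum_eq_sum_of_support_subset]
    · refine finsum_congr fun h => ?_
      rw [Equiv.neg_apply, autoExt, shift_vadd_out_eq hfree, mk_vadd_out, Pi.single_eq_same,
        twist_inv_neg, mul_one, ← hx]
      rfl
    · intro h hh
      rw [Finset.mem_coe, Finsupp.mem_support_iff]
      exact left_ne_zero_of_mul hh
  · intro q' _ hq'
    rw [← finsum_zero (α := G)]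
    refine finsum_congr fun h => ?_
    rw [autoExt, mk_vadd_out, Pi.single_eq_of_ne hq', mul_zero, mul_zero]
  · simp

end

end PeriodicGraph

/-! ### Representations of polynomial growth and Gelfand theory -/

namespace PeriodicGraph

noncomputable section

open scoped Classical

lemma le_one_of_pow_le_polynomial {x l C : ℝ} {N : ℕ} (hl : 0 ≤ l)
    (h : ∀ k : ℕ, x ^ k ≤ C * (1 + k * l) ^ N) : x ≤ 1 := by
  have hC : 0 ≤ C := by have := h 0; simp at this; linarith
  by_contra hx
  push Not at hx
  have h1 := tendsto_pow_const_div_const_pow_of_one_lt N hx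
  have h2 := h1.const_mul (C * (1 + l) ^ N)
  rw [mul_zero] at h2
  have h3 := (h2.eventually_lt_const one_pos).and (Filter.eventually_ge_atTop 1)
  obtain ⟨k, hk, hk1⟩ := h3.exists
  have hk1' : (1 : ℝ) ≤ k := by exact_mod_cast hk1
  have h4 : C * (1 + k * l) ^ N ≤ C * (1 + l) ^ N * (k : ℝ) ^ N := by
    rw [mul_assoc, ← mul_pow]
    exact mul_le_mul_of_nonneg_left (pow_le_pow_left₀ (by positivity) (by nlinarith) _) hC
  have h5 : (0 : ℝ) < x ^ k := by positivity
  rw [← mul_div_assoc, div_lt_one h5] at hk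
  linarith [h k]

section BanachRepresentation

variable {G : Type*} [AddCommGroup G]

/-- Commutativity is a hypothesis and not part of the ring structure, so that the statement applies
to a closed subalgebra of operators with its inherited structure. -/
lemma exists_algHom_of_mem_spectrum {B : Type*} [NormedRing B] [NormedAlgebra ℂ B]
    [CompleteSpace B] (hcomm : ∀ x y : B, x * y = y * x) {a : B} {z : ℂ} (hz : z ∈ spectrum ℂ a) :
    ∃ f : B →ₐ[ℂ] ℂ, f a = z := by
  let _ : NormedCommRing B := { ‹NormedRing B› with mul_comm := hcomm }
  obtain ⟨f, hf⟩ := WeakDual.CharacterSpace.mem_spectrum_iff_exists.1 hz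
  exact ⟨WeakDual.CharacterSpace.toAlgHom f, hf⟩

open Polynomial in
/-- If a homomorphism of polynomial growth of a commutative group into a commutative Banach algebra
is annihilated by an element `d` of the group algebra having only finitely many zeros at the unitary
characters, then its values are algebraic. -/
lemma exists_aeval_eq_zero_of_commutative {B : Type*} [NormedRing B] [NormedAlgebra ℂ B]
    [CompleteSpace B] [NormOneClass B] (hcomm : ∀ x y : B, x * y = y * x) (τ : Multiplicative G →* B) {ℓ : G → ℝ}
    (hℓ0 : ∀ g, 0 ≤ ℓ g) (hℓ : ∀ (k : ℤ) (g : G), ℓ (k • g) ≤ |(k : ℝ)| * ℓ g) {N : ℕ}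
    (hτ : ∀ g : G, ‖τ (Multiplicative.ofAdd g)‖ ≤ (1 + ℓ g) ^ N)
    {d : AddMonoidAlgebra ℂ G} (hd : AddMonoidAlgebra.lift ℂ _ G τ d = 0)
    {Z : Set (AddChar G Circle)} (hZ : Z.Finite)
    (hdZ : ∀ χ : AddChar G Circle, (d.coeff.sum fun g a => a * (χ g : ℂ)) = 0 → χ ∈ Z) (g : G) :
    ∃ M : ℕ, aeval (τ (Multiplicative.ofAdd g))
      ((∏ z ∈ hZ.toFinset.image fun χ => (χ g : ℂ), (X - Polynomial.C z)) ^ M) = 0 := by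
  let T : Multiplicative G →* Bˣ := τ.toHomUnits
  have hTpow : ∀ k : ℤ, T (Multiplicative.ofAdd g) ^ k = T (Multiplicative.ofAdd (k • g)) := by
    intro k
    rw [← map_zpow, ← ofAdd_zsmul]
  have hspec : spectrum ℂ ((T (Multiplicative.ofAdd g) : Bˣ) : B) ⊆
      (hZ.toFinset.image fun χ => (χ g : ℂ) : Finset ℂ) := by
    intro z hz
    obtain ⟨f, hf⟩ := exists_algHom_of_mem_spectrum hcomm hz
    -- Algebra homomorphisms to `ℂ` are contractive here, so the powers of `f (τ h)` grow at most
    -- polynomially. The same bound for `-h` then gives modulus exactly one.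
    have hle : ∀ h : G, ‖f (τ (Multiplicative.ofAdd h))‖ ≤ 1 := by
      intro h
      refine le_one_of_pow_le_polynomial (hℓ0 h) (N := N) (C := 1) fun k => ?_
      rw [one_mul, ← norm_pow, ← map_pow, ← map_pow, ← ofAdd_nsmul]
      refine (AlgHom.norm_apply_le_self (𝕜 := ℂ) f _).trans ((hτ (k • h)).trans ?_)
      refine pow_le_pow_left₀ (by linarith [hℓ0 (k • h)]) ?_ _
      have := hℓ k h
      simp only [natCast_zsmul, Int.cast_natCast, Nat.abs_cast] at this
      linarith
    have hone : ∀ h : G, ‖f (τ (Multiplicative.ofAdd h))‖ = 1 := by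
      intro h
      refine le_antisymm (hle h) ?_
      have h1 : f (τ (Multiplicative.ofAdd h)) * f (τ (Multiplicative.ofAdd (-h))) = 1 := by
        rw [← map_mul, ← map_mul, ← ofAdd_add, add_neg_cancel, ofAdd_zero, map_one, map_one]
      have h2 : ‖f (τ (Multiplicative.ofAdd h))‖ * ‖f (τ (Multiplicative.ofAdd (-h)))‖ = 1 := by
        rw [← norm_mul, h1, norm_one]
      nlinarith [hle (-h), norm_nonneg (f (τ (Multiplicative.ofAdd h)))]
    -- The Gelfand character restricts to a unitary character of `G`. It is a zero of `d` because
    -- `f` annihilates the image of `d`.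
    let χ : AddChar G Circle :=
      { toFun := fun h => ⟨f (τ (Multiplicative.ofAdd h)), mem_sphere_zero_iff_norm.2 (hone h)⟩
        map_zero_eq_one' := by
          apply Circle.ext
          change f (τ (Multiplicative.ofAdd 0)) = 1
          rw [ofAdd_zero, map_one, map_one]
        map_add_eq_mul' := fun a b => by
          apply Circle.ext
          change f (τ (Multiplicative.ofAdd (a + b))) =
            f (τ (Multiplicative.ofAdd a)) * f (τ (Multiplicative.ofAdd b))
          rw [ofAdd_add, map_mul, map_mul] }
    have hχ : χ ∈ Z := by
      refine hdZ χ ?_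
      have h2 := congrArg f hd
      rw [map_zero, AddMonoidAlgebra.lift_apply, Finsupp.sum, map_sum] at h2
      rw [← h2, Finsupp.sum]
      refine Finset.sum_congr rfl fun a _ => ?_
      rw [map_smul]
      rfl
    rw [Finset.mem_coe, Finset.mem_image]
    exact ⟨χ, hZ.mem_toFinset.2 hχ, hf⟩
  exact exists_prod_sub_pow_eq_zero (T (Multiplicative.ofAdd g)) (C := (1 + ℓ g) ^ N)
    (N := N) (fun k => by
      rw [hTpow, ← mul_pow]
      refine (hτ _).trans (pow_le_pow_left₀ (by linarith [hℓ0 (k • g)]) ?_ _)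
      have := hℓ k g
      nlinarith [hℓ0 g, abs_nonneg (k : ℝ)])
    (hZ.toFinset.image fun χ => (χ g : ℂ)) (fun z hz => by
      obtain ⟨χ, -, rfl⟩ := Finset.mem_image.1 hz
      exact Circle.norm_coe _) hspec

variable {K : Type*} [NormedAddCommGroup K] [NormedSpace ℂ K] [CompleteSpace K]

open Polynomial in
/-- In a representation of polynomial growth of a commutative group on a Banach space which is
annihilated by an element `d` of the group algebra having only finitely many zeros at the unitary
characters, all group elements act as algebraic operators. -/
lemma exists_aeval_rep_eq_zero (ρ : Multiplicative G →* (K →L[ℂ] K)) {ℓ : G → ℝ}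
    (hℓ0 : ∀ g, 0 ≤ ℓ g) (hℓ : ∀ (k : ℤ) (g : G), ℓ (k • g) ≤ |(k : ℝ)| * ℓ g) {N : ℕ}
    (hρ : ∀ g : G, ‖ρ (Multiplicative.ofAdd g)‖ ≤ (1 + ℓ g) ^ N)
    {d : AddMonoidAlgebra ℂ G} (hd : AddMonoidAlgebra.lift ℂ _ G ρ d = 0)
    {Z : Set (AddChar G Circle)} (hZ : Z.Finite)
    (hdZ : ∀ χ : AddChar G Circle, (d.coeff.sum fun g a => a * (χ g : ℂ)) = 0 → χ ∈ Z) (g : G) :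
    ∃ M : ℕ, aeval (ρ (Multiplicative.ofAdd g))
      ((∏ z ∈ hZ.toFinset.image fun χ => (χ g : ℂ), (X - Polynomial.C z)) ^ M) = 0 := by
  -- On the zero space the identity has norm `0` and the Banach algebra lemma does not apply.
  rcases subsingleton_or_nontrivial K with hK | hK
  · exact ⟨0, ContinuousLinearMap.ext fun x => Subsingleton.elim _ _⟩
  have hcomm : ∀ a ∈ Set.range ρ, ∀ b ∈ Set.range ρ, a * b = b * a := by
    rintro _ ⟨a, rfl⟩ _ ⟨b, rfl⟩
    rw [← map_mul, mul_comm, map_mul]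
  let S : Subalgebra ℂ (K →L[ℂ] K) := Algebra.adjoin ℂ (Set.range ρ)
  have hScomm : ∀ x y : S, x * y = y * x := by
    have := Algebra.isMulCommutative_adjoin ℂ hcomm
    exact this.is_comm.comm
  obtain ⟨B, hB⟩ : ∃ B : Subalgebra ℂ (K →L[ℂ] K), B = S.topologicalClosure := ⟨_, rfl⟩
  have hBcomm : ∀ x y : B, x * y = y * x := by
    subst hB
    exact (Subalgebra.commRingTopologicalClosure S hScomm).mul_comm
  have hcomplete : CompleteSpace B := by
    subst hB
    exact S.isClosed_topologicalClosure.completeSpace_coe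
  have hmem : ∀ a, ρ a ∈ B := fun a => hB ▸
    S.le_topologicalClosure (Algebra.subset_adjoin (Set.mem_range_self a))
  have _ : NormOneClass B := ⟨(norm_one : ‖(1 : K →L[ℂ] K)‖ = 1)⟩
  let τ : Multiplicative G →* B := ρ.codRestrict B hmem
  have h1 : AddMonoidAlgebra.lift ℂ _ G τ d = 0 := by
    apply Subtype.ext
    change B.val (AddMonoidAlgebra.lift ℂ _ G τ d) = 0
    rw [← hd, AddMonoidAlgebra.lift_apply, AddMonoidAlgebra.lift_apply, Finsupp.sum,
      Finsupp.sum, map_sum]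
    rfl
  obtain ⟨M, hM⟩ := exists_aeval_eq_zero_of_commutative hBcomm τ hℓ0 hℓ hρ h1 hZ hdZ g
  refine ⟨M, ?_⟩
  have := congrArg B.val hM
  rw [map_zero, ← Polynomial.aeval_algHom_apply] at this
  exact this

end BanachRepresentation

end

end PeriodicGraph

/-! ### The solution spaces as Banach representations of the group -/

namespace PeriodicGraph

noncomputable section

open scoped Classical

variable {G V : Type*} [AddCommGroup G] [AddAction G V] {n : ℕ}

/-! ### The size function -/

lemma size_nonneg (c : G →+ (Fin n → ℤ)) (g : G) : 0 ≤ size c g :=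
  Finset.sum_nonneg fun _ _ => abs_nonneg _

lemma size_add_le (c : G →+ (Fin n → ℤ)) (g h : G) : size c (g + h) ≤ size c g + size c h := by
  rw [size, size, size, ← Finset.sum_add_distrib]
  refine Finset.sum_le_sum fun i _ => ?_
  rw [map_add, Pi.add_apply, Int.cast_add]
  exact abs_add_le _ _

lemma size_zsmul (c : G →+ (Fin n → ℤ)) (k : ℤ) (g : G) : size c (k • g) = |(k : ℝ)| * size c g := by
  rw [size, size, Finset.mul_sum]
  refine Finset.sum_congr rfl fun i _ => ?_
  rw [map_zsmul, Pi.smul_apply, smul_eq_mul, Int.cast_mul, abs_mul]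

/-- The weight `(1 + |g|)^N` at the vertex obtained by applying `g` to the representative of an
orbit. -/
def weight (c : G →+ (Fin n → ℤ)) (N : ℕ) (v : V) : ℝ := (1 + size c (shift G v)) ^ N

lemma weight_pos (c : G →+ (Fin n → ℤ)) (N : ℕ) (v : V) : 0 < weight c N v := by
  have := size_nonneg c (shift G v)
  unfold weight
  positivity

/-- Since `1 + |g + h| ≤ (1 + |g|)(1 + |h|)`, translations are bounded on the weighted space with
norms of polynomial growth. -/
lemma weight_vadd_le (hfree : ∀ (g : G) (v : V), g +ᵥ v = v → g = 0) (c : G →+ (Fin n → ℤ)) (N : ℕ)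
    (g : G) (v : V) : weight c N (g +ᵥ v) ≤ (1 + size c g) ^ N * weight c N v := by
  unfold weight
  rw [← mul_pow, shift_vadd hfree]
  have h1 := size_nonneg c (shift G v)
  have h2 := size_nonneg c g
  refine pow_le_pow_left₀ (by have := size_nonneg c (g + shift G v); linarith) ?_ _
  nlinarith [size_add_le c g (shift G v)]

/-! ### The solution space as a Banach space -/

/-- Bounded functions as functions of polynomial growth. -/
def weightedFun (c : G →+ (Fin n → ℤ)) (N : ℕ) : lp (fun _ : V => ℂ) ⊤ →ₗ[ℂ] (V → ℂ) where
  toFun F v := weight c N v * F v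
  map_add' F H := by ext v; simp [mul_add]
  map_smul' a F := by ext v; simp; ring

lemma weightedFun_injective (c : G →+ (Fin n → ℤ)) (N : ℕ) :
    Function.Injective (weightedFun (V := V) c N) := by
  intro F H h
  ext v
  exact mul_left_cancel₀ (Complex.ofReal_ne_zero.2 (weight_pos c N v).ne') (congrFun h v)

lemma norm_weightedTransl_apply_le (hfree : ∀ (g : G) (v : V), g +ᵥ v = v → g = 0)
    (c : G →+ (Fin n → ℤ)) (N : ℕ) (g : G) (F : lp (fun _ : V => ℂ) ⊤) (v : V) :
    ‖((weight c N v)⁻¹ : ℂ) * (weight c N (g +ᵥ v) * F (g +ᵥ v))‖ ≤ (1 + size c g) ^ N * ‖F‖ := by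
  have hw := weight_pos c N v
  have hw' := weight_pos c N (g +ᵥ v)
  rw [norm_mul, norm_mul, norm_inv, Complex.norm_real, Complex.norm_real, ← mul_assoc,
    Real.norm_of_nonneg hw.le, Real.norm_of_nonneg hw'.le]
  refine mul_le_mul ?_ (lp.norm_apply_le_norm (by simp) F _) (norm_nonneg _)
    (by have := size_nonneg c g; positivity)
  rw [inv_mul_le_iff₀ hw, mul_comm]
  exact weight_vadd_le hfree c N g v

/-- The translations acting on bounded functions by means of the weights. -/
def weightedTransl (hfree : ∀ (g : G) (v : V), g +ᵥ v = v → g = 0) (c : G →+ (Fin n → ℤ)) (N : ℕ)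
    (g : G) : lp (fun _ : V => ℂ) ⊤ →L[ℂ] lp (fun _ : V => ℂ) ⊤ :=
  LinearMap.mkContinuous
    { toFun := fun F => ⟨fun v => ((weight c N v)⁻¹ : ℂ) * (weight c N (g +ᵥ v) * F (g +ᵥ v)),
        memℓp_infty ⟨(1 + size c g) ^ N * ‖F‖, by
          rintro _ ⟨v, rfl⟩; exact norm_weightedTransl_apply_le hfree c N g F v⟩⟩
      map_add' := fun F H => by
        ext v
        exact (congrArg _ (mul_add _ _ _)).trans (mul_add _ _ _)
      map_smul' := fun a F => by
        ext v
        simp only [lp.coeFn_smul, Pi.smul_apply, smul_eq_mul, RingHom.id_apply]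
        ring } ((1 + size c g) ^ N) fun F =>
    lp.norm_le_of_forall_le (by have := size_nonneg c g; positivity)
      (norm_weightedTransl_apply_le hfree c N g F)

lemma weightedFun_weightedTransl (hfree : ∀ (g : G) (v : V), g +ᵥ v = v → g = 0)
    (c : G →+ (Fin n → ℤ)) (N : ℕ) (g : G) (F : lp (fun _ : V => ℂ) ⊤) :
    weightedFun c N (weightedTransl hfree c N g F) = transl g (weightedFun c N F) := by
  funext v
  exact mul_inv_cancel_left₀ (Complex.ofReal_ne_zero.2 (weight_pos c N v).ne') _

lemma norm_weightedTransl_le (hfree : ∀ (g : G) (v : V), g +ᵥ v = v → g = 0)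
    (c : G →+ (Fin n → ℤ)) (N : ℕ) (g : G) :
    ‖weightedTransl hfree c N g‖ ≤ (1 + size c g) ^ N :=
  ContinuousLinearMap.opNorm_le_bound _ (by have := size_nonneg c g; positivity) fun F =>
    lp.norm_le_of_forall_le (by have := size_nonneg c g; positivity)
      (norm_weightedTransl_apply_le hfree c N g F)

variable [Fintype (Orbits G V)]

/-- With finitely many orbits, the constants of the separate orbits combine into one weighted
supremum bound. -/
lemma exists_weightedFun_eq (c : G →+ (Fin n → ℤ))
    (N : ℕ) {P : (V → ℂ) →ₗ[ℂ] (V → ℂ)} {u : V → ℂ} (hu : u ∈ polySol c P N) :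
    ∃ F, weightedFun c N F = u := by
  obtain ⟨C, hC⟩ : ∃ C : ℝ, ∀ v, ‖((weight c N v)⁻¹ : ℂ) * u v‖ ≤ C := by
    choose C hC using hu.2
    refine ⟨∑ q : Orbits G V, |C (Quotient.out q)|, fun v => ?_⟩
    have h1 := hC (Quotient.out (Quotient.mk _ v : Orbits G V)) (shift G v)
    rw [shift_vadd_out] at h1
    have hw := weight_pos c N v
    rw [norm_mul, norm_inv, Complex.norm_real, Real.norm_of_nonneg hw.le, inv_mul_le_iff₀ hw,
      mul_comm]
    refine h1.trans (mul_le_mul_of_nonneg_right ?_ hw.le)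
    exact (le_abs_self _).trans (Finset.single_le_sum
      (f := fun q : Orbits G V => |C (Quotient.out q)|) (fun _ _ => abs_nonneg _)
      (Finset.mem_univ _))
  refine ⟨⟨fun v => ((weight c N v)⁻¹ : ℂ) * u v, memℓp_infty ⟨C, ?_⟩⟩, ?_⟩
  · rintro _ ⟨v, rfl⟩
    exact hC v
  · funext v
    exact mul_inv_cancel_left₀ (Complex.ofReal_ne_zero.2 (weight_pos c N v).ne') _

/-- Each value of `P u` involves finitely many values of `u`, hence is continuous for pointwise
convergence. This makes the solution space complete. -/
lemma HasSymbol.isClosed_ker {P : (V → ℂ) →ₗ[ℂ] (V → ℂ)}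
    {D : Matrix (Orbits G V) (Orbits G V) (AddMonoidAlgebra ℂ G)} (hD : HasSymbol P D)
    (c : G →+ (Fin n → ℤ)) (N : ℕ) :
    IsClosed (LinearMap.ker (P ∘ₗ weightedFun c N) : Set (lp (fun _ : V => ℂ) ⊤)) := by
  have h1 : Continuous fun F : lp (fun _ : V => ℂ) ⊤ => P (weightedFun c N F) := by
    refine continuous_pi fun v => ?_
    rw [← shift_vadd_out (G := G) v]
    simp only [hD.apply_eq, Finsupp.sum]
    refine continuous_finsetSum _ fun q _ => continuous_finsetSum _ fun h _ => ?_
    have h2 : Continuous fun F : lp (fun _ : V => ℂ) ⊤ => (F : V → ℂ) :=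
      (lp.uniformContinuous_coe (E := fun _ : V => ℂ) (p := ⊤)).continuous
    exact continuous_const.mul (continuous_const.mul ((continuous_apply _).comp h2))
  exact isClosed_eq h1 continuous_const

lemma HasSymbol.transl_comm {P : (V → ℂ) →ₗ[ℂ] (V → ℂ)}
    {D : Matrix (Orbits G V) (Orbits G V) (AddMonoidAlgebra ℂ G)} (hD : HasSymbol P D) (g : G)
    (u : V → ℂ) : P (transl g u) = transl g (P u) := by
  refine funext_orbits (G := G) fun h q => ?_
  rw [transl_apply, ← add_vadd, hD.apply_eq, hD.apply_eq]
  refine Finset.sum_congr rfl fun q' _ => Finsupp.sum_congr fun k _ => ?_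
  rw [transl_apply, ← add_vadd, ← add_vadd, ← add_vadd]
  congr 3
  abel

/-! ### The real Fermi surface in terms of the Bloch matrices -/

lemma HasSymbol.apply_autoExt {P : (V → ℂ) →ₗ[ℂ] (V → ℂ)}
    {D : Matrix (Orbits G V) (Orbits G V) (AddMonoidAlgebra ℂ G)} (hD : HasSymbol P D)
    (hfree : ∀ (g : G) (v : V), g +ᵥ v = v → g = 0) (c : G →+ (Fin n → ℤ)) (χ : AddChar G Circle)
    (f : Orbits G V → ℂ) :
    P (autoExt (fun g => (χ g : ℂ)) f) =
      autoExt (fun g => (χ g : ℂ)) ((bloch c D χ 0).mulVec f) := by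
  refine funext_orbits (G := G) fun g p => ?_
  rw [hD.apply_eq, autoExt, shift_vadd_out_eq hfree, mk_vadd_out, Matrix.mulVec, dotProduct,
    Finset.mul_sum]
  refine Finset.sum_congr rfl fun q _ => ?_
  rw [bloch_apply, Finsupp.sum_mul, Finsupp.mul_sum]
  refine Finsupp.sum_congr fun h _ => ?_
  rw [← add_vadd, autoExt, shift_vadd_out_eq hfree, mk_vadd_out, AddChar.map_add_eq_mul,
    Circle.coe_mul]
  simp [twist]
  ring

omit [Fintype (Orbits G V)] in
lemma IsAutomorphic.eq_autoExt {χ : G → ℂ} {u : V → ℂ} (hu : IsAutomorphic χ u) :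
    u = autoExt χ fun q : Orbits G V => u (Quotient.out q) := by
  funext v
  rw [autoExt, ← hu, shift_vadd_out]

omit [Fintype (Orbits G V)] in
lemma isAutomorphic_autoExt (hfree : ∀ (g : G) (v : V), g +ᵥ v = v → g = 0) (χ : AddChar G Circle)
    (f : Orbits G V → ℂ) : IsAutomorphic (fun g => (χ g : ℂ)) (autoExt (fun g => (χ g : ℂ)) f) := by
  intro g v
  rw [autoExt, autoExt, shift_vadd hfree, mk_vadd, AddChar.map_add_eq_mul, Circle.coe_mul, mul_assoc]

omit [Fintype (Orbits G V)] in
lemma autoExt_eq_zero_iff (hfree : ∀ (g : G) (v : V), g +ᵥ v = v → g = 0) (χ : AddChar G Circle)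
    (f : Orbits G V → ℂ) : autoExt (fun g => (χ g : ℂ)) f = 0 ↔ f = 0 := by
  refine ⟨fun h => ?_, fun h => ?_⟩
  · funext q
    have := congrFun h ((0 : G) +ᵥ (Quotient.out q : V))
    rw [autoExt, shift_vadd_out_eq hfree, mk_vadd_out] at this
    simpa using this
  · subst h; funext v; simp [autoExt]

lemma HasSymbol.mem_fermi_iff {P : (V → ℂ) →ₗ[ℂ] (V → ℂ)}
    {D : Matrix (Orbits G V) (Orbits G V) (AddMonoidAlgebra ℂ G)} (hD : HasSymbol P D)
    (hfree : ∀ (g : G) (v : V), g +ᵥ v = v → g = 0) (c : G →+ (Fin n → ℤ))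
    (χ : AddChar G Circle) : χ ∈ fermi G P ↔ ∃ f ≠ 0, (bloch c D χ 0).mulVec f = 0 := by
  constructor
  · rintro ⟨u, hu0, hPu, hu⟩
    rw [hu.eq_autoExt] at hu0 hPu
    refine ⟨_, mt (autoExt_eq_zero_iff hfree χ _).2 hu0, ?_⟩
    rwa [hD.apply_autoExt hfree c, autoExt_eq_zero_iff hfree] at hPu
  · rintro ⟨f, hf0, hf⟩
    refine ⟨autoExt (fun g => (χ g : ℂ)) f, mt (autoExt_eq_zero_iff hfree χ _).1 hf0, ?_,
      isAutomorphic_autoExt hfree χ f⟩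
    rw [hD.apply_autoExt hfree c, hf, autoExt_eq_zero_iff hfree]

/-- Evaluating the symbol at a character gives the Bloch matrix there. A zero of the determinant
yields a null vector, that is, an automorphic solution. -/
lemma HasSymbol.mem_fermi_of_det {P : (V → ℂ) →ₗ[ℂ] (V → ℂ)}
    {D : Matrix (Orbits G V) (Orbits G V) (AddMonoidAlgebra ℂ G)} (hD : HasSymbol P D)
    (hfree : ∀ (g : G) (v : V), g +ᵥ v = v → g = 0) (c : G →+ (Fin n → ℤ)) (χ : AddChar G Circle)
    (h : (D.det.coeff.sum fun g a => a * (χ g : ℂ)) = 0) : χ ∈ fermi G P := by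
  rw [hD.mem_fermi_iff hfree c, Matrix.exists_mulVec_eq_zero_iff, bloch]
  have h1 := AlgHom.map_det (AddMonoidAlgebra.lift ℂ ℂ G (twistHom c χ 0)) D
  rw [AlgHom.mapMatrix_apply] at h1
  rw [← h1, AddMonoidAlgebra.lift_apply, ← h]
  refine Finsupp.sum_congr fun g _ => ?_
  simp [twistHom, twist]

/-! ### Algebraicity of translations on the solution space -/

omit [Fintype (Orbits G V)] in
open Polynomial in
lemma map_aeval_of_intertwines {K M : Type*} [NormedAddCommGroup K] [NormedSpace ℂ K]
    [AddCommGroup M] [Module ℂ M] (j : K →ₗ[ℂ] M) {S : K →L[ℂ] K} {S' : Module.End ℂ M}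
    (h : ∀ x, j (S x) = S' (j x)) (p : ℂ[X]) (x : K) : j (aeval S p x) = aeval S' p (j x) := by
  induction p using Polynomial.induction_on' with
  | add p q hp hq => simp [hp, hq]
  | monomial k a =>
    have : ∀ k : ℕ, j ((S ^ k) x) = (S' ^ k) (j x) := by
      intro k
      induction k with
      | zero => simp
      | succ k ih => rw [pow_succ', pow_succ', Module.End.mul_apply, mul_apply_eq_comp, h, ih]
    rw [Polynomial.aeval_monomial, Polynomial.aeval_monomial, ← Algebra.smul_def, ← Algebra.smul_def,
      smul_apply, map_smul, this, LinearMap.smul_apply]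

omit [Fintype (Orbits G V)] in
lemma map_lift_of_intertwines {K M : Type*} [NormedAddCommGroup K] [NormedSpace ℂ K]
    [AddCommGroup M] [Module ℂ M] (ρ : Multiplicative G →* (K →L[ℂ] K))
    (σ : Multiplicative G →* Module.End ℂ M) (j : K →ₗ[ℂ] M)
    (h : ∀ g x, j (ρ g x) = σ g (j x)) (d : AddMonoidAlgebra ℂ G) (x : K) :
    j (AddMonoidAlgebra.lift ℂ _ G ρ d x) = AddMonoidAlgebra.lift ℂ _ G σ d (j x) := by
  rw [AddMonoidAlgebra.lift_apply, AddMonoidAlgebra.lift_apply, Finsupp.sum, Finsupp.sum,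
    sum_apply, LinearMap.sum_apply, map_sum]
  refine Finset.sum_congr rfl fun g _ => ?_
  rw [smul_apply, map_smul, h, LinearMap.smul_apply]

open Polynomial in
/-- If the real Fermi surface is finite, then translations are algebraic on the spaces of solutions
of polynomial growth. -/
lemma HasSymbol.exists_aeval_transl_eq_zero {P : (V → ℂ) →ₗ[ℂ] (V → ℂ)}
    {D : Matrix (Orbits G V) (Orbits G V) (AddMonoidAlgebra ℂ G)} (hD : HasSymbol P D)
    (hfree : ∀ (g : G) (v : V), g +ᵥ v = v → g = 0) (c : G →+ (Fin n → ℤ))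
    (hfin : (fermi G P).Finite) (N : ℕ) (g : G) :
    ∃ p : ℂ[X], p.Monic ∧ ∀ u ∈ polySol c P N, aeval (transl (V := V) g) p u = 0 := by
  -- The Banach model: bounded functions that become solutions after multiplication by the weight.
  -- `j` below identifies them with solutions and intertwines `R` with the translations.
  let K : Submodule ℂ (lp (fun _ : V => ℂ) ⊤) := LinearMap.ker (P ∘ₗ weightedFun c N)
  have hKclosed : IsClosed (K : Set (lp (fun _ : V => ℂ) ⊤)) := hD.isClosed_ker c N
  have hK : CompleteSpace K := hKclosed.completeSpace_coe
  have hinv : ∀ (g : G) (F : K), weightedTransl hfree c N g F ∈ K := by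
    intro g F
    have hF : P (weightedFun c N F) = 0 := F.2
    change P (weightedFun c N (weightedTransl hfree c N g F)) = 0
    rw [weightedFun_weightedTransl, hD.transl_comm, hF, map_zero]
  let j : K →ₗ[ℂ] (V → ℂ) := weightedFun c N ∘ₗ K.subtype
  have hj : Function.Injective j := (weightedFun_injective c N).comp K.injective_subtype
  let R : G → (K →L[ℂ] K) := fun g =>
    ((weightedTransl hfree c N g).comp K.subtypeL).codRestrict K (hinv g)
  have hR : ∀ g F, j (R g F) = transl g (j F) := fun g F =>
    weightedFun_weightedTransl hfree c N g F
  let ρ : Multiplicative G →* (K →L[ℂ] K) :=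
    { toFun := fun g => R (Multiplicative.toAdd g)
      map_one' := by
        ext1 F
        apply hj
        rw [hR]
        exact LinearMap.congr_fun (map_one translHom) (j F)
      map_mul' := fun a b => by
        ext1 F
        apply hj
        rw [hR, mul_apply_eq_comp, hR, hR, ← Module.End.mul_apply, ← map_mul]
        rfl }
  have hjρ : ∀ g F, j (ρ (Multiplicative.ofAdd g) F) = transl g (j F) := hR
  have hρ : ∀ g : G, ‖ρ (Multiplicative.ofAdd g)‖ ≤ (1 + size c g) ^ N := by
    intro g
    have hs := size_nonneg c g
    refine ContinuousLinearMap.opNorm_le_bound _ (by positivity) fun F => ?_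
    exact ((weightedTransl hfree c N g).le_opNorm F).trans
      (mul_le_mul_of_nonneg_right (norm_weightedTransl_le hfree c N g) (norm_nonneg _))
  have hd : AddMonoidAlgebra.lift ℂ _ G ρ D.det = 0 := by
    ext1 F
    apply hj
    have hF : P (j F) = 0 := F.2
    refine (map_lift_of_intertwines ρ translHom j hjρ D.det F).trans ?_
    exact (hD.groupAct_det hF).trans (map_zero j).symm
  obtain ⟨M, hM⟩ := exists_aeval_rep_eq_zero ρ (size_nonneg c) (fun k g => (size_zsmul c k g).le)
    hρ hd hfin (hD.mem_fermi_of_det hfree c) g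
  refine ⟨(∏ z ∈ hfin.toFinset.image fun χ => (χ g : ℂ), (X - Polynomial.C z)) ^ M,
    (Polynomial.monic_prod_X_sub_C _ _).pow M, fun u hu => ?_⟩
  obtain ⟨F, rfl⟩ := exists_weightedFun_eq c N hu
  have hF : F ∈ K := hu.1
  refine (map_aeval_of_intertwines j (hjρ g) _ ⟨F, hF⟩).symm.trans ?_
  rw [hM]
  exact map_zero j

end

end PeriodicGraph

/-! ### Unipotent functions on the group are polynomials -/

namespace PeriodicGraph

noncomputable section

open scoped Classical

/-! ### Powers of unipotent elements -/

/-- The binomial series of `(1 + (t - 1))^x` terminates. Pascal's rule shows that raising `x` by one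
multiplies the sum by `t`, which serves both directions of the integer induction. -/
lemma zpow_eq_sum_choose {R : Type*} [CommRing R] [Algebra ℂ R] (t : Rˣ) {k : ℕ}
    (hk : ((t : R) - 1) ^ k = 0) (x : ℤ) :
    ((t ^ x : Rˣ) : R) = ∑ j ∈ Finset.range k, Ring.choose (x : ℂ) j • ((t : R) - 1) ^ j := by
  rcases k with _ | k
  · have : Subsingleton R := subsingleton_of_zero_eq_one (by simpa using hk.symm)
    exact Subsingleton.elim _ _
  have hstep : ∀ r : ℂ, ∑ j ∈ Finset.range (k + 1), Ring.choose (r + 1) j • ((t : R) - 1) ^ j =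
      t * ∑ j ∈ Finset.range (k + 1), Ring.choose r j • ((t : R) - 1) ^ j := by
    intro r
    have h1 : (t : R) * ∑ j ∈ Finset.range (k + 1), Ring.choose r j • ((t : R) - 1) ^ j =
        ∑ j ∈ Finset.range (k + 1), Ring.choose r j • ((t : R) - 1) ^ j +
        ((t : R) - 1) * ∑ j ∈ Finset.range (k + 1), Ring.choose r j • ((t : R) - 1) ^ j := by ring
    have h2 : ((t : R) - 1) * ∑ j ∈ Finset.range (k + 1), Ring.choose r j • ((t : R) - 1) ^ j =
        ∑ j ∈ Finset.range k, Ring.choose r j • ((t : R) - 1) ^ (j + 1) := by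
      rw [Finset.sum_range_succ, mul_add, mul_smul_comm, ← pow_succ', hk, smul_zero, add_zero,
        Finset.mul_sum]
      exact Finset.sum_congr rfl fun j _ => by rw [mul_smul_comm, ← pow_succ']
    rw [h1, h2, Finset.sum_range_succ', Finset.sum_range_succ']
    simp only [Ring.choose_succ_succ, Ring.choose_zero_right, add_smul, Finset.sum_add_distrib]
    abel
  induction x using Int.induction_on with
  | zero =>
    rw [Finset.sum_range_succ']
    simp [Ring.choose_zero_succ]
  | succ i ih =>
    have := hstep (i : ℂ)
    push_cast at this ih ⊢
    rw [this, ← ih, zpow_add_one, Units.val_mul, mul_comm]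
  | pred i ih =>
    have := hstep (-(i : ℂ) - 1)
    rw [sub_add_cancel] at this
    push_cast at this ih ⊢
    rw [← ih] at this
    rw [zpow_sub_one, Units.val_mul, this, mul_comm, Units.inv_mul_cancel_left]

section Polynomiality

variable {G : Type*} [AddCommGroup G] {n : ℕ}

/-- The polynomial `x ↦ x.choose j`. -/
def choosePoly (j : ℕ) : Polynomial ℂ := Polynomial.C ((j.factorial : ℂ)⁻¹) * descPochhammer ℂ j

lemma eval_choosePoly (j : ℕ) (x : ℂ) : (choosePoly j).eval x = Ring.choose x j := by
  rw [Ring.choose_eq_smul, choosePoly, Polynomial.eval_mul, Polynomial.eval_C, smul_eq_mul,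
    ← descPochhammer_map (algebraMap ℤ ℂ), Polynomial.eval_map_algebraMap,
    Polynomial.aeval_eq_smeval]

lemma groupAct_single (g : G) (f : G → ℂ) (x : G) :
    groupAct (AddMonoidAlgebra.single g (1 : ℂ)) f x = f (g + x) := by
  rw [groupAct, AddMonoidAlgebra.lift_single, one_smul]
  rfl

/-- A function on a commutative group on which all `T_g - 1` act nilpotently is a polynomial
function of the coordinates. -/
lemma exists_eval_eq_of_unipotent (c : G →+ (Fin n → ℤ)) (hc : Function.Surjective c)
    (hc' : Finite c.ker) {f : G → ℂ}
    (hf : ∀ g : G, ∃ k : ℕ, ((transl (V := G) g - 1) ^ k) f = 0) :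
    ∃ φ : MvPolynomial (Fin n) ℂ, ∀ g, f g = MvPolynomial.eval (fun i => (c g i : ℂ)) φ := by
  let A := AddMonoidAlgebra ℂ G
  -- The annihilator of `f`. In the quotient by it all group elements are unipotent, and an element
  -- of the group algebra acts on `f` through its class.
  let J : Ideal A :=
    { carrier := {r | groupAct r f = 0}
      add_mem' := fun {a b} ha hb => by
        have ha' : groupAct a f = 0 := ha
        have hb' : groupAct b f = 0 := hb
        change groupAct (a + b) f = 0
        rw [map_add, LinearMap.add_apply, ha', hb', add_zero]
      zero_mem' := by
        change groupAct 0 f = 0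
        rw [map_zero, LinearMap.zero_apply]
      smul_mem' := fun a b hb => by
        have hb' : groupAct b f = 0 := hb
        change groupAct (a * b) f = 0
        rw [map_mul, Module.End.mul_apply, hb', map_zero] }
  have hJ : ∀ a b : A, Ideal.Quotient.mk J a = Ideal.Quotient.mk J b →
      groupAct a f = groupAct b f := by
    intro a b hab
    have : groupAct (a - b) f = 0 := Ideal.Quotient.eq.1 hab
    rwa [map_sub, LinearMap.sub_apply, sub_eq_zero] at this
  let U : Multiplicative G →* (A ⧸ J)ˣ := MonoidHom.toHomUnits
    ((Ideal.Quotient.mk J : A →* A ⧸ J).comp (AddMonoidAlgebra.of ℂ G))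
  have hU : ∀ g : G, ((U (Multiplicative.ofAdd g) : (A ⧸ J)ˣ) : A ⧸ J) =
      Ideal.Quotient.mk J (AddMonoidAlgebra.single g 1) := fun g => rfl
  have hk : ∀ g : G, ∃ k : ℕ, (((U (Multiplicative.ofAdd g) : (A ⧸ J)ˣ) : A ⧸ J) - 1) ^ k = 0 := by
    intro g
    obtain ⟨k, hk⟩ := hf g
    refine ⟨k, ?_⟩
    rw [hU, ← map_one (Ideal.Quotient.mk J), ← map_sub, ← map_pow, Ideal.Quotient.eq_zero_iff_mem]
    change groupAct _ f = 0
    rw [map_pow, map_sub, map_one, ← hk, groupAct, AddMonoidAlgebra.lift_single, one_smul]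
  have hpow : ∀ (g : G) (x : ℤ), U (Multiplicative.ofAdd (x • g)) = U (Multiplicative.ofAdd g) ^ x := by
    intro g x
    rw [← map_zpow, ← ofAdd_zsmul]
  -- the torsion elements act trivially
  have htors : ∀ t ∈ c.ker, U (Multiplicative.ofAdd t) = 1 := by
    intro t ht
    obtain ⟨m, hm, hmt⟩ : ∃ m : ℕ, 0 < m ∧ m • t = 0 := by
      have := isOfFinAddOrder_of_finite (⟨t, ht⟩ : c.ker)
      obtain ⟨m, hm, h⟩ := isOfFinAddOrder_iff_nsmul_eq_zero.1 this
      exact ⟨m, hm, congrArg Subtype.val h⟩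
    set a : A ⧸ J := ((U (Multiplicative.ofAdd t) : (A ⧸ J)ˣ) : A ⧸ J) with ha
    obtain ⟨k, hk⟩ := hk t
    have ham : a ^ m = 1 := by
      have := hpow t m
      rw [natCast_zsmul, hmt, zpow_natCast, ofAdd_zero, map_one] at this
      rw [ha, ← Units.val_pow_eq_pow_val, ← this, Units.val_one]
    -- A unipotent element of finite order is trivial in characteristic zero: the geometric sum
    -- times `a - 1` vanishes, and that sum is `m` plus a nilpotent, hence a unit.
    have hgeom : (∑ i ∈ Finset.range m, a ^ i) * (a - 1) = 0 := by
      rw [geom_sum_mul, ham, sub_self]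
    have hunit : IsUnit (∑ i ∈ Finset.range m, a ^ i) := by
      have h1 : ∑ i ∈ Finset.range m, a ^ i = (m : A ⧸ J) + ∑ i ∈ Finset.range m, (a ^ i - 1) := by
        simp
      rw [h1]
      refine IsNilpotent.isUnit_add_left_of_commute ?_ ?_ (Commute.all _ _)
      · refine Commute.isNilpotent_sum (fun i _ => ?_) fun _ _ _ _ => Commute.all _ _
        obtain ⟨b, hb⟩ := sub_one_dvd_pow_sub_one a i
        rw [hb]
        exact Commute.isNilpotent_mul_right (Commute.all _ _) ⟨k, hk⟩
      · have : (m : A ⧸ J) = algebraMap ℂ (A ⧸ J) m := by simp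
        rw [this]
        exact (IsUnit.mk0 (m : ℂ) (by exact_mod_cast hm.ne')).map _
    have h2 : a - 1 = 0 := hunit.mul_right_eq_zero.1 hgeom
    exact Units.ext (sub_eq_zero.1 h2)
  choose e he using fun i : Fin n => hc (Pi.single i 1)
  choose k hk' using fun i => hk (e i)
  let κ : ℕ := Finset.univ.sup k
  have hκ : ∀ i, (((U (Multiplicative.ofAdd (e i)) : (A ⧸ J)ˣ) : A ⧸ J) - 1) ^ κ = 0 := fun i =>
    pow_eq_zero_of_le (Finset.le_sup (Finset.mem_univ i)) (hk' i)
  -- Up to torsion `g` is `∑ c_i e_i`. Expanding each unipotent factor in its binomial series makes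
  -- the coefficients polynomials in the coordinates of `g`.
  have hdecomp : ∀ g : G, ((U (Multiplicative.ofAdd g) : (A ⧸ J)ˣ) : A ⧸ J) =
      ∑ j ∈ Fintype.piFinset fun _ : Fin n => Finset.range κ,
        (∏ i, Ring.choose (c g i : ℂ) (j i)) •
          Ideal.Quotient.mk J (∏ i, (AddMonoidAlgebra.single (e i) (1 : ℂ) - 1) ^ j i) := by
    intro g
    have hg : U (Multiplicative.ofAdd g) = ∏ i, U (Multiplicative.ofAdd (e i)) ^ c g i := by
      have h1 : g = (g - ∑ i, c g i • e i) + ∑ i, c g i • e i := by abel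
      have h2 : g - ∑ i, c g i • e i ∈ c.ker := by
        rw [AddMonoidHom.mem_ker, map_sub, map_sum, sub_eq_zero]
        funext i
        simp [map_zsmul, he, Finset.sum_apply, Pi.single_apply]
      conv_lhs => rw [h1, ofAdd_add, map_mul, htors _ h2, one_mul, ofAdd_sum, map_prod]
      exact Finset.prod_congr rfl fun i _ => hpow _ _
    rw [hg, Units.coe_prod, Finset.prod_congr rfl fun i _ => zpow_eq_sum_choose _ (hκ i) _,
      Finset.prod_univ_sum]
    refine Finset.sum_congr rfl fun j _ => ?_
    rw [Finset.prod_smul, map_prod]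
    refine congrArg _ (Finset.prod_congr rfl fun i _ => ?_)
    rw [hU, map_pow, map_sub, map_one]
  refine ⟨∑ j ∈ Fintype.piFinset fun _ : Fin n => Finset.range κ,
    MvPolynomial.C (groupAct (∏ i, (AddMonoidAlgebra.single (e i) (1 : ℂ) - 1) ^ j i) f 0) *
      ∏ i, Polynomial.aeval (MvPolynomial.X i) (choosePoly (j i)), fun g => ?_⟩
  have h1 : groupAct (AddMonoidAlgebra.single g 1) f =
      groupAct (∑ j ∈ Fintype.piFinset fun _ : Fin n => Finset.range κ,
        (∏ i, Ring.choose (c g i : ℂ) (j i)) •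
          (∏ i, (AddMonoidAlgebra.single (e i) (1 : ℂ) - 1) ^ j i)) f := by
    refine hJ _ _ ?_
    rw [← hU, hdecomp, map_sum]
    rfl
  have h2 := congrFun h1 0
  rw [groupAct_single, add_zero] at h2
  rw [h2, map_sum, LinearMap.sum_apply, Finset.sum_apply, map_sum]
  refine Finset.sum_congr rfl fun j _ => ?_
  rw [map_smul, LinearMap.smul_apply, Pi.smul_apply, smul_eq_mul, map_mul, MvPolynomial.eval_C,
    map_prod (MvPolynomial.eval _), mul_comm]
  refine congrArg _ (Finset.prod_congr rfl fun i _ => ?_)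
  rw [← eval_choosePoly]
  have h3 := Polynomial.aeval_algHom_apply (MvPolynomial.aeval (R := ℂ) fun i => (c g i : ℂ))
    (MvPolynomial.X i) (choosePoly (j i))
  rw [MvPolynomial.aeval_X, Polynomial.coe_aeval_eq_eval] at h3
  rw [h3]
  rfl

end Polynomiality

end

end PeriodicGraph

/-! ### Operators `f(D)` on polynomials for analytic germs `f` -/

namespace PeriodicGraph

noncomputable section

open scoped Classical

variable {n : ℕ}

/-! ### Constant coefficient differential operators on polynomials -/

/-- The partial derivative as a linear endomorphism. -/
abbrev pd (i : Fin n) : Module.End ℂ (MvPolynomial (Fin n) ℂ) :=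
  ((MvPolynomial.pderiv i : Derivation ℂ (MvPolynomial (Fin n) ℂ) (MvPolynomial (Fin n) ℂ)) :
      MvPolynomial (Fin n) ℂ →ₗ[ℂ] MvPolynomial (Fin n) ℂ)

lemma pd_commute (i j : Fin n) : pd i * pd j = pd j * pd i := by
  have h : ⁅(MvPolynomial.pderiv i : Derivation ℂ (MvPolynomial (Fin n) ℂ) (MvPolynomial (Fin n) ℂ)),
      (MvPolynomial.pderiv j : Derivation ℂ (MvPolynomial (Fin n) ℂ) (MvPolynomial (Fin n) ℂ))⁆ = 0 := by
    refine MvPolynomial.derivation_ext fun k => ?_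
    rw [Derivation.commutator_apply, MvPolynomial.pderiv_X, MvPolynomial.pderiv_X]
    simp only [Pi.single_apply]
    split_ifs <;> simp
  refine LinearMap.ext fun p => ?_
  have := congrArg (fun D : Derivation ℂ (MvPolynomial (Fin n) ℂ) (MvPolynomial (Fin n) ℂ) => D p) h
  simp only [Derivation.commutator_apply] at this
  exact sub_eq_zero.1 this

/-- The substitution passes through the subalgebra generated by the partial derivatives, because
evaluation of polynomials in several variables needs a commutative target. -/
lemma exists_symbolHom : ∃ Φ : MvPolynomial (Fin n) ℂ →ₐ[ℂ] Module.End ℂ (MvPolynomial (Fin n) ℂ),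
    (∀ Q, Φ Q = symbolOp Q) ∧ ∀ i, Φ (MvPolynomial.X i) = (-Complex.I) • pd i := by
  have hcomm : ∀ a ∈ Set.range (pd (n := n)), ∀ b ∈ Set.range (pd (n := n)), a * b = b * a := by
    rintro _ ⟨i, rfl⟩ _ ⟨j, rfl⟩
    exact pd_commute i j
  let S := Algebra.adjoin ℂ (Set.range (pd (n := n)))
  let _ : CommRing S := { (inferInstance : Ring S) with
    mul_comm := (Algebra.isMulCommutative_adjoin ℂ hcomm).is_comm.comm }
  let d : Fin n → S := fun i => ⟨pd i, Algebra.subset_adjoin ⟨i, rfl⟩⟩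
  refine ⟨S.val.comp (MvPolynomial.aeval fun i => (-Complex.I) • d i), fun Q => ?_, fun i => ?_⟩
  · rw [AlgHom.comp_apply, MvPolynomial.aeval_def, MvPolynomial.eval₂_eq', map_sum, symbolOp]
    refine Finset.sum_congr rfl fun α _ => ?_
    rw [← Algebra.smul_def, map_smul, mul_smul]
    congr 1
    have h1 : ∏ i, ((-Complex.I) • d i) ^ α i =
        (-Complex.I) ^ α.degree • ∏ i, d i ^ α i := by
      simp only [_root_.smul_pow, Finset.prod_smul, Finset.prod_pow_eq_pow_sum,
        Finsupp.degree_eq_sum]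
    rw [h1, map_smul, ← List.prod_ofFn, map_list_prod, List.map_ofFn, partialDeriv]
    rfl
  · rw [AlgHom.comp_apply, MvPolynomial.aeval_X, map_smul]
    rfl

/-- `Q ↦ Q(D)` as an algebra homomorphism. -/
def symbolHom : MvPolynomial (Fin n) ℂ →ₐ[ℂ] Module.End ℂ (MvPolynomial (Fin n) ℂ) :=
  exists_symbolHom.choose

lemma symbolHom_apply (Q : MvPolynomial (Fin n) ℂ) : symbolHom Q = symbolOp Q :=
  exists_symbolHom.choose_spec.1 Q

lemma symbolHom_X (i : Fin n) :
    symbolHom (MvPolynomial.X i : MvPolynomial (Fin n) ℂ) = (-Complex.I) • pd i :=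
  exists_symbolHom.choose_spec.2 i

lemma symbolHom_C (a : ℂ) : symbolHom (MvPolynomial.C a : MvPolynomial (Fin n) ℂ) = a • 1 := by
  rw [← MvPolynomial.algebraMap_eq, AlgHom.commutes, Algebra.algebraMap_eq_smul_one]

/-- Each derivative lowers the degree by one. Vanishing for `m < l` is stated separately because the
truncated `m - l` would only give a constant. -/
lemma symbolHom_homogeneous {Q p : MvPolynomial (Fin n) ℂ} {l m : ℕ} (hQ : Q.IsHomogeneous l)
    (hp : p.IsHomogeneous m) :
    (symbolHom Q p).IsHomogeneous (m - l) ∧ (m < l → symbolHom Q p = 0) := by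
  -- it suffices to consider monomials
  have hmon : ∀ (l : ℕ) (α : Fin n →₀ ℕ), α.degree = l →
      (symbolHom (MvPolynomial.monomial α 1) p).IsHomogeneous (m - l) ∧
        (m < l → symbolHom (MvPolynomial.monomial α 1) p = 0) := by
    intro l
    induction l with
    | zero =>
      intro α hα
      obtain rfl : α = 0 := (Finsupp.degree_eq_zero_iff α).1 hα
      have : symbolHom (MvPolynomial.monomial 0 (1 : ℂ) : MvPolynomial (Fin n) ℂ) = 1 := by
        rw [← MvPolynomial.C_apply, symbolHom_C, one_smul]
      rw [this]
      exact ⟨by simpa using hp, fun h => absurd h (Nat.not_lt_zero _)⟩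
    | succ l ih =>
      intro α hα
      obtain ⟨i, hi⟩ : ∃ i, α i ≠ 0 := by
        by_contra h
        push Not at h
        rw [Finsupp.ext (g := 0) h] at hα
        simp at hα
      have hle : Finsupp.single i 1 ≤ α := by
        rw [Finsupp.single_le_iff]
        exact Nat.one_le_iff_ne_zero.2 hi
      obtain ⟨β, rfl⟩ := exists_add_of_le hle
      have hβ : β.degree = l := by
        rw [map_add, Finsupp.degree_single] at hα
        omega
      have h1 : MvPolynomial.monomial (Finsupp.single i 1 + β) (1 : ℂ) =
          MvPolynomial.X i * MvPolynomial.monomial β 1 := by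
        rw [MvPolynomial.X, MvPolynomial.monomial_mul, one_mul]
      have h2 : symbolHom (MvPolynomial.monomial (Finsupp.single i 1 + β) (1 : ℂ)) p =
          (-Complex.I) • MvPolynomial.pderiv i (symbolHom (MvPolynomial.monomial β 1) p) := by
        rw [h1, map_mul, symbolHom_X]
        rfl
      obtain ⟨ih1, ih2⟩ := ih β hβ
      rw [h2]
      refine ⟨?_, fun hm => ?_⟩
      · rw [MvPolynomial.smul_eq_C_mul, ← Nat.sub_sub]
        have := (MvPolynomial.isHomogeneous_C (Fin n) (-Complex.I)).mul (ih1.pderiv (i := i))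
        rwa [zero_add] at this
      · rcases Nat.lt_or_ge m l with h | h
        · rw [ih2 h, map_zero, smul_zero]
        · have hml : m - l = 0 := by omega
          rw [hml] at ih1
          have := MvPolynomial.totalDegree_eq_zero_iff_eq_C.1
            (Nat.le_zero.1 ih1.totalDegree_le)
          rw [this, MvPolynomial.pderiv_C, smul_zero]
  have hsum : symbolHom Q p = ∑ α ∈ Q.support, Q.coeff α • symbolHom (MvPolynomial.monomial α 1) p := by
    conv_lhs => rw [Q.as_sum, map_sum, LinearMap.sum_apply]
    refine Finset.sum_congr rfl fun α _ => ?_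
    rw [← mul_one (Q.coeff α), ← smul_eq_mul, ← MvPolynomial.smul_monomial, map_smul]
    simp
  have hdeg : ∀ α ∈ Q.support, α.degree = l := fun α hα => by
    have := hQ (MvPolynomial.mem_support_iff.1 hα)
    rw [Finsupp.degree_eq_weight_one]
    exact this
  rw [hsum]
  refine ⟨MvPolynomial.IsHomogeneous.sum _ _ _ fun α hα => ?_, fun h =>
    Finset.sum_eq_zero fun α hα => ?_⟩
  · rw [MvPolynomial.smul_eq_C_mul]
    have := (MvPolynomial.isHomogeneous_C (Fin n) (Q.coeff α)).mul (hmon l α (hdeg α hα)).1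
    rwa [zero_add] at this
  · rw [(hmon l α (hdeg α hα)).2 h, smul_zero]

lemma sum_homogeneousComponent_of_le {p : MvPolynomial (Fin n) ℂ} {N : ℕ} (hp : p.totalDegree ≤ N) :
    ∑ m ∈ Finset.range (N + 1), MvPolynomial.homogeneousComponent m p = p := by
  conv_rhs => rw [← MvPolynomial.sum_homogeneousComponent p]
  refine (Finset.sum_subset (Finset.range_mono (by omega)) fun m _ hm => ?_).symm
  exact MvPolynomial.homogeneousComponent_eq_zero _ _ (by simpa using hm)

lemma symbolHom_totalDegree_le {Q p : MvPolynomial (Fin n) ℂ} {l N : ℕ} (hQ : Q.IsHomogeneous l)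
    (hp : p.totalDegree ≤ N) :
    (symbolHom Q p).totalDegree ≤ N - l ∧ (N < l → symbolHom Q p = 0) := by
  have h1 : symbolHom Q p =
      ∑ m ∈ Finset.range (N + 1), symbolHom Q (MvPolynomial.homogeneousComponent m p) := by
    rw [← map_sum, sum_homogeneousComponent_of_le hp]
  have h2 := fun m => symbolHom_homogeneous hQ (MvPolynomial.homogeneousComponent_isHomogeneous m p)
  rw [h1]
  refine ⟨?_, fun h => Finset.sum_eq_zero fun m hm => (h2 m).2 ?_⟩
  · refine MvPolynomial.totalDegree_finsetSum_le fun m hm => (h2 m).1.totalDegree_le.trans ?_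
    have := Finset.mem_range.1 hm
    omega
  · have := Finset.mem_range.1 hm
    omega

/-! ### Taylor terms -/

lemma taylorTerm_isHomogeneous (f : (Fin n → ℂ) → ℂ) (l : ℕ) : (taylorTerm f l).IsHomogeneous l := by
  refine MvPolynomial.IsHomogeneous.sum _ _ _ fun s _ => ?_
  have h1 : (∏ i, MvPolynomial.X (s i) : MvPolynomial (Fin n) ℂ).IsHomogeneous
      (∑ _i : Fin l, 1) :=
    MvPolynomial.IsHomogeneous.prod _ _ _ fun i _ => MvPolynomial.isHomogeneous_X ℂ (s i)
  have h2 := (MvPolynomial.isHomogeneous_C (Fin n) ((l.factorial : ℂ)⁻¹ *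
      iteratedFDeriv ℂ l f 0 (fun i => Pi.single (s i) 1))).mul h1
  simpa using h2

lemma eval_taylorTerm (f : (Fin n → ℂ) → ℂ) (l : ℕ) (k : Fin n → ℂ) :
    MvPolynomial.eval k (taylorTerm f l) =
      (l.factorial : ℂ)⁻¹ * iteratedFDeriv ℂ l f 0 fun _ => k := by
  have hk : (fun _ : Fin l => k) = fun _ => ∑ j, k j • (Pi.single j 1 : Fin n → ℂ) := by
    funext _
    conv_lhs => rw [pi_eq_sum_univ' k]
  rw [hk, ContinuousMultilinearMap.map_sum, taylorTerm, map_sum, Finset.mul_sum]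
  refine Finset.sum_congr rfl fun s _ => ?_
  rw [ContinuousMultilinearMap.map_smul_univ, map_mul, MvPolynomial.eval_C, map_prod]
  simp only [MvPolynomial.eval_X, smul_eq_mul]
  ring

/-- Restriction to the ray `t ↦ t k` reduces the algebra of Taylor terms to calculus in one
variable. -/
lemma eval_taylorTerm_eq_iteratedDeriv {f : (Fin n → ℂ) → ℂ} (hf : AnalyticAt ℂ f 0) (l : ℕ)
    (k : Fin n → ℂ) :
    MvPolynomial.eval k (taylorTerm f l) =
      (l.factorial : ℂ)⁻¹ * iteratedDeriv l (fun t : ℂ => f (t • k)) 0 := by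
  obtain ⟨p, r, hp⟩ := hf
  let u : ℂ →L[ℂ] (Fin n → ℂ) := (ContinuousLinearMap.id ℂ ℂ).smulRight k
  have hp' : HasFPowerSeriesOnBall f p (u 0) r := by rwa [map_zero]
  have h1 := hp.factorial_smul k l
  have h2 := (hp'.compContinuousLinearMap (u := u)).factorial_smul 1 l
  rw [eval_taylorTerm, ← h1, iteratedDeriv_eq_iteratedFDeriv]
  congr 1
  refine Eq.trans ?_ h2
  rw [FormalMultilinearSeries.compContinuousLinearMap_apply]
  congr 2
  funext _
  simp [u]

lemma analyticAt_ray {f : (Fin n → ℂ) → ℂ} (hf : AnalyticAt ℂ f 0) (k : Fin n → ℂ) :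
    AnalyticAt ℂ (fun t : ℂ => f (t • k)) 0 := by
  have : AnalyticAt ℂ f ((0 : ℂ) • k) := by rwa [zero_smul]
  exact this.comp (f := fun t : ℂ => t • k) (analyticAt_id.smul analyticAt_const)

lemma taylorTerm_congr {f g : (Fin n → ℂ) → ℂ} (h : f =ᶠ[nhds 0] g) (l : ℕ) :
    taylorTerm f l = taylorTerm g l := by
  rw [taylorTerm, taylorTerm, (h.iteratedFDeriv ℂ l).eq_of_nhds]

lemma taylorTerm_mul {f g : (Fin n → ℂ) → ℂ} (hf : AnalyticAt ℂ f 0) (hg : AnalyticAt ℂ g 0)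
    (l : ℕ) : taylorTerm (fun k => f k * g k) l =
      ∑ i ∈ Finset.range (l + 1), taylorTerm f i * taylorTerm g (l - i) := by
  refine MvPolynomial.funext fun k => ?_
  rw [eval_taylorTerm_eq_iteratedDeriv (f := fun k => f k * g k) (hf.mul hg),
    iteratedDeriv_fun_mul (analyticAt_ray hf k).contDiffAt (analyticAt_ray hg k).contDiffAt,
    map_sum, Finset.mul_sum]
  refine Finset.sum_congr rfl fun i hi => ?_
  rw [map_mul, eval_taylorTerm_eq_iteratedDeriv hf, eval_taylorTerm_eq_iteratedDeriv hg]
  have hi' : i ≤ l := Nat.lt_succ_iff.1 (Finset.mem_range.1 hi)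
  have h1 : (l.factorial : ℂ)⁻¹ * (l.choose i : ℂ) =
      (i.factorial : ℂ)⁻¹ * ((l - i).factorial : ℂ)⁻¹ := by
    rw [← Nat.choose_mul_factorial_mul_factorial hi']
    have := (Nat.choose_pos hi').ne'
    have := i.factorial_ne_zero
    have := (l - i).factorial_ne_zero
    push_cast
    field_simp
  rw [← mul_assoc, ← mul_assoc, h1]
  ring

lemma taylorTerm_sum {ι : Type*} (s : Finset ι) {f : ι → (Fin n → ℂ) → ℂ}
    (hf : ∀ i ∈ s, AnalyticAt ℂ (f i) 0) (l : ℕ) :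
    taylorTerm (fun k => ∑ i ∈ s, f i k) l = ∑ i ∈ s, taylorTerm (f i) l := by
  refine MvPolynomial.funext fun k => ?_
  rw [map_sum, eval_taylorTerm_eq_iteratedDeriv (Finset.analyticAt_fun_sum s hf),
    iteratedDeriv_fun_sum fun i hi => (analyticAt_ray (hf i hi) k).contDiffAt, Finset.mul_sum]
  exact Finset.sum_congr rfl fun i hi => (eval_taylorTerm_eq_iteratedDeriv (hf i hi) _ _).symm

lemma taylorTerm_const (a : ℂ) (l : ℕ) :
    taylorTerm (fun _ : Fin n → ℂ => a) l = if l = 0 then MvPolynomial.C a else 0 := by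
  refine MvPolynomial.funext fun k => ?_
  rw [eval_taylorTerm_eq_iteratedDeriv analyticAt_const, iteratedDeriv_const]
  split_ifs with h <;> simp [h]

/-- The operator `f(D)` on polynomials for a function `f` which is analytic at `0`. -/
def analyticOp (f : (Fin n → ℂ) → ℂ) :
    MvPolynomial (Fin n) ℂ →ₗ[ℂ] MvPolynomial (Fin n) ℂ where
  toFun p := ∑ l ∈ Finset.range (p.totalDegree + 1), symbolHom (taylorTerm f l) p
  map_add' p q := by
    have key : ∀ (r : MvPolynomial (Fin n) ℂ) (N : ℕ), r.totalDegree ≤ N →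
        ∑ l ∈ Finset.range (r.totalDegree + 1), symbolHom (taylorTerm f l) r =
          ∑ l ∈ Finset.range (N + 1), symbolHom (taylorTerm f l) r := fun r N hr =>
      Finset.sum_subset (Finset.range_mono (by omega)) fun l _ hl =>
        (symbolHom_totalDegree_le (taylorTerm_isHomogeneous f l) le_rfl).2 (by simpa using hl)
    rw [key (p + q) _ (MvPolynomial.totalDegree_add p q), key p _ (le_max_left _ _),
      key q _ (le_max_right _ _), ← Finset.sum_add_distrib]
    exact Finset.sum_congr rfl fun l _ => map_add _ _ _
  map_smul' a p := by
    rw [RingHom.id_apply, Finset.smul_sum]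
    rw [Finset.sum_subset (Finset.range_mono
      (Nat.succ_le_succ (MvPolynomial.totalDegree_smul_le a p)))
      fun l _ hl => (symbolHom_totalDegree_le (taylorTerm_isHomogeneous f l) le_rfl).2
        (by simpa using hl)]
    exact Finset.sum_congr rfl fun l _ => map_smul _ _ _

lemma analyticOp_apply_of_le (f : (Fin n → ℂ) → ℂ) {p : MvPolynomial (Fin n) ℂ} {N : ℕ}
    (hp : p.totalDegree ≤ N) :
    analyticOp f p = ∑ l ∈ Finset.range (N + 1), symbolHom (taylorTerm f l) p :=
  Finset.sum_subset (Finset.range_mono (by omega)) fun l _ hl =>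
    (symbolHom_totalDegree_le (taylorTerm_isHomogeneous f l) le_rfl).2 (by simpa using hl)

lemma analyticOp_totalDegree_le (f : (Fin n → ℂ) → ℂ) {p : MvPolynomial (Fin n) ℂ} {N : ℕ}
    (hp : p.totalDegree ≤ N) : (analyticOp f p).totalDegree ≤ N := by
  rw [analyticOp_apply_of_le f hp]
  exact MvPolynomial.totalDegree_finsetSum_le fun l _ =>
    (symbolHom_totalDegree_le (taylorTerm_isHomogeneous f l) hp).1.trans (Nat.sub_le _ _)

lemma analyticOp_congr {f g : (Fin n → ℂ) → ℂ} (h : f =ᶠ[nhds 0] g) : analyticOp f = analyticOp g := by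
  refine LinearMap.ext fun p => ?_
  rw [analyticOp_apply_of_le f le_rfl, analyticOp_apply_of_le g le_rfl]
  exact Finset.sum_congr rfl fun l _ => by rw [taylorTerm_congr h]

/-- The Cauchy product of the Taylor series. Products of terms of degrees `i + j > N` annihilate
`p`, so the triangle of index pairs may be completed to a square. -/
lemma analyticOp_mul {f g : (Fin n → ℂ) → ℂ} (hf : AnalyticAt ℂ f 0) (hg : AnalyticAt ℂ g 0) :
    analyticOp (fun k => f k * g k) = analyticOp f ∘ₗ analyticOp g := by
  refine LinearMap.ext fun p => ?_
  set N := p.totalDegree with hN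
  have hpN : p.totalDegree ≤ N := le_rfl
  rw [LinearMap.comp_apply, analyticOp_apply_of_le f (analyticOp_totalDegree_le g hpN),
    analyticOp_apply_of_le _ hpN, analyticOp_apply_of_le g hpN]
  have h1 : ∀ l ∈ Finset.range (N + 1), symbolHom (taylorTerm (fun k => f k * g k) l) p =
      ∑ i ∈ Finset.range (l + 1), symbolHom (taylorTerm f i * taylorTerm g (l - i)) p := by
    intro l _
    rw [taylorTerm_mul hf hg, map_sum, LinearMap.sum_apply]
  rw [Finset.sum_congr rfl h1]
  have h2 : ∑ l ∈ Finset.range (N + 1), ∑ i ∈ Finset.range (l + 1),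
      symbolHom (taylorTerm f i * taylorTerm g (l - i)) p =
      ∑ i ∈ Finset.range (N + 1), ∑ j ∈ Finset.range (N + 1 - i),
        symbolHom (taylorTerm f i * taylorTerm g j) p :=
    Finset.sum_sigma' _ _ _ |>.trans <| by
      rw [Finset.sum_sigma']
      refine Finset.sum_bij' (fun x _ => ⟨x.2, x.1 - x.2⟩) (fun x _ => ⟨x.1 + x.2, x.1⟩) ?_ ?_ ?_ ?_ ?_
      · rintro ⟨l, i⟩ h
        simp only [Finset.mem_sigma, Finset.mem_range] at h ⊢
        omega
      · rintro ⟨i, j⟩ h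
        simp only [Finset.mem_sigma, Finset.mem_range] at h ⊢
        omega
      · rintro ⟨l, i⟩ h
        simp only [Finset.mem_sigma, Finset.mem_range] at h
        simp only [Sigma.mk.injEq, heq_eq_eq, and_true]
        omega
      · rintro ⟨i, j⟩ h
        simp
      · rintro ⟨l, i⟩ h
        rfl
  rw [h2]
  refine Finset.sum_congr rfl fun i hi => ?_
  rw [map_sum]
  rw [Finset.sum_subset (Finset.range_mono (Nat.sub_le _ _) : Finset.range (N + 1 - i) ⊆
    Finset.range (N + 1))]
  · exact Finset.sum_congr rfl fun j _ => by rw [map_mul]; rfl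
  · intro j _ hj
    refine (symbolHom_totalDegree_le ((taylorTerm_isHomogeneous f i).mul
      (taylorTerm_isHomogeneous g j)) hpN).2 ?_
    simp only [Finset.mem_range] at hj
    omega

lemma analyticOp_sum {ι : Type*} (s : Finset ι) {f : ι → (Fin n → ℂ) → ℂ}
    (hf : ∀ i ∈ s, AnalyticAt ℂ (f i) 0) :
    analyticOp (fun k => ∑ i ∈ s, f i k) = ∑ i ∈ s, analyticOp (f i) := by
  refine LinearMap.ext fun p => ?_
  rw [LinearMap.sum_apply, analyticOp_apply_of_le _ le_rfl]
  simp only [analyticOp_apply_of_le _ (le_refl p.totalDegree)]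
  rw [Finset.sum_comm]
  refine Finset.sum_congr rfl fun l _ => ?_
  rw [taylorTerm_sum s hf, map_sum, LinearMap.sum_apply]

lemma analyticOp_const (a : ℂ) : analyticOp (fun _ : Fin n → ℂ => a) = a • LinearMap.id := by
  refine LinearMap.ext fun p => ?_
  rw [analyticOp_apply_of_le _ le_rfl, Finset.sum_eq_single 0]
  · rw [taylorTerm_const, if_pos rfl, symbolHom_C]
    rfl
  · intro l _ hl
    rw [taylorTerm_const, if_neg hl, map_zero, LinearMap.zero_apply]
  · simp

end

end PeriodicGraph

/-! ### Translations as exponentials of derivatives, and matrix operators -/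

namespace PeriodicGraph

noncomputable section

open scoped Classical

variable {n : ℕ}

/-! ### Translations of polynomials -/

/-- The directional derivative `∑ i, a i ∂_i`. -/
def dirDeriv (a : Fin n → ℂ) : Module.End ℂ (MvPolynomial (Fin n) ℂ) := ∑ i, a i • pd i

/-- The restriction of a polynomial to the line through `x` in the direction `a`. -/
def lineHom (x a : Fin n → ℂ) : MvPolynomial (Fin n) ℂ →ₐ[ℂ] Polynomial ℂ :=
  MvPolynomial.aeval fun i => Polynomial.C (x i) + Polynomial.C (a i) * Polynomial.X

lemma eval_lineHom (x a : Fin n → ℂ) (t : ℂ) (p : MvPolynomial (Fin n) ℂ) :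
    (lineHom x a p).eval t = MvPolynomial.eval (fun i => x i + a i * t) p := by
  have : (Polynomial.evalRingHom t).comp (lineHom x a).toRingHom =
      MvPolynomial.eval fun i => x i + a i * t := by
    refine MvPolynomial.ringHom_ext (fun r => ?_) fun i => ?_
    · simp [lineHom]
    · simp [lineHom]
  exact RingHom.congr_fun this p

lemma derivative_lineHom (x a : Fin n → ℂ) (p : MvPolynomial (Fin n) ℂ) :
    Polynomial.derivative (lineHom x a p) = lineHom x a (dirDeriv a p) := by
  have happ : ∀ q : MvPolynomial (Fin n) ℂ, dirDeriv a q = ∑ i, a i • MvPolynomial.pderiv i q := by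
    intro q
    rw [dirDeriv, LinearMap.sum_apply]
    rfl
  induction p using MvPolynomial.induction_on with
  | C r => simp [happ, lineHom]
  | add p q hp hq => simp [hp, hq]
  | mul_X p j hp =>
    rw [map_mul, Polynomial.derivative_mul, hp, happ, happ]
    simp only [Derivation.leibniz, smul_add, Finset.sum_add_distrib, map_add, map_sum,
      map_smul, smul_eq_mul, map_mul, MvPolynomial.pderiv_X]
    have h1 : ∑ i, a i • ((lineHom x a) p * (lineHom x a) ((Pi.single i 1 : Fin n → MvPolynomial (Fin n) ℂ) j)) =
        (lineHom x a) p * Polynomial.derivative (lineHom x a (MvPolynomial.X j)) := by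
      rw [Finset.sum_eq_single j]
      · have : Polynomial.derivative (lineHom x a (MvPolynomial.X j)) = Polynomial.C (a j) := by
          simp [lineHom]
        rw [this, Pi.single_eq_same, map_one, mul_one, Polynomial.smul_eq_C_mul, mul_comm]
      · intro i _ hi
        rw [Pi.single_eq_of_ne hi.symm]
        simp
      · simp
    rw [h1, add_comm, Finset.sum_mul]
    congr 1
    refine Finset.sum_congr rfl fun i _ => ?_
    rw [smul_mul_assoc, mul_comm]

lemma eval_dirDeriv_pow (x a : Fin n → ℂ) (p : MvPolynomial (Fin n) ℂ) (l : ℕ) :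
    MvPolynomial.eval x ((dirDeriv a ^ l) p) = l.factorial * (lineHom x a p).coeff l := by
  have h1 : ∀ q, MvPolynomial.eval x q = (lineHom x a q).coeff 0 := fun q => by
    rw [Polynomial.coeff_zero_eq_eval_zero, eval_lineHom]
    simp
  have h2 : ∀ l : ℕ, lineHom x a ((dirDeriv a ^ l) p) =
      Polynomial.derivative^[l] (lineHom x a p) := by
    intro l
    induction l with
    | zero => simp
    | succ l ih =>
      rw [pow_succ', Module.End.mul_apply, ← derivative_lineHom, ih, Function.iterate_succ_apply']
  rw [h1, h2, Polynomial.coeff_iterate_derivative, zero_add, Nat.descFactorial_self, nsmul_eq_mul]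

/-- The exponential `k ↦ exp (i k·a)`, the symbol of the translation by `a`. -/
def expFn (a : Fin n → ℂ) (k : Fin n → ℂ) : ℂ := Complex.exp (Complex.I * ∑ i, k i * a i)

lemma analyticAt_expFn (a : Fin n → ℂ) (k : Fin n → ℂ) : AnalyticAt ℂ (expFn a) k := by
  unfold expFn
  refine AnalyticAt.cexp' (analyticAt_const.mul (Finset.analyticAt_fun_sum _ fun i _ => ?_))
  exact ((ContinuousLinearMap.proj (R := ℂ) (φ := fun _ : Fin n => ℂ) i).analyticAt k).mul
    analyticAt_const

/-- As `D = -i∂`, the symbol `i k·a` gives the derivative `a·∂`, and the terms are those of its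
exponential series. -/
lemma taylorTerm_expFn (a : Fin n → ℂ) (l : ℕ) :
    symbolHom (taylorTerm (expFn a) l) = (l.factorial : ℂ)⁻¹ • dirDeriv a ^ l := by
  have h : taylorTerm (expFn a) l = MvPolynomial.C ((l.factorial : ℂ)⁻¹) *
      (∑ i, MvPolynomial.C (Complex.I * a i) * MvPolynomial.X i) ^ l := by
    refine MvPolynomial.funext fun k => ?_
    rw [eval_taylorTerm_eq_iteratedDeriv (analyticAt_expFn a 0)]
    have h1 : (fun t : ℂ => expFn a (t • k)) =
        fun t => Complex.exp ((Complex.I * ∑ i, k i * a i) * t) := by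
      funext t
      rw [expFn]
      congr 1
      simp only [Pi.smul_apply, smul_eq_mul, Finset.mul_sum, Finset.sum_mul]
      exact Finset.sum_congr rfl fun i _ => by ring
    rw [h1, iteratedDeriv_cexp_const_mul]
    simp only [mul_zero, Complex.exp_zero, mul_one, map_mul, MvPolynomial.eval_C, map_pow, map_sum,
      MvPolynomial.eval_X, Finset.mul_sum]
    congr 2
    exact Finset.sum_congr rfl fun i _ => by ring
  have h2 : symbolHom (∑ i, MvPolynomial.C (Complex.I * a i) * MvPolynomial.X i) =
      dirDeriv a := by
    rw [map_sum, dirDeriv]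
    refine Finset.sum_congr rfl fun i _ => ?_
    rw [map_mul, symbolHom_C, symbolHom_X, smul_mul_assoc, one_mul, smul_smul]
    congr 1
    linear_combination (-a i) * Complex.I_mul_I
  rw [h, map_mul, map_pow, h2, symbolHom_C, smul_mul_assoc, one_mul]

/-- Taylor's formula along the line through `x` in the direction `a`, a finite sum for polynomials.
Through it a translation becomes an analytic symbol. -/
lemma eval_analyticOp_expFn (a x : Fin n → ℂ) (p : MvPolynomial (Fin n) ℂ) :
    MvPolynomial.eval x (analyticOp (expFn a) p) = MvPolynomial.eval (fun i => x i + a i) p := by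
  set N := max p.totalDegree (lineHom x a p).natDegree
  rw [analyticOp_apply_of_le _ (le_max_left _ _ : _ ≤ N), map_sum]
  have h1 : ∀ l ∈ Finset.range (N + 1),
      MvPolynomial.eval x (symbolHom (taylorTerm (expFn a) l) p) =
        (lineHom x a p).coeff l * 1 ^ l := by
    intro l _
    rw [taylorTerm_expFn, LinearMap.smul_apply, MvPolynomial.smul_eval, eval_dirDeriv_pow,
      inv_mul_cancel_left₀ (Nat.cast_ne_zero.2 l.factorial_ne_zero), one_pow, mul_one]
  rw [Finset.sum_congr rfl h1, ← Polynomial.eval_eq_sum_range' (Nat.lt_succ_iff.2 (le_max_right _ _)),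
    eval_lineHom]
  simp

/-! ### Matrix operators -/

variable {ι κ ν : Type*}

/-- The operator `M(D)` on vector-valued polynomials for a matrix function `M` which is analytic
at `0`. -/
def matOp [Fintype ι] (M : (Fin n → ℂ) → Matrix κ ι ℂ) :
    (ι → MvPolynomial (Fin n) ℂ) →ₗ[ℂ] (κ → MvPolynomial (Fin n) ℂ) :=
  LinearMap.pi fun i => ∑ j, (analyticOp fun k => M k i j) ∘ₗ LinearMap.proj j

lemma matOp_apply [Fintype ι] (M : (Fin n → ℂ) → Matrix κ ι ℂ) (φ : ι → MvPolynomial (Fin n) ℂ) (i : κ) :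
    matOp M φ i = ∑ j, analyticOp (fun k => M k i j) (φ j) := by
  simp [matOp]

/-- The entries of a matrix function are analytic at `0`. -/
def MatAnalytic (M : (Fin n → ℂ) → Matrix κ ι ℂ) : Prop := ∀ i j, AnalyticAt ℂ (fun k => M k i j) 0

lemma MatAnalytic.mul [Fintype ι] {M : (Fin n → ℂ) → Matrix κ ι ℂ} {N : (Fin n → ℂ) → Matrix ι ν ℂ}
    (hM : MatAnalytic M) (hN : MatAnalytic N) : MatAnalytic fun k => M k * N k := fun i j => by
  simp only [Matrix.mul_apply]
  exact Finset.analyticAt_fun_sum _ fun l _ => (hM i l).mul (hN l j)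

lemma MatAnalytic.transpose {M : (Fin n → ℂ) → Matrix κ ι ℂ} (hM : MatAnalytic M) :
    MatAnalytic fun k => (M k).transpose := fun i j => hM j i

lemma matAnalytic_const (A : Matrix κ ι ℂ) : MatAnalytic fun _ : Fin n → ℂ => A :=
  fun _ _ => analyticAt_const

lemma matOp_congr [Fintype ι] {M N : (Fin n → ℂ) → Matrix κ ι ℂ} (h : M =ᶠ[nhds 0] N) : matOp M = matOp N := by
  refine LinearMap.ext fun φ => funext fun i => ?_
  rw [matOp_apply, matOp_apply]
  refine Finset.sum_congr rfl fun j _ => ?_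
  rw [analyticOp_congr (h.mono fun k hk => congrFun (congrFun hk i) j)]

/-- Together with `matOp_congr`, this turns identities of analytic matrices near `0` into identities
of operators on polynomial vectors. -/
lemma matOp_mul [Fintype ι] [Fintype ν] {M : (Fin n → ℂ) → Matrix κ ι ℂ} {N : (Fin n → ℂ) → Matrix ι ν ℂ}
    (hM : MatAnalytic M) (hN : MatAnalytic N) (φ : ν → MvPolynomial (Fin n) ℂ) :
    matOp (fun k => M k * N k) φ = matOp M (matOp N φ) := by
  refine funext fun i => ?_
  simp only [matOp_apply, map_sum, Matrix.mul_apply]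
  rw [Finset.sum_comm]
  refine Finset.sum_congr rfl fun j _ => ?_
  have key := analyticOp_sum Finset.univ (f := fun l k => M k i l * N k l j)
    fun l _ => (hM i l).mul (hN l j)
  rw [key, LinearMap.sum_apply]
  refine Finset.sum_congr rfl fun l _ => ?_
  rw [analyticOp_mul (hM i l) (hN l j)]
  rfl

lemma matOp_one [Fintype ι] [DecidableEq ι] (φ : ι → MvPolynomial (Fin n) ℂ) :
    matOp (fun _ => (1 : Matrix ι ι ℂ)) φ = φ := by
  refine funext fun i => ?_
  rw [matOp_apply, Finset.sum_eq_single i]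
  · rw [analyticOp_const, Matrix.one_apply_eq, one_smul, LinearMap.id_apply]
  · intro j _ hj
    rw [analyticOp_const, Matrix.one_apply_ne hj.symm, zero_smul, LinearMap.zero_apply]
  · simp

lemma matOp_totalDegree_le [Fintype ι] (M : (Fin n → ℂ) → Matrix κ ι ℂ) {φ : ι → MvPolynomial (Fin n) ℂ}
    {N : ℕ} (hφ : ∀ j, (φ j).totalDegree ≤ N) (i : κ) : (matOp M φ i).totalDegree ≤ N := by
  rw [matOp_apply]
  exact MvPolynomial.totalDegree_finsetSum_le fun j _ => analyticOp_totalDegree_le _ (hφ j)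

lemma matrixOp_apply {r : ℕ} (Q : Matrix (Fin r) (Fin r) (MvPolynomial (Fin n) ℂ))
    (φ : Fin r → MvPolynomial (Fin n) ℂ) (i : Fin r) :
    matrixOp Q φ i = ∑ j, symbolHom (Q i j) (φ j) := by
  simp [matrixOp, symbolHom_apply]

lemma mem_polyLE {r N : ℕ} {φ : Fin r → MvPolynomial (Fin n) ℂ} :
    φ ∈ polyLE n r N ↔ ∀ i, (φ i).totalDegree ≤ N := by
  simp [polyLE, Submodule.mem_pi, MvPolynomial.mem_restrictTotalDegree]

lemma matOp_eq_sum_taylorMatrix {r N : ℕ} (F : (Fin n → ℂ) → Matrix (Fin r) (Fin r) ℂ)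
    {φ : Fin r → MvPolynomial (Fin n) ℂ} (hφ : φ ∈ polyLE n r N) :
    matOp F φ = (∑ l ∈ Finset.range (N + 1), matrixOp (taylorMatrix F l)) φ := by
  refine funext fun i => ?_
  rw [matOp_apply, LinearMap.sum_apply, Finset.sum_apply]
  simp only [matrixOp_apply]
  rw [Finset.sum_comm]
  exact Finset.sum_congr rfl fun j _ => analyticOp_apply_of_le _ (mem_polyLE.1 hφ j)

end

end PeriodicGraph

/-! ### Finite dimensionality and joint generalized eigenspaces -/

namespace PeriodicGraph

noncomputable section

open scoped Classical

variable {G V : Type*} [AddCommGroup G] [AddAction G V] {n : ℕ}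

/-! ### Invariant spaces of functions -/

/-- The space `K` of functions is invariant under translations. -/
def TranslInvariant (G : Type*) {V : Type*} [AddCommGroup G] [AddAction G V]
    (K : Submodule ℂ (V → ℂ)) : Prop :=
  ∀ (g : G), ∀ u ∈ K, transl g u ∈ K

/-- The translation on an invariant space. -/
def translOn {K : Submodule ℂ (V → ℂ)} (hK : TranslInvariant G K) (g : G) : Module.End ℂ K :=
  (transl g).restrict (hK g)

lemma coe_translOn {K : Submodule ℂ (V → ℂ)} (hK : TranslInvariant G K) (g : G) (u : K) :
    (translOn hK g u : V → ℂ) = transl g (u : V → ℂ) := rfl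

lemma transl_add (g h : G) : transl (V := V) (g + h) = transl g * transl h := by
  rw [transl, ofAdd_add, map_mul]

lemma translOn_add {K : Submodule ℂ (V → ℂ)} (hK : TranslInvariant G K) (g h : G) :
    translOn hK (g + h) = translOn hK g * translOn hK h := by
  refine LinearMap.ext fun u => Subtype.ext ?_
  rw [coe_translOn, transl_add]
  rfl

lemma translOn_commute {K : Submodule ℂ (V → ℂ)} (hK : TranslInvariant G K) (g h : G) :
    Commute (translOn hK g) (translOn hK h) := by
  rw [Commute, SemiconjBy, ← translOn_add, ← translOn_add, add_comm]

/-- The representation of the group algebra on an invariant space. -/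
def groupActOn {K : Submodule ℂ (V → ℂ)} (hK : TranslInvariant G K) :
    AddMonoidAlgebra ℂ G →ₐ[ℂ] Module.End ℂ K :=
  AddMonoidAlgebra.lift ℂ _ G
    { toFun := fun g => translOn hK (Multiplicative.toAdd g)
      map_one' := LinearMap.ext fun u => Subtype.ext <| by
        rw [coe_translOn, toAdd_one, transl, ofAdd_zero, map_one]
        rfl
      map_mul' := fun g h => translOn_add hK _ _ }

lemma groupActOn_single {K : Submodule ℂ (V → ℂ)} (hK : TranslInvariant G K) (g : G) :
    groupActOn hK (AddMonoidAlgebra.single g 1) = translOn hK g := by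
  rw [groupActOn, AddMonoidAlgebra.lift_single, one_smul]
  rfl

lemma coe_aeval_translOn {K : Submodule ℂ (V → ℂ)} (hK : TranslInvariant G K) (g : G)
    (p : Polynomial ℂ) (u : K) :
    (Polynomial.aeval (translOn hK g) p u : V → ℂ) =
      Polynomial.aeval (transl g) p (u : V → ℂ) := by
  have hpow : ∀ (k : ℕ) (u : K), ((translOn hK g ^ k) u : V → ℂ) = (transl g ^ k) (u : V → ℂ) := by
    intro k
    induction k with
    | zero => intro u; rfl
    | succ k ih => intro u; rw [pow_succ, pow_succ, Module.End.mul_apply, ih]; rfl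
  rw [Polynomial.aeval_eq_sum_range, Polynomial.aeval_eq_sum_range, LinearMap.sum_apply,
    LinearMap.sum_apply, AddSubmonoidClass.coe_finsetSum]
  exact Finset.sum_congr rfl fun k _ => by
    rw [LinearMap.smul_apply, LinearMap.smul_apply, Submodule.coe_smul, hpow]

/-- The image `B` of the group algebra is of finite type and generated by integral elements, hence
finite dimensional. An element `u` of `K` is determined by the functionals `b ↦ (b u)(out q)` on
`B`, one for each of the finitely many orbits. -/
lemma finiteDimensional_of_aeval_transl [Fintype (Orbits G V)] [AddMonoid.FG G]
    {K : Submodule ℂ (V → ℂ)} (hK : TranslInvariant G K)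
    (h : ∀ g : G, ∃ p : Polynomial ℂ, p.Monic ∧
      ∀ u ∈ K, Polynomial.aeval (transl (V := V) g) p u = 0) : FiniteDimensional ℂ K := by
  let A := AddMonoidAlgebra ℂ G
  let ρ : A →ₐ[ℂ] Module.End ℂ K := groupActOn hK
  let B := A ⧸ RingHom.ker ρ
  have hinj : Function.Injective (Ideal.kerLiftAlg ρ) := Ideal.kerLiftAlg_injective ρ
  have hsingle : ∀ g : G, IsIntegral ℂ (Ideal.Quotient.mk (RingHom.ker ρ)
      (AddMonoidAlgebra.single g 1)) := by
    intro g
    obtain ⟨p, hp, hp0⟩ := h g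
    refine ⟨p, hp, hinj ?_⟩
    rw [← Polynomial.aeval_def, ← Polynomial.aeval_algHom_apply, map_zero]
    have h1 : Ideal.kerLiftAlg ρ (Ideal.Quotient.mk (RingHom.ker ρ)
        (AddMonoidAlgebra.single g 1)) = translOn hK g := groupActOn_single hK g
    rw [h1]
    refine LinearMap.ext fun u => Subtype.ext ?_
    rw [coe_aeval_translOn, hp0 _ u.2]
    rfl
  have hint : Algebra.IsIntegral ℂ B := by
    refine ⟨fun b => ?_⟩
    obtain ⟨a, rfl⟩ := Ideal.Quotient.mk_surjective b
    induction a using AddMonoidAlgebra.induction_on with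
    | of g => exact hsingle _
    | add a b ha hb => rw [map_add]; exact ha.add hb
    | smul r a ha =>
      have : Ideal.Quotient.mk (RingHom.ker ρ) (r • a) =
          r • Ideal.Quotient.mk (RingHom.ker ρ) a := rfl
      rw [this]
      exact ha.smul r
  have hft : Algebra.FiniteType ℂ B :=
    Algebra.FiniteType.of_surjective (Ideal.Quotient.mkₐ ℂ (RingHom.ker ρ))
      (Ideal.Quotient.mkₐ_surjective ℂ _)
  have hfinB : Module.Finite ℂ B := Algebra.finite_iff_isIntegral_and_finiteType.2 ⟨hint, hft⟩
  let ev : K →ₗ[ℂ] (Orbits G V → Module.Dual ℂ B) := LinearMap.pi fun q =>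
    { toFun := fun u => (LinearMap.proj (R := ℂ) (φ := fun _ : V => ℂ) (Quotient.out q)) ∘ₗ
        K.subtype ∘ₗ LinearMap.applyₗ u ∘ₗ (Ideal.kerLiftAlg ρ).toLinearMap
      map_add' := fun u w => LinearMap.ext fun b => by simp
      map_smul' := fun r u => LinearMap.ext fun b => by simp }
  have hev : ∀ (u : K) (q : Orbits G V) (g : G), ev u q (Ideal.Quotient.mk (RingHom.ker ρ)
      (AddMonoidAlgebra.single g 1)) = (u : V → ℂ) (g +ᵥ (Quotient.out q : V)) := by
    intro u q g
    have h1 : Ideal.kerLiftAlg ρ (Ideal.Quotient.mk (RingHom.ker ρ)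
        (AddMonoidAlgebra.single g 1)) = translOn hK g := groupActOn_single hK g
    change ((Ideal.kerLiftAlg ρ (Ideal.Quotient.mk (RingHom.ker ρ)
        (AddMonoidAlgebra.single g 1)) u : K) : V → ℂ) (Quotient.out q) = _
    rw [h1]
    rfl
  refine FiniteDimensional.of_injective ev fun u w huw => Subtype.ext (funext_orbits (G := G) fun g q => ?_)
  rw [← hev, ← hev, huw]

lemma fg_of_coordinates (c : G →+ (Fin n → ℤ)) (hc' : Finite c.ker) :
    AddMonoid.FG G := by
  rw [← AddGroup.fg_iff_addMonoid_fg, ← Module.Finite.iff_addGroup_fg]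
  let f : G →ₗ[ℤ] (Fin n → ℤ) := c.toIntLinearMap
  have h1 : Module.Finite ℤ (LinearMap.ker f) := by
    have : Finite (LinearMap.ker f) := hc'
    exact Module.Finite.of_finite
  have h2 : Module.Finite ℤ (LinearMap.range f) := inferInstance
  refine ⟨Submodule.fg_of_fg_map_of_fg_inf_ker f ?_ ?_⟩
  · rw [Submodule.map_top]
    exact Module.Finite.iff_fg.1 h2
  · rw [top_inf_eq]
    exact Module.Finite.iff_fg.1 h1

lemma HasSymbol.translInvariant_polySol [Fintype (Orbits G V)] {P : (V → ℂ) →ₗ[ℂ] (V → ℂ)}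
    {D : Matrix (Orbits G V) (Orbits G V) (AddMonoidAlgebra ℂ G)} (hD : HasSymbol P D)
    (c : G →+ (Fin n → ℤ)) (N : ℕ) : TranslInvariant G (polySol c P N) := by
  rintro g u ⟨hu, hu'⟩
  refine ⟨by rw [hD.transl_comm, hu, map_zero], fun v => ?_⟩
  obtain ⟨C, hC⟩ := hu' (g +ᵥ v)
  refine ⟨C, fun h => ?_⟩
  rw [transl_apply, vadd_comm]
  exact hC h

lemma HasSymbol.finiteDimensional_polySol [Fintype (Orbits G V)] {P : (V → ℂ) →ₗ[ℂ] (V → ℂ)}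
    {D : Matrix (Orbits G V) (Orbits G V) (AddMonoidAlgebra ℂ G)} (hD : HasSymbol P D)
    (hfree : ∀ (g : G) (v : V), g +ᵥ v = v → g = 0) (c : G →+ (Fin n → ℤ)) (hc' : Finite c.ker)
    (hfin : (fermi G P).Finite) (N : ℕ) : FiniteDimensional ℂ (polySol c P N) := by
  have := fg_of_coordinates c hc'
  exact finiteDimensional_of_aeval_transl (hD.translInvariant_polySol c N)
    (hD.exists_aeval_transl_eq_zero hfree c hfin N)

/-! ### Joint generalized eigenspaces of the translations -/

/-- The functions which are generalized `χ`-automorphic. -/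
def genSpace (V : Type*) [AddAction G V] (χ : G → ℂ) : Submodule ℂ (V → ℂ) :=
  ⨅ g : G, (transl (V := V) g).maxGenEigenspace (χ g)

lemma mem_genSpace {χ : G → ℂ} {u : V → ℂ} :
    u ∈ genSpace V χ ↔ ∀ g : G, ∃ k : ℕ, ((transl g - χ g • 1) ^ k) u = 0 := by
  simp only [genSpace, Submodule.mem_iInf, Module.End.mem_maxGenEigenspace]

lemma iSupIndep_genSpace : iSupIndep fun χ : G → ℂ => genSpace V χ := by
  refine Module.End.independent_iInf_maxGenEigenspace_of_forall_mapsTo _ fun g h μ =>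
    Module.End.mapsTo_maxGenEigenspace_of_comm ?_ μ
  rw [Commute, SemiconjBy, ← transl_add, ← transl_add, add_comm]

lemma coe_sub_smul_pow_translOn {K : Submodule ℂ (V → ℂ)} (hK : TranslInvariant G K) (g : G)
    (μ : ℂ) (k : ℕ) (u : K) :
    (((translOn hK g - μ • 1) ^ k) u : V → ℂ) = ((transl g - μ • 1) ^ k) (u : V → ℂ) := by
  induction k generalizing u with
  | zero => rfl
  | succ k ih => rw [pow_succ, pow_succ, Module.End.mul_apply, ih]; rfl

lemma TranslInvariant.eq_iSup {K : Submodule ℂ (V → ℂ)} (hK : TranslInvariant G K)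
    [FiniteDimensional ℂ K] : K = ⨆ χ : G → ℂ, K ⊓ genSpace V χ := by
  refine le_antisymm ?_ (iSup_le fun χ => inf_le_left)
  have h1 := Module.End.iSup_iInf_maxGenEigenspace_eq_top_of_iSup_maxGenEigenspace_eq_top_of_commute
    (translOn hK) (fun g h _ => translOn_commute hK g h)
    fun g => Module.End.iSup_maxGenEigenspace_eq_top _
  have h2 : K = Submodule.map K.subtype ⊤ := by rw [Submodule.map_subtype_top]
  conv_lhs => rw [h2, ← h1, Submodule.map_iSup]
  refine iSup_mono fun χ => ?_
  rintro _ ⟨u, hu, rfl⟩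
  refine ⟨u.2, mem_genSpace.2 fun g => ?_⟩
  obtain ⟨k, hk⟩ := Module.End.mem_maxGenEigenspace _ _ _ |>.1 ((Submodule.mem_iInf _).1 hu g)
  refine ⟨k, ?_⟩
  have := congrArg Subtype.val hk
  rwa [coe_sub_smul_pow_translOn] at this

/-- In a nonzero invariant subspace of least dimension, the eigenspace of one translation is nonzero
by nilpotency and invariant by commutativity, hence everything. Any nonzero vector is then a common
eigenvector. -/
lemma exists_isAutomorphic_of_ne_bot {K : Submodule ℂ (V → ℂ)} (hK : TranslInvariant G K)
    [FiniteDimensional ℂ K] {χ : G → ℂ} (h : K ⊓ genSpace V χ ≠ ⊥) :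
    ∃ u ∈ K, u ≠ 0 ∧ IsAutomorphic χ u := by
  -- a nonzero invariant subspace of minimal dimension
  let Pr : ℕ → Prop := fun d => ∃ S : Submodule ℂ (V → ℂ), S ≤ K ⊓ genSpace V χ ∧ S ≠ ⊥ ∧
    TranslInvariant G S ∧ Module.finrank ℂ S = d
  have hcomm : ∀ (g h : G) (u : V → ℂ), transl g (transl h u) = transl h (transl g u) := by
    intro g h u
    rw [← Module.End.mul_apply, ← transl_add, add_comm, transl_add, Module.End.mul_apply]
  have hcomm' : ∀ (g h : G) (μ : ℂ) (k : ℕ) (u : V → ℂ), ((transl g - μ • 1) ^ k) (transl h u) =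
      transl h (((transl g - μ • 1) ^ k) u) := by
    intro g h μ k
    induction k with
    | zero => intro u; rfl
    | succ k ih =>
      intro u
      rw [pow_succ, Module.End.mul_apply, Module.End.mul_apply, ← ih]
      congr 1
      simp only [LinearMap.sub_apply, LinearMap.smul_apply, Module.End.one_apply, map_sub, map_smul,
        hcomm g h]
  have hex : ∃ d, Pr d := by
    refine ⟨_, K ⊓ genSpace V χ, le_rfl, h, fun g u hu => ⟨hK g u hu.1, mem_genSpace.2 fun h => ?_⟩,
      rfl⟩
    obtain ⟨k, hk⟩ := mem_genSpace.1 hu.2 h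
    exact ⟨k, by rw [hcomm', hk, map_zero]⟩
  obtain ⟨S, hSK, hS0, hSinv, hSd⟩ := Nat.find_spec hex
  have hfd : FiniteDimensional ℂ S := Submodule.finiteDimensional_of_le (hSK.trans inf_le_left)
  have heig : ∀ g : G, S ≤ LinearMap.ker (transl g - χ g • 1) := by
    intro g
    let S' := S ⊓ LinearMap.ker (transl g - χ g • 1)
    have h0 : S' ≠ ⊥ := by
      obtain ⟨x, hx, hx0⟩ := Submodule.exists_mem_ne_zero_of_ne_bot hS0
      have hex' := mem_genSpace.1 (hSK hx).2 g
      have hk := Nat.find_spec hex'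
      obtain ⟨k, hk'⟩ : ∃ k, Nat.find hex' = k + 1 := by
        refine Nat.exists_eq_succ_of_ne_zero fun h => ?_
        rw [h] at hk
        exact hx0 hk
      have hmem : ∀ (j : ℕ), ((transl g - χ g • 1) ^ j) x ∈ S := by
        intro j
        induction j with
        | zero => exact hx
        | succ j ih =>
          rw [pow_succ', Module.End.mul_apply]
          exact S.sub_mem (hSinv g _ ih) (S.smul_mem _ ih)
      refine (Submodule.ne_bot_iff _).2 ⟨((transl g - χ g • 1) ^ k) x, ⟨hmem k, ?_⟩, ?_⟩
      · rw [hk', pow_succ', Module.End.mul_apply] at hk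
        exact hk
      · exact Nat.find_min hex' (by omega)
    have hinv : TranslInvariant G S' := by
      rintro h u ⟨hu1, hu2⟩
      refine ⟨hSinv h u hu1, ?_⟩
      have h1 := hcomm' g h (χ g) 1 u
      rw [pow_one] at h1
      rw [SetLike.mem_coe, LinearMap.mem_ker, h1, LinearMap.mem_ker.1 hu2, map_zero]
    have hle : Module.finrank ℂ S ≤ Module.finrank ℂ S' := by
      rw [hSd]
      exact Nat.find_min' hex ⟨S', inf_le_left.trans hSK, h0, hinv, rfl⟩
    have := Submodule.eq_of_le_of_finrank_le (inf_le_left : S' ≤ S) hle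
    rw [← this]
    exact inf_le_right
  obtain ⟨x, hx, hx0⟩ := Submodule.exists_mem_ne_zero_of_ne_bot hS0
  refine ⟨x, (hSK hx).1, hx0, fun g v => ?_⟩
  have := congrFun (LinearMap.mem_ker.1 (heig g hx)) v
  exact sub_eq_zero.1 this

/-- At a vertex with `u v ≠ 0` the multipliers are seen to be multiplicative. Polynomial growth
along the multiples of `g` and of `-g` forces them onto the unit circle. -/
lemma exists_mem_fermi_of_ne_bot {P : (V → ℂ) →ₗ[ℂ] (V → ℂ)} {c : G →+ (Fin n → ℤ)} {N : ℕ}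
    {χ : G → ℂ} {u : V → ℂ} (hu : u ∈ polySol c P N) (hu0 : u ≠ 0) (hχ : IsAutomorphic χ u) :
    ∃ χ' ∈ fermi G P, χ = fun g => (χ' g : ℂ) := by
  obtain ⟨v, hv⟩ := Function.ne_iff.1 hu0
  rw [Pi.zero_apply] at hv
  have h0 : χ 0 = 1 := by
    have := hχ 0 v
    rw [zero_vadd] at this
    exact (mul_eq_right₀ hv).1 this.symm
  have hadd : ∀ g h, χ (g + h) = χ g * χ h := by
    intro g h
    have h1 := hχ (g + h) v
    rw [add_vadd, hχ, hχ, ← mul_assoc] at h1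
    exact (mul_right_cancel₀ hv h1).symm
  have hpow : ∀ (g : G) (k : ℕ), χ ((k : ℤ) • g) = χ g ^ k := by
    intro g k
    induction k with
    | zero => simpa using h0
    | succ k ih => rw [Nat.cast_succ, add_zsmul, one_zsmul, hadd, ih, pow_succ]
  have hle : ∀ g, ‖χ g‖ ≤ 1 := by
    intro g
    obtain ⟨C, hC⟩ := hu.2 v
    refine le_one_of_pow_le_polynomial (C := C / ‖u v‖) (N := N) (size_nonneg c g) fun k => ?_
    have h1 := hC ((k : ℤ) • g)
    rw [hχ, hpow, norm_mul, norm_pow, size_zsmul] at h1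
    rw [div_mul_eq_mul_div, le_div_iff₀ (norm_pos_iff.2 hv)]
    simpa using h1
  have hnorm : ∀ g, ‖χ g‖ = 1 := by
    intro g
    have h1 : ‖χ g‖ * ‖χ (-g)‖ = 1 := by
      rw [← norm_mul, ← hadd, add_neg_cancel, h0, norm_one]
    have h2 := hle (-g)
    refine le_antisymm (hle g) ?_
    nlinarith [norm_nonneg (χ g), norm_nonneg (χ (-g))]
  let χ' : AddChar G Circle :=
    { toFun := fun g => ⟨χ g, mem_sphere_zero_iff_norm.2 (hnorm g)⟩
      map_zero_eq_one' := Subtype.ext h0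
      map_add_eq_mul' := fun g h => Subtype.ext (hadd g h) }
  exact ⟨χ', ⟨u, hu0, hu.1, hχ⟩, rfl⟩

/-- The polynomially growing solutions are sums of generalized automorphic ones with characters
in the real Fermi surface. -/
lemma HasSymbol.polySol_eq_iSup [Fintype (Orbits G V)] {P : (V → ℂ) →ₗ[ℂ] (V → ℂ)}
    {D : Matrix (Orbits G V) (Orbits G V) (AddMonoidAlgebra ℂ G)} (hD : HasSymbol P D)
    (hfree : ∀ (g : G) (v : V), g +ᵥ v = v → g = 0) (c : G →+ (Fin n → ℤ)) (hc' : Finite c.ker)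
    (hfin : (fermi G P).Finite) (N : ℕ) :
    polySol c P N = ⨆ χ : fermi G P, polySol c P N ⊓ genSpace V fun g => (χ.1 g : ℂ) := by
  have hfd := hD.finiteDimensional_polySol hfree c hc' hfin N
  have hinv := hD.translInvariant_polySol c N
  refine le_antisymm ?_ (iSup_le fun χ => inf_le_left)
  conv_lhs => rw [hinv.eq_iSup]
  refine iSup_le fun χ => ?_
  rcases eq_or_ne (polySol c P N ⊓ genSpace V χ) ⊥ with h | h
  · rw [h]; exact bot_le
  · obtain ⟨u, hu, hu0, hχ⟩ := exists_isAutomorphic_of_ne_bot hinv h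
    obtain ⟨χ', hχ', rfl⟩ := exists_mem_fermi_of_ne_bot hu hu0 hχ
    exact le_iSup (fun χ : fermi G P => polySol c P N ⊓ genSpace V fun g => (χ.1 g : ℂ)) ⟨χ', hχ'⟩

lemma injective_coe_char : Function.Injective fun (χ : AddChar G Circle) (g : G) => (χ g : ℂ) := by
  intro χ ψ h
  refine DFunLike.ext _ _ fun g => Subtype.ext ?_
  exact congrFun h g

lemma IsAutomorphic.mem_genSpace {χ : G → ℂ} {u : V → ℂ} (hu : IsAutomorphic χ u) :
    u ∈ genSpace V χ := by
  refine PeriodicGraph.mem_genSpace.2 fun g => ⟨1, ?_⟩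
  rw [pow_one]
  funext v
  exact sub_eq_zero.2 (hu g v)

lemma mem_polySol_of_isAutomorphic {P : (V → ℂ) →ₗ[ℂ] (V → ℂ)} (c : G →+ (Fin n → ℤ))
    {χ : AddChar G Circle} {u : V → ℂ} (hPu : P u = 0) (hu : IsAutomorphic (fun g => (χ g : ℂ)) u) :
    u ∈ polySol c P 0 := by
  refine ⟨hPu, fun v => ⟨‖u v‖, fun g => ?_⟩⟩
  rw [hu, norm_mul, Circle.norm_coe, one_mul, pow_zero, mul_one]

lemma polySol_mono (c : G →+ (Fin n → ℤ)) (P : (V → ℂ) →ₗ[ℂ] (V → ℂ)) {M N : ℕ} (h : M ≤ N) :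
    polySol c P M ≤ polySol c P N := by
  rintro u ⟨hu, hu'⟩
  refine ⟨hu, fun v => ?_⟩
  obtain ⟨C, hC⟩ := hu' v
  refine ⟨|C|, fun g => (hC g).trans ?_⟩
  have h1 : 1 ≤ 1 + size c g := le_add_of_nonneg_right (size_nonneg c g)
  exact mul_le_mul (le_abs_self C) (pow_le_pow_right₀ h1 h) (by positivity) (abs_nonneg C)

/-- Each character in the Fermi surface contributes a bounded automorphic solution. These are
linearly independent, as they lie in independent generalized eigenspaces. -/
lemma finite_fermi_of_liouvilleOfOrder {P : (V → ℂ) →ₗ[ℂ] (V → ℂ)} {c : G →+ (Fin n → ℤ)} {N : ℕ}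
    (h : LiouvilleOfOrder c P N) : (fermi G P).Finite := by
  have : FiniteDimensional ℂ (polySol c P N) := h
  have hex : ∀ χ : fermi G P, ∃ u : V → ℂ, u ≠ 0 ∧ P u = 0 ∧
      IsAutomorphic (fun g => (χ.1 g : ℂ)) u := fun χ => χ.2
  choose u hu0 hPu hu using hex
  have hmem : ∀ χ, u χ ∈ polySol c P N := fun χ =>
    polySol_mono c P (Nat.zero_le N) (mem_polySol_of_isAutomorphic c (hPu χ) (hu χ))
  have hlin : LinearIndependent ℂ u :=
    (iSupIndep_genSpace (V := V).comp (injective_coe_char.comp Subtype.val_injective)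
      : iSupIndep fun χ : fermi G P => genSpace V fun g => (χ.1 g : ℂ)).linearIndependent _
      (fun χ => (hu χ).mem_genSpace) hu0
  have hlin' : LinearIndependent ℂ fun χ => (⟨u χ, hmem χ⟩ : polySol c P N) :=
    LinearIndependent.of_comp (polySol c P N).subtype hlin
  have := hlin'.finite
  exact Set.toFinite _

end

end PeriodicGraph

/-! ### Generalized automorphic solutions as polynomial vectors -/

namespace PeriodicGraph

noncomputable section

open scoped Classical

variable {G V : Type*} [AddCommGroup G] [AddAction G V] {n : ℕ}

/-! ### Automorphic functions with polynomial coefficients -/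

/-- The function `v ↦ χ(g) φ_q(c g)`, `v = g +ᵥ out q`. -/
def polyFn (c : G →+ (Fin n → ℤ)) (χ : AddChar G Circle) :
    (Orbits G V → MvPolynomial (Fin n) ℂ) →ₗ[ℂ] (V → ℂ) where
  toFun φ v := (χ (shift G v) : ℂ) *
    MvPolynomial.eval (fun i => (c (shift G v) i : ℂ)) (φ (Quotient.mk _ v))
  map_add' φ ψ := by
    funext v
    simp [mul_add]
  map_smul' a φ := by
    funext v
    simp [mul_left_comm]

lemma polyFn_apply (hfree : ∀ (g : G) (v : V), g +ᵥ v = v → g = 0) (c : G →+ (Fin n → ℤ))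
    (χ : AddChar G Circle) (φ : Orbits G V → MvPolynomial (Fin n) ℂ) (g : G) (q : Orbits G V) :
    polyFn c χ φ (g +ᵥ (Quotient.out q : V)) =
      (χ g : ℂ) * MvPolynomial.eval (fun i => (c g i : ℂ)) (φ q) := by
  change (χ (shift G (g +ᵥ (Quotient.out q : V))) : ℂ) * _ = _
  rw [shift_vadd_out_eq hfree, mk_vadd_out]

lemma eq_zero_of_eval_int {p : MvPolynomial (Fin n) ℂ}
    (h : ∀ x : Fin n → ℤ, MvPolynomial.eval (fun i => (x i : ℂ)) p = 0) : p = 0 := by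
  refine MvPolynomial.funext_set (fun _ => Set.range ((↑) : ℤ → ℂ))
    (fun _ => Set.infinite_range_of_injective Int.cast_injective) fun x hx => ?_
  choose y hy using fun i => hx i (Set.mem_univ i)
  rw [map_zero, ← h y]
  simp only [hy]

lemma polyFn_injective (hfree : ∀ (g : G) (v : V), g +ᵥ v = v → g = 0) (c : G →+ (Fin n → ℤ))
    (hc : Function.Surjective c) (χ : AddChar G Circle) :
    Function.Injective (polyFn (V := V) c χ) := by
  rw [injective_iff_map_eq_zero]
  intro φ hφ
  funext q
  refine eq_zero_of_eval_int fun x => ?_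
  obtain ⟨g, rfl⟩ := hc x
  have := congrFun hφ (g +ᵥ (Quotient.out q : V))
  rw [polyFn_apply hfree] at this
  exact (mul_eq_zero.1 this).resolve_left (Circle.coe_ne_zero _)

/-- The coordinates of `c g` as complex numbers. -/
def coordC (c : G →+ (Fin n → ℤ)) (g : G) : Fin n → ℂ := fun i => (c g i : ℂ)

lemma twist_eq_expFn (c : G →+ (Fin n → ℤ)) (χ : AddChar G Circle) (k : Fin n → ℂ) (g : G) :
    twist c χ k g = (χ g : ℂ) * expFn (coordC c g) k := rfl

lemma bloch_eq_sum (c : G →+ (Fin n → ℤ))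
    (D : Matrix (Orbits G V) (Orbits G V) (AddMonoidAlgebra ℂ G))
    (χ : AddChar G Circle) (p q : Orbits G V) :
    (fun k => bloch c D χ k p q) = fun k => ∑ h ∈ (D p q).coeff.support,
      ((D p q).coeff h * (χ h : ℂ)) * expFn (coordC c h) k := by
  funext k
  rw [bloch_apply, Finsupp.sum]
  exact Finset.sum_congr rfl fun h _ => by rw [twist_eq_expFn, mul_assoc]

lemma matAnalytic_bloch (c : G →+ (Fin n → ℤ))
    (D : Matrix (Orbits G V) (Orbits G V) (AddMonoidAlgebra ℂ G))
    (χ : AddChar G Circle) : MatAnalytic (bloch c D χ) := by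
  intro p q
  rw [bloch_eq_sum]
  exact Finset.analyticAt_fun_sum _ fun h _ => analyticAt_const.mul (analyticAt_expFn _ _)

variable [Fintype (Orbits G V)]

/-- Translation by `h` multiplies the character factor by `χ h` and acts on the polynomial as `exp(i
c(h)·D)`. Summing over the symbol gives the Bloch matrix with `k` replaced by `D`. -/
lemma HasSymbol.apply_polyFn {P : (V → ℂ) →ₗ[ℂ] (V → ℂ)}
    {D : Matrix (Orbits G V) (Orbits G V) (AddMonoidAlgebra ℂ G)} (hD : HasSymbol P D)
    (hfree : ∀ (g : G) (v : V), g +ᵥ v = v → g = 0) (c : G →+ (Fin n → ℤ))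
    (χ : AddChar G Circle) (φ : Orbits G V → MvPolynomial (Fin n) ℂ) :
    P (polyFn c χ φ) = polyFn c χ (matOp (bloch c D χ) φ) := by
  refine funext_orbits (G := G) fun g p => ?_
  rw [hD.apply_eq, polyFn_apply hfree, matOp_apply, map_sum, Finset.mul_sum]
  refine Finset.sum_congr rfl fun q _ => ?_
  have key := analyticOp_sum (D p q).coeff.support
    (f := fun h k => ((D p q).coeff h * (χ h : ℂ)) * expFn (coordC c h) k)
    fun h _ => analyticAt_const.mul (analyticAt_expFn _ _)
  rw [bloch_eq_sum, key, LinearMap.sum_apply, map_sum, Finset.mul_sum, Finsupp.sum]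
  refine Finset.sum_congr rfl fun h _ => ?_
  have h2 := analyticOp_mul (f := fun _ : Fin n → ℂ => (D p q).coeff h * (χ h : ℂ))
    analyticAt_const (analyticAt_expFn (coordC c h) 0)
  rw [h2, analyticOp_const, LinearMap.comp_apply, LinearMap.smul_apply, LinearMap.id_apply,
    MvPolynomial.smul_eval, eval_analyticOp_expFn, ← add_vadd, polyFn_apply hfree,
    AddChar.map_add_eq_mul, Circle.coe_mul]
  have h3 : (fun i => (c (h + g) i : ℂ)) = fun i => (c g i : ℂ) + coordC c h i := by
    funext i
    simp [coordC, add_comm]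
  rw [h3]
  ring

/-- The vector-valued polynomials of degree at most `N` annihilated by `M(D)`. -/
def polySolSpace {ι : Type*} [Fintype ι] (M : (Fin n → ℂ) → Matrix ι ι ℂ) (N : ℕ) :
    Submodule ℂ (ι → MvPolynomial (Fin n) ℂ) :=
  LinearMap.ker (matOp M) ⊓ Submodule.pi Set.univ fun _ => MvPolynomial.restrictTotalDegree (Fin n) ℂ N

omit [Fintype (Orbits G V)] in
lemma mem_polySolSpace {ι : Type*} [Fintype ι] {M : (Fin n → ℂ) → Matrix ι ι ℂ} {N : ℕ}
    {φ : ι → MvPolynomial (Fin n) ℂ} :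
    φ ∈ polySolSpace M N ↔ matOp M φ = 0 ∧ ∀ i, (φ i).totalDegree ≤ N := by
  simp [polySolSpace, Submodule.mem_pi, MvPolynomial.mem_restrictTotalDegree]

/-! ### Growth of polynomials on the integer points -/

omit [Fintype (Orbits G V)] in
lemma exists_norm_eval_le {p : MvPolynomial (Fin n) ℂ} {N : ℕ} (hp : p.totalDegree ≤ N) :
    ∃ C : ℝ, ∀ x : Fin n → ℤ,
      ‖MvPolynomial.eval (fun i => (x i : ℂ)) p‖ ≤ C * (1 + ∑ i, |(x i : ℝ)|) ^ N := by
  refine ⟨∑ α ∈ p.support, ‖p.coeff α‖, fun x => ?_⟩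
  rw [MvPolynomial.eval_eq', Finset.sum_mul]
  refine (norm_sum_le _ _).trans (Finset.sum_le_sum fun α hα => ?_)
  rw [norm_mul, norm_prod]
  refine mul_le_mul_of_nonneg_left ?_ (norm_nonneg _)
  have h1 : 1 ≤ 1 + ∑ i, |(x i : ℝ)| :=
    le_add_of_nonneg_right (Finset.sum_nonneg fun i _ => abs_nonneg _)
  calc ∏ i, ‖(x i : ℂ) ^ α i‖ ≤ ∏ i, (1 + ∑ i, |(x i : ℝ)|) ^ α i := by
        refine Finset.prod_le_prod (fun i _ => norm_nonneg _) fun i _ => ?_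
        rw [norm_pow, Complex.norm_intCast]
        refine pow_le_pow_left₀ (abs_nonneg _) ?_ _
        have := Finset.single_le_sum (f := fun i => |(x i : ℝ)|) (fun i _ => abs_nonneg _)
          (Finset.mem_univ i)
        linarith
    _ = (1 + ∑ i, |(x i : ℝ)|) ^ α.degree := by
        rw [Finset.prod_pow_eq_pow_sum, Finsupp.degree_eq_sum]
    _ ≤ (1 + ∑ i, |(x i : ℝ)|) ^ N := by
        refine pow_le_pow_right₀ h1 (le_trans ?_ hp)
        exact MvPolynomial.le_totalDegree hα

omit [Fintype (Orbits G V)] in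
-- A polynomial of larger degree would dominate `(X + 1)^N` strictly along the natural numbers,
-- while the bound says the opposite.
lemma natDegree_le_of_norm_eval_le {f : Polynomial ℂ} {N : ℕ} {C : ℝ}
    (h : ∀ t : ℕ, ‖f.eval (t : ℂ)‖ ≤ C * (1 + t) ^ N) : f.natDegree ≤ N := by
  by_contra! hlt
  have hdeg : ((Polynomial.X + Polynomial.C (1 : ℂ)) ^ N).degree < f.degree := by
    refine Polynomial.degree_lt_degree ?_
    rwa [Polynomial.natDegree_pow, Polynomial.natDegree_X_add_C, mul_one]
  have h1 := (Polynomial.isLittleO_cobounded_of_degree_lt hdeg).comp_tendsto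
    (tendsto_natCast_atTop_cobounded (α := ℂ))
  have h2 : ∀ t : ℕ, ‖((Polynomial.X + Polynomial.C (1 : ℂ)) ^ N).eval (t : ℂ)‖ = (1 + t) ^ N := by
    intro t
    rw [Polynomial.eval_pow, norm_pow]
    congr 1
    rw [Polynomial.eval_add, Polynomial.eval_X, Polynomial.eval_C]
    have : (t : ℂ) + 1 = ((t + 1 : ℕ) : ℂ) := by push_cast; rfl
    rw [this, Complex.norm_natCast]
    push_cast
    ring
  have h3 : (f.eval ∘ ((↑) : ℕ → ℂ)) =O[Filter.atTop]
      (((Polynomial.X + Polynomial.C (1 : ℂ)) ^ N).eval ∘ ((↑) : ℕ → ℂ)) := by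
    refine Asymptotics.IsBigO.of_bound C (Filter.Eventually.of_forall fun t => ?_)
    rw [Function.comp_apply, Function.comp_apply, h2]
    exact h t
  refine Asymptotics.isLittleO_irrefl ?_ (h1.trans_isBigO h3)
  refine Filter.Frequently.of_forall fun t => norm_pos_iff.1 ?_
  rw [Function.comp_apply, h2]
  positivity

omit [Fintype (Orbits G V)] in
lemma lineHom_zero_homogeneous {p : MvPolynomial (Fin n) ℂ} {m : ℕ} (hp : p.IsHomogeneous m)
    (x : Fin n → ℂ) : lineHom 0 x p = Polynomial.C (MvPolynomial.eval x p) * Polynomial.X ^ m := by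
  refine Polynomial.funext fun t => ?_
  rw [eval_lineHom, Polynomial.eval_mul, Polynomial.eval_C, Polynomial.eval_pow, Polynomial.eval_X,
    MvPolynomial.eval_eq', MvPolynomial.eval_eq', Finset.sum_mul]
  refine Finset.sum_congr rfl fun α hα => ?_
  have hα : α.degree = m := by
    rw [Finsupp.degree_eq_weight_one]
    exact hp (MvPolynomial.mem_support_iff.1 hα)
  simp only [Pi.zero_apply, zero_add, mul_pow, Finset.prod_mul_distrib]
  rw [Finset.prod_pow_eq_pow_sum, ← Finsupp.degree_eq_sum, hα, mul_assoc]

omit [Fintype (Orbits G V)] in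
-- On the ray through an integer point `x`, the coefficient of degree `d` is the value at `x` of the
-- top homogeneous part. If `d > N`, the growth in one variable makes it zero for every such `x`, so
-- the top part vanishes.
lemma totalDegree_le_of_norm_eval_le {p : MvPolynomial (Fin n) ℂ} {N : ℕ} {C : ℝ}
    (h : ∀ x : Fin n → ℤ,
      ‖MvPolynomial.eval (fun i => (x i : ℂ)) p‖ ≤ C * (1 + ∑ i, |(x i : ℝ)|) ^ N) :
    p.totalDegree ≤ N := by
  by_contra! hlt
  set d := p.totalDegree with hd
  have h0 : MvPolynomial.homogeneousComponent d p ≠ 0 := by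
    have hp0 : p ≠ 0 := by
      rintro rfl
      rw [MvPolynomial.totalDegree_zero] at hd
      omega
    obtain ⟨α, hα, hαd⟩ := Finset.exists_mem_eq_sup p.support (MvPolynomial.support_nonempty.2 hp0)
      fun s => s.sum fun _ e => e
    refine MvPolynomial.ne_zero_iff.2 ⟨α, ?_⟩
    rw [MvPolynomial.coeff_homogeneousComponent, if_pos]
    · exact MvPolynomial.mem_support_iff.1 hα
    · rw [hd, MvPolynomial.totalDegree, hαd]
      rfl
  refine h0 (eq_zero_of_eval_int fun x => ?_)
  -- the restriction of `p` to the ray through `x`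
  let f : Polynomial ℂ := lineHom 0 (fun i => (x i : ℂ)) p
  have hf : f.natDegree ≤ N := by
    refine natDegree_le_of_norm_eval_le
      (C := |C| * (1 + ∑ i, |(x i : ℝ)|) ^ N) fun t => ?_
    have h1 := h fun i => x i * t
    have h2 : f.eval (t : ℂ) = MvPolynomial.eval (fun i => ((x i * t : ℤ) : ℂ)) p := by
      rw [eval_lineHom]
      simp
    rw [h2]
    refine h1.trans ?_
    rw [mul_assoc, ← mul_pow]
    refine mul_le_mul (le_abs_self C) (pow_le_pow_left₀ ?_ ?_ _) ?_ (abs_nonneg C)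
    · positivity
    · push_cast
      simp only [abs_mul, Nat.abs_cast]
      rw [← Finset.sum_mul]
      have : 0 ≤ ∑ i, |(x i : ℝ)| := Finset.sum_nonneg fun i _ => abs_nonneg _
      nlinarith [t.cast_nonneg (α := ℝ)]
    · positivity
  have hcoeff : f.coeff d = 0 := Polynomial.coeff_eq_zero_of_natDegree_lt (by omega)
  have h3 : f = ∑ m ∈ Finset.range (d + 1), Polynomial.C (MvPolynomial.eval (fun i => (x i : ℂ))
      (MvPolynomial.homogeneousComponent m p)) * Polynomial.X ^ m := by
    have h4 : f = lineHom 0 (fun i => (x i : ℂ)) p := rfl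
    rw [h4]
    conv_lhs => rw [← sum_homogeneousComponent_of_le (le_refl p.totalDegree)]
    rw [map_sum]
    exact Finset.sum_congr rfl fun m _ => lineHom_zero_homogeneous
      (MvPolynomial.homogeneousComponent_isHomogeneous m p) _
  rw [h3, Polynomial.finsetSum_coeff, Finset.sum_eq_single d] at hcoeff
  · rwa [Polynomial.coeff_C_mul_X_pow, if_pos rfl] at hcoeff
  · intro m _ hm
    rw [Polynomial.coeff_C_mul_X_pow, if_neg hm.symm]
  · simp

/-! ### Solutions as automorphic functions with polynomial coefficients -/

omit [Fintype (Orbits G V)] in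
lemma analyticOp_sub_one_totalDegree_le (a : Fin n → ℂ) {p : MvPolynomial (Fin n) ℂ} {N : ℕ}
    (hp : p.totalDegree ≤ N) :
    (analyticOp (expFn a) p - p).totalDegree ≤ N - 1 ∧ (N = 0 → analyticOp (expFn a) p - p = 0) := by
  have h0 : symbolHom (taylorTerm (expFn a) 0) p = p := by
    rw [taylorTerm_expFn, Nat.factorial_zero, Nat.cast_one, inv_one, one_smul, pow_zero,
      Module.End.one_apply]
  have h1 : analyticOp (expFn a) p - p =
      ∑ l ∈ Finset.range N, symbolHom (taylorTerm (expFn a) (l + 1)) p := by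
    rw [analyticOp_apply_of_le _ hp, Finset.sum_range_succ', h0, add_sub_cancel_right]
  rw [h1]
  refine ⟨MvPolynomial.totalDegree_finsetSum_le fun l _ =>
    ((symbolHom_totalDegree_le (taylorTerm_isHomogeneous _ _) hp).1).trans (by omega), ?_⟩
  rintro rfl
  simp

omit [Fintype (Orbits G V)] in
lemma transl_polyFn (hfree : ∀ (g : G) (v : V), g +ᵥ v = v → g = 0) (c : G →+ (Fin n → ℤ))
    (χ : AddChar G Circle) (φ : Orbits G V → MvPolynomial (Fin n) ℂ) (g : G) :
    transl g (polyFn c χ φ) =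
      (χ g : ℂ) • polyFn c χ fun q => analyticOp (expFn (coordC c g)) (φ q) := by
  refine funext_orbits (G := G) fun h q => ?_
  rw [transl_apply, Pi.smul_apply, ← add_vadd, polyFn_apply hfree, polyFn_apply hfree,
    eval_analyticOp_expFn, AddChar.map_add_eq_mul, Circle.coe_mul, smul_eq_mul, mul_assoc]
  have h3 : (fun i => (c (g + h) i : ℂ)) = fun i => (c h i : ℂ) + coordC c g i := by
    funext i
    simp [coordC, add_comm]
  rw [h3]

omit [Fintype (Orbits G V)] in
-- After division by the character, translation minus the identity lowers the degree, so `N + 1`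
-- applications annihilate the function.
lemma polyFn_mem_genSpace (hfree : ∀ (g : G) (v : V), g +ᵥ v = v → g = 0) (c : G →+ (Fin n → ℤ))
    (χ : AddChar G Circle) {φ : Orbits G V → MvPolynomial (Fin n) ℂ} {N : ℕ}
    (hφ : ∀ q, (φ q).totalDegree ≤ N) : polyFn c χ φ ∈ genSpace V fun g => (χ g : ℂ) := by
  refine mem_genSpace.2 fun g => ⟨N + 1, ?_⟩
  have hstep : ∀ φ : Orbits G V → MvPolynomial (Fin n) ℂ,
      (transl g - (χ g : ℂ) • 1) (polyFn c χ φ) =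
        (χ g : ℂ) • polyFn c χ fun q => analyticOp (expFn (coordC c g)) (φ q) - φ q := by
    intro φ
    rw [LinearMap.sub_apply, transl_polyFn hfree, LinearMap.smul_apply, Module.End.one_apply,
      ← smul_sub, ← map_sub]
    rfl
  induction N generalizing φ with
  | zero =>
    rw [zero_add, pow_one, hstep]
    have : (fun q => analyticOp (expFn (coordC c g)) (φ q) - φ q) = 0 :=
      funext fun q => (analyticOp_sub_one_totalDegree_le _ (hφ q)).2 rfl
    rw [this, map_zero, smul_zero]
  | succ N ih =>
    rw [pow_succ, Module.End.mul_apply, hstep, map_smul,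
      ih fun q => (analyticOp_sub_one_totalDegree_le _ (hφ q)).1, smul_zero]

omit [Fintype (Orbits G V)] in
-- Division by `χ` along an orbit turns `T_g - χ(g)` into a multiple of `T_g - 1`, so the
-- restriction to the orbit is unipotent and hence polynomial.
lemma exists_eq_polyFn (hfree : ∀ (g : G) (v : V), g +ᵥ v = v → g = 0) (c : G →+ (Fin n → ℤ))
    (hc : Function.Surjective c) (hc' : Finite c.ker) (χ : AddChar G Circle) {u : V → ℂ}
    (hu : u ∈ genSpace V fun g => (χ g : ℂ)) :
    ∃ φ : Orbits G V → MvPolynomial (Fin n) ℂ, u = polyFn c χ φ := by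
  have hex : ∀ q : Orbits G V, ∃ φ : MvPolynomial (Fin n) ℂ, ∀ g,
      (χ (-g) : ℂ) * u (g +ᵥ (Quotient.out q : V)) = MvPolynomial.eval (fun i => (c g i : ℂ)) φ := by
    intro q
    refine exists_eval_eq_of_unipotent c hc hc'
      (f := fun g => (χ (-g) : ℂ) * u (g +ᵥ (Quotient.out q : V))) fun g => ?_
    obtain ⟨k, hk⟩ := mem_genSpace.1 hu g
    refine ⟨k, ?_⟩
    have hpow : ∀ (k : ℕ) (w : V → ℂ),
        ((transl (V := G) g - 1) ^ k) (fun g => (χ (-g) : ℂ) * w (g +ᵥ (Quotient.out q : V))) =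
          fun h => (χ (-g) : ℂ) ^ k * ((χ (-h) : ℂ) *
            ((transl g - (χ g : ℂ) • 1) ^ k) w (h +ᵥ (Quotient.out q : V))) := by
      intro k
      induction k with
      | zero => intro w; simp
      | succ k ih =>
        intro w
        have h1 : (transl (V := G) g - 1)
            (fun g => (χ (-g) : ℂ) * w (g +ᵥ (Quotient.out q : V))) =
            (χ (-g) : ℂ) • fun h => (χ (-h) : ℂ) *
              (transl g - (χ g : ℂ) • 1) w (h +ᵥ (Quotient.out q : V)) := by
          funext h
          have h2 : (χ (-g) : ℂ) * (χ g : ℂ) = 1 := by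
            rw [← Circle.coe_mul, ← AddChar.map_add_eq_mul, neg_add_cancel, AddChar.map_zero_eq_one,
              Circle.coe_one]
          have h3 : (χ (-(g + h)) : ℂ) = (χ (-g) : ℂ) * (χ (-h) : ℂ) := by
            rw [neg_add, AddChar.map_add_eq_mul, Circle.coe_mul]
          simp only [LinearMap.sub_apply, Module.End.one_apply, Pi.sub_apply, transl_apply,
            vadd_eq_add, h3, LinearMap.smul_apply, Pi.smul_apply, smul_eq_mul, add_vadd]
          linear_combination ((χ (-h) : ℂ) * w (h +ᵥ (Quotient.out q : V))) * h2
        rw [pow_succ, Module.End.mul_apply, h1, map_smul, ih, pow_succ (transl g - _),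
          Module.End.mul_apply]
        funext h
        simp only [Pi.smul_apply, smul_eq_mul]
        ring
    rw [hpow, hk]
    funext h
    simp
  choose φ hφ using hex
  refine ⟨φ, funext_orbits (G := G) fun g q => ?_⟩
  rw [polyFn_apply hfree, ← hφ, ← mul_assoc, ← Circle.coe_mul, ← AddChar.map_add_eq_mul,
    add_neg_cancel, AddChar.map_zero_eq_one, Circle.coe_one, one_mul]

/-- Growth of order `N` on the integer points is the same as degree at most `N`. Growth from a
vertex other than a representative is read off a translated polynomial, whose degree is no larger.
-/
lemma HasSymbol.polySol_inf_genSpace {P : (V → ℂ) →ₗ[ℂ] (V → ℂ)}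
    {D : Matrix (Orbits G V) (Orbits G V) (AddMonoidAlgebra ℂ G)} (hD : HasSymbol P D)
    (hfree : ∀ (g : G) (v : V), g +ᵥ v = v → g = 0) (c : G →+ (Fin n → ℤ))
    (hc : Function.Surjective c) (hc' : Finite c.ker) (χ : AddChar G Circle) (N : ℕ) :
    polySol c P N ⊓ genSpace V (fun g => (χ g : ℂ)) =
      (polySolSpace (bloch c D χ) N).map (polyFn c χ) := by
  refine le_antisymm ?_ ?_
  · rintro u ⟨⟨hPu, hgrowth⟩, hu⟩
    obtain ⟨φ, rfl⟩ := exists_eq_polyFn hfree c hc hc' χ hu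
    refine ⟨φ, mem_polySolSpace.2 ⟨?_, fun q => ?_⟩, rfl⟩
    · rw [hD.apply_polyFn hfree] at hPu
      exact (map_eq_zero_iff _ (polyFn_injective hfree c hc χ)).1 hPu
    · obtain ⟨C, hC⟩ := hgrowth (Quotient.out q)
      refine totalDegree_le_of_norm_eval_le (C := C) fun x => ?_
      obtain ⟨g, rfl⟩ := hc x
      have := hC g
      rwa [polyFn_apply hfree, norm_mul, Circle.norm_coe, one_mul] at this
  · rintro _ ⟨φ, hφ, rfl⟩
    obtain ⟨h1, h2⟩ := mem_polySolSpace.1 hφ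
    refine ⟨⟨by rw [hD.apply_polyFn hfree, h1, map_zero], fun v => ?_⟩,
      polyFn_mem_genSpace hfree c χ h2⟩
    obtain ⟨C, hC⟩ := exists_norm_eval_le
      ((analyticOp_totalDegree_le (expFn (coordC c (shift G v))) (h2 (Quotient.mk _ v))))
    refine ⟨C, fun g => ?_⟩
    have h3 : g +ᵥ v = (g + shift G v) +ᵥ (Quotient.out (Quotient.mk _ v : Orbits G V) : V) := by
      rw [add_vadd, shift_vadd_out]
    have h4 := hC (c g)
    rw [eval_analyticOp_expFn] at h4
    rw [h3, polyFn_apply hfree, norm_mul, Circle.norm_coe, one_mul]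
    have h5 : (fun i => (c (g + shift G v) i : ℂ)) =
        fun i => (c g i : ℂ) + coordC c (shift G v) i := by
      funext i
      simp [coordC]
    rw [h5]
    exact h4

end

end PeriodicGraph

/-! ### Floquet functions, the sum over characters and the upper bound -/

namespace PeriodicGraph

noncomputable section

open scoped Classical

variable {G V : Type*} [AddCommGroup G] [AddAction G V] [Fintype (Orbits G V)] {n : ℕ}

/-! ### Floquet functions -/

omit [AddCommGroup G] [AddAction G V] [Fintype (Orbits G V)] in
lemma mem_multiIndices {N : ℕ} {j : Fin n → ℕ} : j ∈ multiIndices n N ↔ ∑ i, j i ≤ N := by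
  rw [multiIndices, Finset.mem_filter, and_iff_right_iff_imp, Fintype.mem_piFinset]
  intro h i
  rw [Finset.mem_range]
  have := Finset.single_le_sum (f := j) (fun i _ => Nat.zero_le _) (Finset.mem_univ i)
  omega

omit [Fintype (Orbits G V)] in
lemma IsCoordinates.eq_shift {c : G →+ (Fin n → ℤ)} {ξ : V → Fin n → ℝ} (hξ : IsCoordinates c ξ)
    (v : V) (i : Fin n) :
    ξ v i = ξ (Quotient.out (Quotient.mk _ v : Orbits G V)) i + c (shift G v) i := by
  rw [← hξ, shift_vadd_out]

omit [Fintype (Orbits G V)] in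
-- On each orbit `ξ` differs from the group coordinates by a constant, so both expansions are
-- related by a translation of polynomials that does not raise the degree. In particular the choices
-- of `ξ` and `e` are immaterial.
lemma isFloquet_iff (hfree : ∀ (g : G) (v : V), g +ᵥ v = v → g = 0) {c : G →+ (Fin n → ℤ)}
    {ξ : V → Fin n → ℝ} (hξ : IsCoordinates c ξ) (χ : AddChar G Circle) (N : ℕ) (u : V → ℂ) :
    IsFloquet ξ χ N u ↔ ∃ φ : Orbits G V → MvPolynomial (Fin n) ℂ,
      (∀ q, (φ q).totalDegree ≤ N) ∧ u = polyFn c χ φ := by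
  constructor
  · rintro ⟨e, p, -, he, hp, hu⟩
    refine ⟨fun q => ∑ j ∈ multiIndices n N, MvPolynomial.C (e (Quotient.out q) * p j (Quotient.out q)) *
      ∏ i, (MvPolynomial.X i + MvPolynomial.C (ξ (Quotient.out q) i : ℂ)) ^ j i, fun q => ?_, ?_⟩
    · refine MvPolynomial.totalDegree_finsetSum_le fun j hj => ?_
      refine (MvPolynomial.totalDegree_mul _ _).trans ?_
      rw [MvPolynomial.totalDegree_C, zero_add]
      refine (MvPolynomial.totalDegree_finsetProd _ _).trans (le_trans ?_ (mem_multiIndices.1 hj))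
      refine Finset.sum_le_sum fun i _ => (MvPolynomial.totalDegree_pow _ _).trans ?_
      refine (Nat.mul_le_mul_left (j i) (m := 1) ?_).trans_eq (mul_one _)
      refine (MvPolynomial.totalDegree_add _ _).trans ?_
      simp
    · funext v
      have he' : e v = χ (shift G v) * e (Quotient.out (Quotient.mk _ v : Orbits G V)) := by
        rw [← he, shift_vadd_out]
      have hp' : ∀ j, p j v = p j (Quotient.out (Quotient.mk _ v : Orbits G V)) := fun j => by
        conv_lhs => rw [← shift_vadd_out (G := G) v, hp]
      rw [hu, he']
      change _ = (χ (shift G v) : ℂ) * MvPolynomial.eval _ (∑ j ∈ multiIndices n N, _)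
      rw [mul_assoc, map_sum, Finset.mul_sum]
      congr 1
      refine Finset.sum_congr rfl fun j _ => ?_
      rw [map_mul, map_prod, MvPolynomial.eval_C, hp']
      have h1 : ∀ i, MvPolynomial.eval (fun i => (c (shift G v) i : ℂ)) ((MvPolynomial.X i +
          MvPolynomial.C (ξ (Quotient.out (Quotient.mk _ v : Orbits G V)) i : ℂ)) ^ j i) =
          (ξ v i : ℂ) ^ j i := by
        intro i
        rw [map_pow, map_add, MvPolynomial.eval_X, MvPolynomial.eval_C, hξ.eq_shift v i]
        push_cast
        ring
      rw [Finset.prod_congr rfl fun i _ => h1 i]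
      ring
  · rintro ⟨φ, hφ, rfl⟩
    let ψ : Orbits G V → MvPolynomial (Fin n) ℂ := fun q =>
      analyticOp (expFn fun i => -(ξ (Quotient.out q) i : ℂ)) (φ q)
    have hψ : ∀ q, (ψ q).totalDegree ≤ N := fun q => analyticOp_totalDegree_le _ (hφ q)
    refine ⟨autoExt (fun g => (χ g : ℂ)) fun _ : Orbits G V => 1,
      fun j v => (ψ (Quotient.mk _ v)).coeff (Finsupp.equivFunOnFinite.symm j), fun v => ?_,
      isAutomorphic_autoExt hfree χ _, fun j g v => ?_, fun v => ?_⟩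
    · rw [autoExt, mul_one]
      exact Circle.coe_ne_zero _
    · simp only [mk_vadd]
    · rw [autoExt, mul_one]
      change (χ (shift G v) : ℂ) * _ = _
      congr 1
      have h1 : MvPolynomial.eval (fun i => (c (shift G v) i : ℂ)) (φ (Quotient.mk _ v)) =
          MvPolynomial.eval (fun i => (ξ v i : ℂ)) (ψ (Quotient.mk _ v)) := by
        rw [eval_analyticOp_expFn]
        congr 2
        funext i
        rw [hξ.eq_shift v i]
        push_cast
        ring
      rw [h1, MvPolynomial.eval_eq']
      have h2 : ∀ α ∈ (ψ (Quotient.mk _ v)).support,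
          (⇑α : Fin n → ℕ) ∈ multiIndices n N := by
        intro α hα
        rw [mem_multiIndices, ← Finsupp.degree_eq_sum]
        exact (MvPolynomial.le_totalDegree hα).trans (hψ _)
      rw [← Finset.sum_subset (Finset.image_subset_iff.2 h2)]
      · rw [Finset.sum_image fun a _ b _ h => DFunLike.coe_injective h]
        refine Finset.sum_congr rfl fun α _ => ?_
        rw [mul_comm]
        have h3 : Finsupp.equivFunOnFinite.symm (⇑α : Fin n → ℕ) = α := Finsupp.ext fun _ => rfl
        simp only [h3]
      · intro j _ hj
        have : (ψ (Quotient.mk _ v)).coeff (Finsupp.equivFunOnFinite.symm j) = 0 := by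
          by_contra h
          exact hj (Finset.mem_image.2 ⟨_, MvPolynomial.mem_support_iff.2 h, rfl⟩)
        simp only [this, mul_zero]

lemma HasSymbol.floquetSol_eq {P : (V → ℂ) →ₗ[ℂ] (V → ℂ)}
    {D : Matrix (Orbits G V) (Orbits G V) (AddMonoidAlgebra ℂ G)} (hD : HasSymbol P D)
    (hfree : ∀ (g : G) (v : V), g +ᵥ v = v → g = 0) {c : G →+ (Fin n → ℤ)}
    (hc : Function.Surjective c) {ξ : V → Fin n → ℝ} (hξ : IsCoordinates c ξ)
    (χ : AddChar G Circle) (N : ℕ) :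
    floquetSol P ξ χ N = polyFn c χ '' (polySolSpace (bloch c D χ) N) := by
  ext u
  constructor
  · rintro ⟨hPu, hu⟩
    obtain ⟨φ, hφ, rfl⟩ := (isFloquet_iff hfree hξ χ N u).1 hu
    rw [hD.apply_polyFn hfree] at hPu
    exact ⟨φ, mem_polySolSpace.2 ⟨(map_eq_zero_iff _ (polyFn_injective hfree c hc χ)).1 hPu, hφ⟩, rfl⟩
  · rintro ⟨φ, hφ, rfl⟩
    obtain ⟨h1, h2⟩ := mem_polySolSpace.1 hφ
    exact ⟨by rw [hD.apply_polyFn hfree, h1, map_zero], (isFloquet_iff hfree hξ χ N _).2 ⟨φ, h2, rfl⟩⟩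

/-! ### Dimensions -/

omit [AddCommGroup G] [AddAction G V] [Fintype (Orbits G V)] in
lemma finrank_iSup_of_iSupIndep {ι E : Type*} [Fintype ι] [AddCommGroup E] [Module ℂ E]
    {p : ι → Submodule ℂ E} (hp : iSupIndep p) [∀ i, FiniteDimensional ℂ (p i)] :
    Module.finrank ℂ (⨆ i, p i : Submodule ℂ E) = ∑ i, Module.finrank ℂ (p i) := by
  have h1 := hp.dfinsupp_lsum_injective
  rw [Submodule.iSup_eq_range_dfinsupp_lsum, LinearMap.finrank_range_of_inj h1]
  exact Module.finrank_directSum (R := ℂ) (fun i => p i)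

instance finiteDimensional_polySolSpace {ι : Type*} [Fintype ι] (M : (Fin n → ℂ) → Matrix ι ι ℂ)
    (N : ℕ) : FiniteDimensional ℂ (polySolSpace M N) := by
  let F : polySolSpace M N →ₗ[ℂ] (ι → MvPolynomial.restrictTotalDegree (Fin n) ℂ N) :=
    LinearMap.pi fun i => LinearMap.codRestrict _
      (LinearMap.proj i ∘ₗ (polySolSpace M N).subtype) fun φ =>
        (MvPolynomial.mem_restrictTotalDegree _ _ _).2 ((mem_polySolSpace.1 φ.2).2 i)
  refine FiniteDimensional.of_injective F fun φ ψ h => Subtype.ext (funext fun i => ?_)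
  exact congrArg Subtype.val (congrFun h i)

lemma HasSymbol.finrank_polySol {P : (V → ℂ) →ₗ[ℂ] (V → ℂ)}
    {D : Matrix (Orbits G V) (Orbits G V) (AddMonoidAlgebra ℂ G)} (hD : HasSymbol P D)
    (hfree : ∀ (g : G) (v : V), g +ᵥ v = v → g = 0) (c : G →+ (Fin n → ℤ))
    (hc : Function.Surjective c) (hc' : Finite c.ker) (hfin : (fermi G P).Finite) (N : ℕ) :
    Module.finrank ℂ (polySol c P N) =
      ∑ χ ∈ hfin.toFinset, Module.finrank ℂ (polySolSpace (bloch c D χ) N) := by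
  have : Fintype (fermi G P) := hfin.fintype
  have hindep : iSupIndep fun χ : fermi G P => polySol c P N ⊓ genSpace V fun g => (χ.1 g : ℂ) :=
    (iSupIndep_genSpace (V := V).comp (injective_coe_char.comp Subtype.val_injective)
      : iSupIndep fun χ : fermi G P => genSpace V fun g => (χ.1 g : ℂ)).mono fun χ => inf_le_right
  have hfd : FiniteDimensional ℂ (polySol c P N) := hD.finiteDimensional_polySol hfree c hc' hfin N
  have hfd' : ∀ χ : fermi G P,
      FiniteDimensional ℂ (polySol c P N ⊓ genSpace V fun g => (χ.1 g : ℂ) : Submodule ℂ (V → ℂ)) :=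
    fun χ => Submodule.finiteDimensional_of_le inf_le_left
  have hsum : ∑ χ ∈ hfin.toFinset, Module.finrank ℂ (polySolSpace (bloch c D χ) N) =
      ∑ χ : fermi G P, Module.finrank ℂ (polySolSpace (bloch c D χ.1) N) :=
    Finset.sum_subtype _ (fun χ => hfin.mem_toFinset) _
  have heq := congrArg (fun S : Submodule ℂ (V → ℂ) => Module.finrank ℂ S)
    (hD.polySol_eq_iSup hfree c hc' hfin N)
  rw [heq, finrank_iSup_of_iSupIndep hindep, hsum]
  refine Finset.sum_congr rfl fun χ _ => ?_
  rw [hD.polySol_inf_genSpace hfree c hc hc' χ.1 N]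
  exact (LinearEquiv.finrank_eq (Submodule.equivMapOfInjective _
    (polyFn_injective hfree c hc χ.1) _)).symm

/-! ### Bounds for the spaces of polynomial solutions -/

omit [AddCommGroup G] [AddAction G V] [Fintype (Orbits G V)] in
lemma analyticOp_totalDegree_le_sub_one {f : (Fin n → ℂ) → ℂ} (hf : f 0 = 0)
    {p : MvPolynomial (Fin n) ℂ} {N : ℕ} (hp : p.totalDegree ≤ N) :
    (analyticOp f p).totalDegree ≤ N - 1 ∧ (N = 0 → analyticOp f p = 0) := by
  have h0 : taylorTerm f 0 = 0 := by
    refine MvPolynomial.funext fun k => ?_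
    rw [eval_taylorTerm, iteratedFDeriv_zero_apply, hf, mul_zero, map_zero]
  have h1 : analyticOp f p = ∑ l ∈ Finset.range N, symbolHom (taylorTerm f (l + 1)) p := by
    rw [analyticOp_apply_of_le _ hp, Finset.sum_range_succ', h0, map_zero, LinearMap.zero_apply,
      add_zero]
  rw [h1]
  refine ⟨MvPolynomial.totalDegree_finsetSum_le fun l _ =>
    ((symbolHom_totalDegree_le (taylorTerm_isHomogeneous _ _) hp).1).trans (by omega), ?_⟩
  rintro rfl
  simp

omit [AddCommGroup G] [AddAction G V] [Fintype (Orbits G V)] in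
lemma MatAnalytic.add {ι κ : Type*} {M N : (Fin n → ℂ) → Matrix κ ι ℂ}
    (hM : MatAnalytic M) (hN : MatAnalytic N) : MatAnalytic fun k => M k + N k :=
  fun i j => (hM i j).add (hN i j)

omit [AddCommGroup G] [AddAction G V] [Fintype (Orbits G V)] in
lemma matOp_add {ι κ : Type*} [Fintype ι] {M N : (Fin n → ℂ) → Matrix κ ι ℂ}
    (hM : MatAnalytic M) (hN : MatAnalytic N) (φ : ι → MvPolynomial (Fin n) ℂ) :
    matOp (fun k => M k + N k) φ = matOp M φ + matOp N φ := by
  funext i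
  rw [Pi.add_apply, matOp_apply, matOp_apply, matOp_apply, ← Finset.sum_add_distrib]
  refine Finset.sum_congr rfl fun j _ => ?_
  have h := analyticOp_sum (Finset.univ : Finset Bool)
    (f := fun b k => if b then M k i j else N k i j) fun b _ => by
      cases b
      · exact hN i j
      · exact hM i j
  have h' : (fun k => ∑ b : Bool, if b then M k i j else N k i j) =
      fun k => (M k + N k) i j := by
    funext k
    simp
  rw [h', Fintype.sum_bool] at h
  rw [h]
  rfl

omit [AddCommGroup G] [AddAction G V] [Fintype (Orbits G V)] in
-- Without a constant term `M(D)` lowers the degree, and a polynomial vector that it fixes descends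
-- to zero.
lemma eq_zero_of_matOp_eq {ι : Type*} [Fintype ι] {M : (Fin n → ℂ) → Matrix ι ι ℂ} (hM : M 0 = 0)
    {φ : ι → MvPolynomial (Fin n) ℂ} (hφ : matOp M φ = φ) : φ = 0 := by
  have hentry : ∀ i j, (fun k => M k i j) 0 = 0 := fun i j => by simp only [hM]; rfl
  have key : ∀ N : ℕ, (∀ i, (φ i).totalDegree ≤ N) → φ = 0 := by
    intro N
    induction N with
    | zero =>
      intro h
      rw [← hφ]
      funext i
      rw [matOp_apply]
      exact Finset.sum_eq_zero fun j _ => (analyticOp_totalDegree_le_sub_one (hentry i j) (h j)).2 rfl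
    | succ N ih =>
      intro h
      refine ih fun i => ?_
      rw [← hφ, matOp_apply]
      exact MvPolynomial.totalDegree_finsetSum_le fun j _ =>
        (analyticOp_totalDegree_le_sub_one (hentry i j) (h j)).1
  exact key (Finset.univ.sup fun i => (φ i).totalDegree) fun i =>
    Finset.le_sup (f := fun i => (φ i).totalDegree) (Finset.mem_univ i)

omit [AddCommGroup G] [AddAction G V] [Fintype (Orbits G V)] in
-- `A` paired with a projection onto its kernel is injective. `B` and `E` are the two blocks of a
-- left inverse of this pair.
lemma exists_left_inverse_modulo {ι : Type*} [Fintype ι] (A : Matrix ι ι ℂ) :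
    ∃ (B : Matrix ι ι ℂ) (E : Matrix ι (Fin (Module.finrank ℂ (LinearMap.ker A.mulVecLin))) ℂ)
      (κ : Matrix (Fin (Module.finrank ℂ (LinearMap.ker A.mulVecLin))) ι ℂ), B * A + E * κ = 1 := by
  let S := LinearMap.ker A.mulVecLin
  obtain ⟨π, hπ⟩ := LinearMap.exists_leftInverse_of_injective S.subtype S.ker_subtype
  have hinj : LinearMap.ker (A.mulVecLin.prod π) = ⊥ := by
    rw [LinearMap.ker_eq_bot']
    intro x hx
    have h1 : A.mulVecLin x = 0 := congrArg Prod.fst hx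
    have h2 : π x = 0 := congrArg Prod.snd hx
    have h3 := LinearMap.congr_fun hπ ⟨x, h1⟩
    have h4 : π x = ⟨x, h1⟩ := h3
    rw [h2] at h4
    exact (congrArg Subtype.val h4).symm
  obtain ⟨H, hH⟩ := LinearMap.exists_leftInverse_of_injective _ hinj
  let b := (Module.finBasis ℂ S).equivFun
  refine ⟨LinearMap.toMatrix' (H ∘ₗ LinearMap.inl ℂ _ _),
    LinearMap.toMatrix' (H ∘ₗ LinearMap.inr ℂ _ _ ∘ₗ b.symm.toLinearMap),
    LinearMap.toMatrix' (b.toLinearMap ∘ₗ π), ?_⟩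
  have hA : A = LinearMap.toMatrix' A.mulVecLin := (LinearMap.toMatrix'_toLin' A).symm
  conv_lhs => enter [1, 2]; rw [hA]
  rw [← LinearMap.toMatrix'_comp, ← LinearMap.toMatrix'_comp, ← map_add, ← LinearMap.toMatrix'_id]
  congr 1
  rw [← hH]
  refine LinearMap.ext fun x => ?_
  simp [← map_add]

omit [AddCommGroup G] [AddAction G V] [Fintype (Orbits G V)] in
-- A solution is determined by `κ φ`, a vector of `dim ker M(0)` polynomials: if it vanishes, then
-- `1 = B (M(0) - M) + B M + E κ` gives `φ = B (M(0) - M(D)) φ`, and that operator lowers degrees.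
lemma finrank_polySolSpace_le {ι : Type*} [Fintype ι] {M : (Fin n → ℂ) → Matrix ι ι ℂ}
    (hM : MatAnalytic M) (N : ℕ) : Module.finrank ℂ (polySolSpace M N) ≤
      Module.finrank ℂ (LinearMap.ker (M 0).mulVecLin) * polyDim n N := by
  obtain ⟨B, E, κ, hBE⟩ := exists_left_inverse_modulo (M 0)
  let F : polySolSpace M N →ₗ[ℂ] (Fin (Module.finrank ℂ (LinearMap.ker (M 0).mulVecLin)) →
      MvPolynomial.restrictTotalDegree (Fin n) ℂ N) :=
    LinearMap.pi fun i => LinearMap.codRestrict _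
      (LinearMap.proj i ∘ₗ (matOp fun _ => κ) ∘ₗ (polySolSpace M N).subtype) fun φ =>
        (MvPolynomial.mem_restrictTotalDegree _ _ _).2
          (matOp_totalDegree_le _ (mem_polySolSpace.1 φ.2).2 i)
  have hF : Function.Injective F := by
    rw [injective_iff_map_eq_zero]
    intro φ hφ
    have h1 : matOp (fun _ => κ) (φ : ι → MvPolynomial (Fin n) ℂ) = 0 := by
      funext i
      exact congrArg Subtype.val (congrFun hφ i)
    refine Subtype.ext (eq_zero_of_matOp_eq (M := fun k => B * (M 0 - M k)) (by simp) ?_)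
    have hB : MatAnalytic fun _ : Fin n → ℂ => B := matAnalytic_const B
    have hsub : MatAnalytic fun k => M 0 - M k := fun i j => analyticAt_const.sub (hM i j)
    have hid : (fun _ : Fin n → ℂ => (1 : Matrix ι ι ℂ)) =
        fun k => B * (M 0 - M k) + (B * M k + E * κ) := by
      funext k
      rw [← hBE]
      noncomm_ring
    have h2 := matOp_one (n := n) (φ : ι → MvPolynomial (Fin n) ℂ)
    rw [hid, matOp_add (hB.mul hsub) ((hB.mul hM).add
        ((matAnalytic_const E).mul (matAnalytic_const κ))),
      matOp_add (hB.mul hM) ((matAnalytic_const E).mul (matAnalytic_const κ)),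
      matOp_mul hB hM, matOp_mul (matAnalytic_const E) (matAnalytic_const κ), h1,
      (mem_polySolSpace.1 φ.2).1, map_zero, map_zero, add_zero, add_zero] at h2
    exact h2
  refine (LinearMap.finrank_le_finrank_of_injective hF).trans ?_
  rw [Module.finrank_pi_fintype]
  simp [polyDim]

omit [AddCommGroup G] [AddAction G V] [Fintype (Orbits G V)] in
lemma taylorTerm_zero (f : (Fin n → ℂ) → ℂ) : taylorTerm f 0 = MvPolynomial.C (f 0) := by
  refine MvPolynomial.funext fun k => ?_
  rw [eval_taylorTerm, iteratedFDeriv_zero_apply, MvPolynomial.eval_C]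
  simp

omit [AddCommGroup G] [AddAction G V] [Fintype (Orbits G V)] in
-- On constant vectors `M(D)` acts as `M(0)`.
lemma finrank_ker_le_finrank_polySolSpace {ι : Type*} [Fintype ι] (M : (Fin n → ℂ) → Matrix ι ι ℂ) :
    Module.finrank ℂ (LinearMap.ker (M 0).mulVecLin) ≤ Module.finrank ℂ (polySolSpace M 0) := by
  let F : LinearMap.ker (M 0).mulVecLin →ₗ[ℂ] polySolSpace M 0 := LinearMap.codRestrict _
    (((Algebra.linearMap ℂ (MvPolynomial (Fin n) ℂ)).compLeft ι) ∘ₗ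
      (LinearMap.ker (M 0).mulVecLin).subtype) fun f => by
    refine mem_polySolSpace.2 ⟨funext fun i => ?_, fun i =>
      (MvPolynomial.totalDegree_C (f.1 i)).le⟩
    have h1 : ∀ j, analyticOp (fun k => M k i j) (MvPolynomial.C (f.1 j)) =
        MvPolynomial.C (M 0 i j * f.1 j) := by
      intro j
      rw [analyticOp_apply_of_le _ (MvPolynomial.totalDegree_C (f.1 j)).le, zero_add,
        Finset.sum_range_one, taylorTerm_zero, symbolHom_C, LinearMap.smul_apply,
        Module.End.one_apply, MvPolynomial.smul_eq_C_mul, ← map_mul]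
    rw [matOp_apply]
    have h2 : ∑ j, M 0 i j * f.1 j = 0 := congrFun (LinearMap.mem_ker.1 f.2) i
    refine (Finset.sum_congr rfl fun j _ => h1 j).trans ?_
    rw [← map_sum, h2, map_zero]
    rfl
  refine LinearMap.finrank_le_finrank_of_injective (f := F) fun f g h => Subtype.ext (funext fun i => ?_)
  exact MvPolynomial.C_injective (Fin n) ℂ (congrFun (congrArg Subtype.val h) i)

lemma HasSymbol.finrank_polySol_le {P : (V → ℂ) →ₗ[ℂ] (V → ℂ)}
    {D : Matrix (Orbits G V) (Orbits G V) (AddMonoidAlgebra ℂ G)} (hD : HasSymbol P D)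
    (hfree : ∀ (g : G) (v : V), g +ᵥ v = v → g = 0) (c : G →+ (Fin n → ℤ))
    (hc : Function.Surjective c) (hc' : Finite c.ker) (hfin : (fermi G P).Finite) (N : ℕ) :
    Module.finrank ℂ (polySol c P N) ≤ Module.finrank ℂ (polySol c P 0) * polyDim n N := by
  rw [hD.finrank_polySol hfree c hc hc' hfin, hD.finrank_polySol hfree c hc hc' hfin,
    Finset.sum_mul]
  exact Finset.sum_le_sum fun χ _ => (finrank_polySolSpace_le (matAnalytic_bloch c D χ) N).trans
    (Nat.mul_le_mul_right _ (finrank_ker_le_finrank_polySolSpace _))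

end

end PeriodicGraph

/-! ### The Riesz projector and its analytic dependence on the quasimomentum -/

namespace PeriodicGraph

noncomputable section

open scoped Classical

variable {n : ℕ} {ι : Type*} [Fintype ι]

/-! ### The spectral projector of a matrix -/

/-- The matrix `B` has no eigenvalues on the circle `|ζ| = δ`. -/
def CircleRegular (B : Matrix ι ι ℂ) (δ : ℝ) : Prop :=
  ∀ ζ : ℂ, ‖ζ‖ = δ → (ζ • (1 : Matrix ι ι ℂ) - B).det ≠ 0

lemma mulVec_resolvent {B : Matrix ι ι ℂ} {ζ : ℂ} (h : (ζ • (1 : Matrix ι ι ℂ) - B).det ≠ 0)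
    {v w : ι → ℂ} (hvw : (ζ • (1 : Matrix ι ι ℂ) - B).mulVec w = v) :
    ((ζ • (1 : Matrix ι ι ℂ) - B)⁻¹).mulVec v = w := by
  rw [← hvw, Matrix.mulVec_mulVec, Matrix.nonsing_inv_mul _ (isUnit_iff_ne_zero.2 h),
    Matrix.one_mulVec]

lemma continuousOn_resolvent {B : Matrix ι ι ℂ} {δ : ℝ} (hB : CircleRegular B δ) (p q : ι) :
    ContinuousOn (fun ζ : ℂ => ((ζ • (1 : Matrix ι ι ℂ) - B)⁻¹ : Matrix ι ι ℂ) p q)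
      (Metric.sphere 0 δ) := by
  have h1 : Continuous fun ζ : ℂ => ζ • (1 : Matrix ι ι ℂ) - B :=
    (continuous_id.smul continuous_const).sub continuous_const
  have h2 : (fun ζ : ℂ => ((ζ • (1 : Matrix ι ι ℂ) - B)⁻¹ : Matrix ι ι ℂ) p q) = fun ζ : ℂ =>
      ((ζ • (1 : Matrix ι ι ℂ) - B).det)⁻¹ * (ζ • (1 : Matrix ι ι ℂ) - B).adjugate p q := by
    funext ζ
    rw [Matrix.inv_def, Matrix.smul_apply, Ring.inverse_eq_inv', smul_eq_mul]
  rw [h2]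
  refine ContinuousOn.mul (ContinuousOn.inv₀ h1.matrix_det.continuousOn fun ζ hζ =>
    hB ζ (mem_sphere_zero_iff_norm.1 hζ)) ?_
  exact (h1.matrix_adjugate.matrix_elem p q).continuousOn

lemma rieszProjector_mulVec {B : Matrix ι ι ℂ} {δ : ℝ} (hδ : 0 < δ) (hB : CircleRegular B δ)
    (v : ι → ℂ) (p : ι) : (rieszProjector B δ).mulVec v p = (2 * (Real.pi : ℂ) * Complex.I)⁻¹ *
      ∮ ζ in C(0, δ), ((ζ • (1 : Matrix ι ι ℂ) - B)⁻¹).mulVec v p := by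
  have h1 : ∀ q, CircleIntegrable (fun ζ : ℂ =>
      ((ζ • (1 : Matrix ι ι ℂ) - B)⁻¹ : Matrix ι ι ℂ) p q * v q) 0 δ := fun q =>
    ((continuousOn_resolvent hB p q).mul continuousOn_const).circleIntegrable hδ.le
  simp only [Matrix.mulVec, dotProduct, rieszProjector, Matrix.of_apply]
  rw [circleIntegral.integral_fun_sum fun q _ => h1 q, Finset.mul_sum]
  refine Finset.sum_congr rfl fun q _ => ?_
  have h2 := circleIntegral.integral_const_mul (v q)
    (fun ζ : ℂ => ((ζ • (1 : Matrix ι ι ℂ) - B)⁻¹ : Matrix ι ι ℂ) p q) 0 δ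
  simp only [mul_comm (v q)] at h2
  rw [h2, mul_assoc]

lemma circleIntegral_sub_inv_of_norm_lt {δ : ℝ} (hδ : 0 < δ) {μ : ℂ} (hμ : δ < ‖μ‖) :
    (∮ ζ in C(0, δ), (ζ - μ)⁻¹) = 0 := by
  refine DiffContOnCl.circleIntegral_eq_zero hδ.le ?_
  refine DifferentiableOn.diffContOnCl fun ζ hζ => ?_
  have hne : ζ - μ ≠ 0 := by
    intro h
    rw [sub_eq_zero] at h
    have := Metric.closure_ball_subset_closedBall hζ
    rw [mem_closedBall_zero_iff, h] at this
    linarith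
  exact ((differentiableAt_id.sub_const μ).inv hne).differentiableWithinAt

/-- On a generalized eigenvector the resolvent is the finite sum `∑ (ζ - μ)^(-j-1) (B - μ)^j v`.
Only the term `j = 0` can have a nonzero integral, and it has one exactly when `μ` is inside the
circle. -/
lemma rieszProjector_mulVec_of_mem {B : Matrix ι ι ℂ} {δ : ℝ} (hδ : 0 < δ) (hB : CircleRegular B δ)
    {μ : ℂ} {v : ι → ℂ} (hv : v ∈ Module.End.maxGenEigenspace (Matrix.toLin' B) μ) :
    (rieszProjector B δ).mulVec v = if ‖μ‖ < δ then v else 0 := by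
  obtain ⟨m, hm⟩ := (Module.End.mem_maxGenEigenspace _ _ _).1 hv
  set T := Matrix.toLin' B - μ • 1 with hT
  by_cases hμδ : ‖μ‖ = δ
  · -- there is no spectrum on the circle
    have hinj : ∀ w, T w = 0 → w = 0 := by
      intro w hw
      have h1 : (μ • (1 : Matrix ι ι ℂ) - B).mulVec w = 0 := by
        have : B.mulVec w - μ • w = 0 := hw
        rw [Matrix.sub_mulVec, Matrix.smul_mulVec, Matrix.one_mulVec, ← neg_sub, this, neg_zero]
      exact (Matrix.eq_zero_of_mulVec_eq_zero (hB μ hμδ) h1)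
    have hv0 : v = 0 := by
      clear hv
      induction m with
      | zero => exact hm
      | succ m ih =>
        rw [pow_succ', Module.End.mul_apply] at hm
        exact ih (hinj _ hm)
    rw [hv0, Matrix.mulVec_zero, ite_self]
  · funext p
    have hres : ∀ ζ ∈ Metric.sphere (0 : ℂ) δ, ((ζ • (1 : Matrix ι ι ℂ) - B)⁻¹).mulVec v p =
        ∑ j ∈ Finset.range m, (T ^ j) v p * (ζ - μ) ^ (-(j + 1 : ℤ)) := by
      intro ζ hζ
      have hζδ := mem_sphere_zero_iff_norm.1 hζ
      have hne : ζ - μ ≠ 0 := fun h => hμδ (by rw [← sub_eq_zero.1 h, hζδ])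
      have h1 : ((ζ • (1 : Matrix ι ι ℂ) - B)⁻¹).mulVec v =
          ∑ j ∈ Finset.range m, (ζ - μ) ^ (-(j + 1 : ℤ)) • (T ^ j) v := by
        refine mulVec_resolvent (hB ζ hζδ) ?_
        have h2 : ∀ w, (ζ • (1 : Matrix ι ι ℂ) - B).mulVec w = (ζ - μ) • w - T w := by
          intro w
          have : T w = B.mulVec w - μ • w := rfl
          rw [this, Matrix.sub_mulVec, Matrix.smul_mulVec, Matrix.one_mulVec, sub_smul]
          abel
        rw [h2, map_sum, Finset.smul_sum, ← Finset.sum_sub_distrib]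
        have h3 : ∀ j ∈ Finset.range m, (ζ - μ) • (ζ - μ) ^ (-(j + 1 : ℤ)) • (T ^ j) v -
            T ((ζ - μ) ^ (-(j + 1 : ℤ)) • (T ^ j) v) =
            (ζ - μ) ^ (-(j : ℤ)) • (T ^ j) v - (ζ - μ) ^ (-((j + 1 : ℕ) : ℤ)) • (T ^ (j + 1)) v := by
          intro j _
          rw [map_smul, smul_smul, pow_succ', Module.End.mul_apply]
          congr 2
          rw [← zpow_one_add₀ hne]
          congr 1
          ring
        rw [Finset.sum_congr rfl h3,
          Finset.sum_range_sub' (fun j : ℕ => (ζ - μ) ^ (-(j : ℤ)) • (T ^ j) v), hm]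
        simp
      rw [h1, Finset.sum_apply]
      exact Finset.sum_congr rfl fun j _ => by rw [Pi.smul_apply, smul_eq_mul, mul_comm]
    have hint : ∀ j : ℕ, CircleIntegrable (fun ζ => (T ^ j) v p * (ζ - μ) ^ (-(j + 1 : ℤ))) 0 δ := by
      intro j
      refine ContinuousOn.circleIntegrable hδ.le (continuousOn_const.mul ?_)
      refine ContinuousOn.zpow₀ (continuousOn_id.sub continuousOn_const) _ fun ζ hζ => Or.inl ?_
      intro h
      have h' : ζ = μ := sub_eq_zero.1 h
      exact hμδ (by rw [← h']; exact mem_sphere_zero_iff_norm.1 hζ)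
    have hval : ∀ j : ℕ, (2 * (Real.pi : ℂ) * Complex.I)⁻¹ *
        (∮ ζ in C(0, δ), (T ^ j) v p * (ζ - μ) ^ (-(j + 1 : ℤ))) =
        if j = 0 then (if ‖μ‖ < δ then v p else 0) else 0 := by
      intro j
      rw [circleIntegral.integral_const_mul]
      rcases Nat.eq_zero_or_pos j with rfl | hj
      · rw [if_pos rfl]
        simp only [Nat.cast_zero, zero_add, zpow_neg_one, pow_zero, Module.End.one_apply]
        split_ifs with h
        · rw [circleIntegral.integral_sub_inv_of_mem_ball (mem_ball_zero_iff.2 h)]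
          have := Complex.two_pi_I_ne_zero
          field_simp
        · rw [circleIntegral_sub_inv_of_norm_lt hδ (lt_of_le_of_ne (not_lt.1 h) (Ne.symm hμδ)),
            mul_zero, mul_zero]
      · rw [if_neg hj.ne', circleIntegral.integral_sub_zpow_of_ne (by omega), mul_zero, mul_zero]
    rw [rieszProjector_mulVec hδ hB, circleIntegral.integral_congr hδ.le hres,
      circleIntegral.integral_fun_sum fun j _ => hint j, Finset.mul_sum,
      Finset.sum_congr rfl fun j _ => hval j]
    rcases m with _ | m
    · have : v = 0 := hm
      simp [this]
    · rw [Finset.sum_range_succ', Finset.sum_eq_zero (fun j _ => if_neg (Nat.succ_ne_zero j)),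
        if_pos rfl, zero_add]
      split_ifs <;> rfl

/-- The generalized eigenspaces span, so the identities for the projector can be checked on them. -/
lemma matrix_ext_maxGenEigenspace (B : Matrix ι ι ℂ) {M N : Matrix ι ι ℂ}
    (h : ∀ (μ : ℂ), ∀ v ∈ Module.End.maxGenEigenspace (Matrix.toLin' B) μ, M.mulVec v = N.mulVec v) : M = N := by
  refine Matrix.toLin'.injective (LinearMap.ext fun v => ?_)
  have hv : v ∈ ⨆ μ : ℂ, Module.End.maxGenEigenspace (Matrix.toLin' B) μ := by
    rw [Module.End.iSup_maxGenEigenspace_eq_top]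
    trivial
  have hle : ⨆ μ : ℂ, Module.End.maxGenEigenspace (Matrix.toLin' B) μ ≤
      LinearMap.eqLocus (Matrix.toLin' M) (Matrix.toLin' N) := iSup_le fun μ w hw => h μ w hw
  exact hle hv

lemma rieszProjector_mul_self {B : Matrix ι ι ℂ} {δ : ℝ} (hδ : 0 < δ) (hB : CircleRegular B δ) :
    rieszProjector B δ * rieszProjector B δ = rieszProjector B δ := by
  refine matrix_ext_maxGenEigenspace B fun μ v hv => ?_
  rw [← Matrix.mulVec_mulVec, rieszProjector_mulVec_of_mem hδ hB hv]
  split_ifs with h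
  · rw [rieszProjector_mulVec_of_mem hδ hB hv, if_pos h]
  · rw [Matrix.mulVec_zero]

lemma rieszProjector_commute {B : Matrix ι ι ℂ} {δ : ℝ} (hδ : 0 < δ) (hB : CircleRegular B δ) :
    B * rieszProjector B δ = rieszProjector B δ * B := by
  refine matrix_ext_maxGenEigenspace B fun μ v hv => ?_
  have h1 : B.mulVec v ∈ Module.End.maxGenEigenspace (Matrix.toLin' B) μ :=
    Module.End.mapsTo_maxGenEigenspace_of_comm (Commute.refl (Matrix.toLin' B)) μ hv
  rw [← Matrix.mulVec_mulVec, ← Matrix.mulVec_mulVec, rieszProjector_mulVec_of_mem hδ hB hv,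
    rieszProjector_mulVec_of_mem hδ hB h1]
  split_ifs with h
  · rfl
  · rw [Matrix.mulVec_zero]

/-- The circle of radius `δ` separates the eigenvalue `0` from the other ones. -/
def Separates (B : Matrix ι ι ℂ) (δ : ℝ) : Prop :=
  ∀ μ : ℂ, Module.End.HasEigenvalue (Matrix.toLin' B) μ → μ ≠ 0 → δ < ‖μ‖

lemma Separates.circleRegular {B : Matrix ι ι ℂ} {δ : ℝ} (hδ : 0 < δ) (h : Separates B δ) :
    CircleRegular B δ := by
  intro ζ hζ hdet
  obtain ⟨v, hv0, hv⟩ := Matrix.exists_mulVec_eq_zero_iff.2 hdet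
  have hev : Module.End.HasEigenvalue (Matrix.toLin' B) ζ := by
    refine Module.End.hasEigenvalue_of_hasEigenvector (x := v)
      ⟨Module.End.mem_eigenspace_iff.2 ?_, hv0⟩
    rw [Matrix.sub_mulVec, Matrix.smul_mulVec, Matrix.one_mulVec, sub_eq_zero] at hv
    exact hv.symm
  have := h ζ hev (by rintro rfl; simp at hζ; linarith)
  linarith

/-- The other generalized eigenspaces belong to eigenvalues outside the circle and are annihilated
by the projector. -/
lemma Separates.rieszProjector_mulVec_mem {B : Matrix ι ι ℂ} {δ : ℝ} (hδ : 0 < δ)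
    (h : Separates B δ) (v : ι → ℂ) :
    (rieszProjector B δ).mulVec v ∈ Module.End.maxGenEigenspace (Matrix.toLin' B) 0 := by
  have hv : v ∈ ⨆ μ : ℂ, Module.End.maxGenEigenspace (Matrix.toLin' B) μ := by
    rw [Module.End.iSup_maxGenEigenspace_eq_top]
    trivial
  have hle : ⨆ μ : ℂ, Module.End.maxGenEigenspace (Matrix.toLin' B) μ ≤
      (Module.End.maxGenEigenspace (Matrix.toLin' B) 0).comap (Matrix.toLin' (rieszProjector B δ)) := by
    refine iSup_le fun μ w hw => ?_
    rw [Submodule.mem_comap, Matrix.toLin'_apply,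
      rieszProjector_mulVec_of_mem hδ (h.circleRegular hδ) hw]
    split_ifs with hμ
    · rcases eq_or_ne μ 0 with rfl | hμ0
      · exact hw
      · rcases eq_or_ne w 0 with rfl | hw0
        · exact Submodule.zero_mem _
        · exfalso
          have hne : Module.End.maxGenEigenspace (Matrix.toLin' B) μ ≠ ⊥ :=
            (Submodule.ne_bot_iff _).2 ⟨w, hw, hw0⟩
          have hev : Module.End.HasEigenvalue (Matrix.toLin' B) μ := by
            rw [Module.End.hasEigenvalue_iff]
            intro hbot
            refine hw0 ?_
            obtain ⟨m, hm⟩ := (Module.End.mem_maxGenEigenspace _ _ _).1 hw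
            have hinj : ∀ x, (Matrix.toLin' B - μ • 1) x = 0 → x = 0 := fun x hx => by
              have : x ∈ Module.End.eigenspace (Matrix.toLin' B) μ :=
                Module.End.mem_eigenspace_iff.2 (sub_eq_zero.1 hx)
              rwa [hbot, Submodule.mem_bot] at this
            clear hw hne
            induction m with
            | zero => exact hm
            | succ m ih =>
              rw [pow_succ', Module.End.mul_apply] at hm
              exact ih (hinj _ hm)
          exact absurd (h μ hev hμ0) (not_lt.2 hμ.le)
    · exact Submodule.zero_mem _
  exact hle hv

/-! ### Analytic dependence on parameters -/

lemma analyticAt_det {E 𝔸 κ : Type*} [NormedAddCommGroup E] [NormedSpace ℂ E] [NormedCommRing 𝔸]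
    [NormedAlgebra ℂ 𝔸] [Fintype κ] [DecidableEq κ] {M : E → Matrix κ κ 𝔸} {x : E}
    (hM : ∀ i j, AnalyticAt ℂ (fun k => M k i j) x) : AnalyticAt ℂ (fun k => (M k).det) x := by
  simp only [Matrix.det_apply']
  exact Finset.analyticAt_fun_sum _ fun σ _ => analyticAt_const.mul
    (Finset.analyticAt_fun_prod _ fun i _ => hM _ _)

lemma analyticAt_adjugate {E 𝔸 κ : Type*} [NormedAddCommGroup E] [NormedSpace ℂ E]
    [NormedCommRing 𝔸] [NormedAlgebra ℂ 𝔸] [Fintype κ] [DecidableEq κ] {M : E → Matrix κ κ 𝔸} {x : E}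
    (hM : ∀ i j, AnalyticAt ℂ (fun k => M k i j) x) (i j : κ) :
    AnalyticAt ℂ (fun k => (M k).adjugate i j) x := by
  simp only [Matrix.adjugate_apply]
  refine analyticAt_det fun a b => ?_
  by_cases h : a = j
  · subst h
    simp only [Matrix.updateRow_self]
    exact analyticAt_const
  · simp only [Matrix.updateRow_ne h]
    exact hM a b

lemma MatAnalytic.eventually_det_ne_zero [DecidableEq ι] {M : (Fin n → ℂ) → Matrix ι ι ℂ} (hM : MatAnalytic M)
    (h0 : (M 0).det ≠ 0) : ∀ᶠ k in nhds 0, (M k).det ≠ 0 :=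
  (analyticAt_det hM).continuousAt.eventually_ne h0

lemma MatAnalytic.inv [DecidableEq ι] {M : (Fin n → ℂ) → Matrix ι ι ℂ} (hM : MatAnalytic M)
    (h0 : (M 0).det ≠ 0) : MatAnalytic fun k => (M k)⁻¹ := by
  intro i j
  have h1 : (fun k => (M k)⁻¹ i j) = fun k => ((M k).det)⁻¹ * (M k).adjugate i j := by
    funext k
    rw [Matrix.inv_def, Matrix.smul_apply, Ring.inverse_eq_inv', smul_eq_mul]
  rw [h1]
  exact ((analyticAt_det hM).inv h0).mul (analyticAt_adjugate hM i j)

lemma continuous_circleFunctional_integrand {δ : ℝ} (hδ : 0 ≤ δ)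
    (f : C(Metric.sphere (0 : ℂ) δ, ℂ)) : Continuous fun θ : ℝ =>
      deriv (circleMap 0 δ) θ * f ⟨circleMap 0 δ θ, circleMap_mem_sphere 0 hδ θ⟩ := by
  simp only [deriv_circleMap]
  exact ((continuous_circleMap 0 δ).mul continuous_const).mul
    (f.continuous.comp ((continuous_circleMap 0 δ).subtype_mk _))

/-- The integral over a circle as a continuous linear functional. -/
def circleFunctional (δ : ℝ) (hδ : 0 ≤ δ) : C(Metric.sphere (0 : ℂ) δ, ℂ) →L[ℂ] ℂ :=
  LinearMap.mkContinuous
    { toFun := fun f => ∫ θ in (0 : ℝ)..2 * Real.pi,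
        deriv (circleMap 0 δ) θ * f ⟨circleMap 0 δ θ, circleMap_mem_sphere 0 hδ θ⟩
      map_add' := fun f g => by
        rw [← intervalIntegral.integral_add
          ((continuous_circleFunctional_integrand hδ f).intervalIntegrable _ _)
          ((continuous_circleFunctional_integrand hδ g).intervalIntegrable _ _)]
        simp only [ContinuousMap.add_apply, mul_add]
      map_smul' := fun a f => by
        rw [RingHom.id_apply, smul_eq_mul, ← intervalIntegral.integral_const_mul]
        simp only [ContinuousMap.smul_apply, smul_eq_mul, mul_left_comm] }
    (δ * |2 * Real.pi - 0|) fun f => by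
      rw [mul_right_comm]
      refine intervalIntegral.norm_integral_le_of_norm_le_const fun θ _ => ?_
      rw [norm_mul, deriv_circleMap, norm_mul, norm_circleMap_zero, Complex.norm_I, mul_one,
        abs_of_nonneg hδ]
      exact mul_le_mul_of_nonneg_left (f.norm_coe_le_norm _) hδ

lemma circleFunctional_eq {δ : ℝ} (hδ : 0 ≤ δ) (f : C(Metric.sphere (0 : ℂ) δ, ℂ)) (g : ℂ → ℂ)
    (h : ∀ ζ : Metric.sphere (0 : ℂ) δ, g ζ = f ζ) :
    circleFunctional δ hδ f = ∮ ζ in C(0, δ), g ζ := by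
  rw [circleIntegral]
  refine intervalIntegral.integral_congr fun θ _ => ?_
  simp only [smul_eq_mul]
  rw [← h]

/-- The matrices `ζ - A(k)`, for all `ζ` on the circle at once, form a single matrix over the Banach
algebra of continuous functions on the circle. Determinant, adjugate and inversion are analytic
there, integration is a continuous functional, and units are open, which also preserves regularity
for small `k`. -/
lemma matAnalytic_rieszProjector {A : (Fin n → ℂ) → Matrix ι ι ℂ} (hA : MatAnalytic A) {δ : ℝ}
    (hδ : 0 < δ) (h0 : CircleRegular (A 0) δ) :
    (MatAnalytic fun k => rieszProjector (A k) δ) ∧ ∀ᶠ k in nhds 0, CircleRegular (A k) δ := by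
  let X := C(Metric.sphere (0 : ℂ) δ, ℂ)
  let z : X := ⟨Subtype.val, continuous_subtype_val⟩
  let M : (Fin n → ℂ) → Matrix ι ι X := fun k =>
    Matrix.of fun p q => (if p = q then z else 0) - algebraMapCLM ℂ X (A k p q)
  have hM : ∀ p q, AnalyticAt ℂ (fun k => M k p q) 0 := fun p q =>
    analyticAt_const.sub (((algebraMapCLM ℂ X).analyticAt _).comp (hA p q))
  let ev : Metric.sphere (0 : ℂ) δ → X →+* ℂ := fun ζ => (ContinuousMap.evalAlgHom ℂ ℂ ζ).toRingHom
  have hev : ∀ (k) (ζ : Metric.sphere (0 : ℂ) δ),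
      (ev ζ).mapMatrix (M k) = (ζ : ℂ) • (1 : Matrix ι ι ℂ) - A k := by
    intro k ζ
    ext p q
    rw [RingHom.mapMatrix_apply, Matrix.map_apply, Matrix.sub_apply, Matrix.smul_apply,
      Matrix.one_apply]
    have hval : M k p q ζ = (if p = q then z else 0 : X) ζ - A k p q := rfl
    refine hval.trans ?_
    by_cases hpq : p = q
    · rw [if_pos hpq, if_pos hpq, smul_eq_mul, mul_one]
      rfl
    · rw [if_neg hpq, if_neg hpq, smul_zero]
      rfl
  have hdet : ∀ (k) (ζ : Metric.sphere (0 : ℂ) δ),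
      (M k).det ζ = ((ζ : ℂ) • (1 : Matrix ι ι ℂ) - A k).det := fun k ζ => by
    rw [← hev, ← RingHom.map_det]
    rfl
  have hadj : ∀ (k) (ζ : Metric.sphere (0 : ℂ) δ) (p q),
      (M k).adjugate p q ζ = ((ζ : ℂ) • (1 : Matrix ι ι ℂ) - A k).adjugate p q := fun k ζ p q => by
    rw [← hev, ← RingHom.map_adjugate]
    rfl
  have hunit0 : IsUnit (M 0).det := by
    rw [ContinuousMap.isUnit_iff_forall_ne_zero]
    intro ζ
    rw [hdet]
    exact h0 ζ (mem_sphere_zero_iff_norm.1 ζ.2)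
  have hanal : AnalyticAt ℂ (fun k => (M k).det) 0 := analyticAt_det hM
  have hunit : ∀ᶠ k in nhds 0, IsUnit (M k).det :=
    hanal.continuousAt.eventually (Units.isOpen.mem_nhds hunit0)
  refine ⟨fun p q => ?_, hunit.mono fun k hk ζ hζ => ?_⟩
  · have h1 : AnalyticAt ℂ (fun k => Ring.inverse (M k).det) 0 := by
      have h2 : AnalyticAt ℂ (Ring.inverse : X → X) (M 0).det := by
        have := analyticAt_inverse (𝕜 := ℂ) hunit0.unit
        rwa [IsUnit.unit_spec] at this
      exact h2.comp (f := fun k => (M k).det) hanal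
    have h3 : AnalyticAt ℂ (fun k => (2 * (Real.pi : ℂ) * Complex.I)⁻¹ *
        circleFunctional δ hδ.le (Ring.inverse (M k).det * (M k).adjugate p q)) 0 :=
      analyticAt_const.mul (((circleFunctional δ hδ.le).analyticAt _).comp
        (h1.mul (analyticAt_adjugate hM p q)))
    refine h3.congr (hunit.mono fun k hk => ?_)
    simp only [rieszProjector, Matrix.of_apply]
    congr 1
    refine circleFunctional_eq hδ.le _ _ fun ζ => ?_
    rw [Matrix.inv_def, Matrix.smul_apply, Ring.inverse_eq_inv', smul_eq_mul,
      ContinuousMap.mul_apply, hadj]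
    congr 1
    refine (eq_inv_of_mul_eq_one_right ?_).symm
    rw [← hdet, ← ContinuousMap.mul_apply, Ring.mul_inverse_cancel _ hk, ContinuousMap.one_apply]
  · have := (ContinuousMap.isUnit_iff_forall_ne_zero _).1 hk ⟨ζ, mem_sphere_zero_iff_norm.2 hζ⟩
    rwa [hdet] at this

end

end PeriodicGraph

/-! ### Reduction of the Bloch system to the spectral subspace -/

namespace PeriodicGraph

noncomputable section

open scoped Classical

variable {n : ℕ} {ι : Type*} [Fintype ι]

/-! ### Reduction to the spectral subspace -/

lemma polySolSpace_congr {M N : (Fin n → ℂ) → Matrix ι ι ℂ} (h : M =ᶠ[nhds 0] N) :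
    polySolSpace M = polySolSpace N := by
  funext K
  rw [polySolSpace, polySolSpace, matOp_congr h]

/-- The right-hand side `Y` is idempotent with `Q Y = Y Q = Y`, so `Q - Y` is idempotent too. It
vanishes as soon as `1 - (Q - Y)` is invertible. -/
lemma eq_compress_of_idempotent {r : ℕ} {Q : Matrix ι ι ℂ} {F : Matrix ι (Fin r) ℂ}
    {H : Matrix (Fin r) ι ℂ} (h1 : Q * Q = Q) (h2 : (H * Q * F).det ≠ 0)
    (h3 : (1 - (Q - Q * F * ((H * Q * F)⁻¹ * (H * Q)))).det ≠ 0) :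
    Q = Q * F * ((H * Q * F)⁻¹ * (H * Q)) := by
  have hSS : (H * Q * F)⁻¹ * (H * Q * F) = 1 := Matrix.nonsing_inv_mul _ (isUnit_iff_ne_zero.2 h2)
  generalize hW : (H * Q * F)⁻¹ = W at *
  generalize hY : Q * F * (W * (H * Q)) = Y at *
  have hQY : Q * Y = Y := by
    rw [← hY]
    simp only [← Matrix.mul_assoc, h1]
  have hYQ : Y * Q = Y := by
    rw [← hY]
    simp only [Matrix.mul_assoc, h1]
  have hYY : Y * Y = Y := by
    have : Y * Y = Q * F * (W * (H * (Q * Q) * F) * (W * (H * Q))) := by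
      rw [← hY]
      simp only [Matrix.mul_assoc]
    rw [this, h1, hSS, Matrix.one_mul, hY]
  have hzero : (1 - (Q - Y)) * (Q - Y) = 0 := by
    rw [sub_mul, one_mul, mul_sub, sub_mul, sub_mul, h1, hQY, hYQ, hYY]
    abel
  have h5 : (1 - (Q - Y))⁻¹ * ((1 - (Q - Y)) * (Q - Y)) = (1 - (Q - Y))⁻¹ * 0 := by rw [hzero]
  rw [← mul_assoc, Matrix.nonsing_inv_mul _ (isUnit_iff_ne_zero.2 h3), one_mul, mul_zero] at h5
  exact sub_eq_zero.1 h5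

/-- `L (1 - Q) + Q` is `L` on the range of `1 - Q` and the identity on the range of `Q`. Its inverse
thus inverts `L` off the range of `Q`. -/
lemma one_eq_of_idempotent {L Q : Matrix ι ι ℂ} (h1 : Q * Q = Q) (h2 : L * Q = Q * L)
    (h3 : (L * (1 - Q) + Q).det ≠ 0) :
    (1 : Matrix ι ι ℂ) = Q + (L * (1 - Q) + Q)⁻¹ * (1 - Q) * L := by
  have h4 : (1 - Q) * L = (L * (1 - Q) + Q) * (1 - Q) := by
    have h5 : (1 - Q) * (1 - Q) = 1 - Q := by
      rw [sub_mul, one_mul, mul_sub, mul_one, h1, sub_self, sub_zero]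
    rw [add_mul, mul_assoc, h5, mul_sub, mul_sub, mul_one, mul_one, h1, sub_self, add_zero, h2,
      sub_mul, one_mul]
  rw [mul_assoc, h4, ← mul_assoc, Matrix.nonsing_inv_mul _ (isUnit_iff_ne_zero.2 h3), one_mul]
  abel

/-- The relations become operator identities: `T(D)` and `U(D)` exchange the solution spaces and are
inverse there, since the term with `W L` vanishes on solutions. None of these operators raises
degrees. -/
lemma bijOn_polySolSpace {κ : Type*} [Fintype κ] [DecidableEq κ] {L W : (Fin n → ℂ) → Matrix ι ι ℂ}
    {lam : (Fin n → ℂ) → Matrix κ κ ℂ} {T B : (Fin n → ℂ) → Matrix κ ι ℂ}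
    {U C : (Fin n → ℂ) → Matrix ι κ ℂ} (hL : MatAnalytic L) (hW : MatAnalytic W)
    (hlam : MatAnalytic lam) (hT : MatAnalytic T) (hB : MatAnalytic B) (hU : MatAnalytic U)
    (hC : MatAnalytic C) (h1 : ∀ᶠ k in nhds 0, lam k * T k = B k * L k)
    (h2 : ∀ᶠ k in nhds 0, L k * U k = C k * lam k) (h3 : ∀ᶠ k in nhds 0, T k * U k = 1)
    (h4 : ∀ᶠ k in nhds 0, U k * T k + W k * L k = 1) (N : ℕ) :
    Set.BijOn (matOp T) (polySolSpace L N) (polySolSpace lam N) := by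
  have e1 : ∀ φ, matOp lam (matOp T φ) = matOp B (matOp L φ) := fun φ => by
    rw [← matOp_mul hlam hT, ← matOp_mul hB hL, matOp_congr h1]
  have e2 : ∀ ψ, matOp L (matOp U ψ) = matOp C (matOp lam ψ) := fun φ => by
    rw [← matOp_mul hL hU, ← matOp_mul hC hlam, matOp_congr h2]
  have e3 : ∀ ψ, matOp T (matOp U ψ) = ψ := fun ψ => by
    rw [← matOp_mul hT hU, matOp_congr h3, matOp_one]
  have e4 : ∀ φ, matOp U (matOp T φ) + matOp W (matOp L φ) = φ := fun φ => by
    rw [← matOp_mul hU hT, ← matOp_mul hW hL, ← matOp_add (hU.mul hT) (hW.mul hL), matOp_congr h4,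
      matOp_one]
  refine Set.InvOn.bijOn (f' := matOp U) ⟨fun φ hφ => ?_, fun ψ _ => e3 ψ⟩ (fun φ hφ => ?_)
    fun ψ hψ => ?_
  · have h := e4 φ
    rwa [(mem_polySolSpace.1 hφ).1, map_zero, add_zero] at h
  · obtain ⟨h1, h2⟩ := mem_polySolSpace.1 hφ
    exact mem_polySolSpace.2 ⟨by rw [e1, h1, map_zero], matOp_totalDegree_le _ h2⟩
  · obtain ⟨h1, h2⟩ := mem_polySolSpace.1 hψ
    exact mem_polySolSpace.2 ⟨by rw [e2, h1, map_zero], matOp_totalDegree_le _ h2⟩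

omit [Fintype ι] in
lemma MatAnalytic.sub {κ : Type*} {M N : (Fin n → ℂ) → Matrix κ ι ℂ}
    (hM : MatAnalytic M) (hN : MatAnalytic N) : MatAnalytic fun k => M k - N k :=
  fun i j => (hM i j).sub (hN i j)

/-- The columns of `Q(k) F` are a moving frame of the range of `Q(k)`, with coordinates `(H Q F)⁻¹ H
Q`. The inverse corrects for `F` and `H` being adapted only to `Q(0)`. -/
lemma exists_bijOn_polySolSpace {r : ℕ} {L Q : (Fin n → ℂ) → Matrix ι ι ℂ} (hL : MatAnalytic L)
    (hQ : MatAnalytic Q) {F : Matrix ι (Fin r) ℂ} {H : Matrix (Fin r) ι ℂ}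
    (hQQ : ∀ᶠ k in nhds 0, Q k * Q k = Q k) (hLQ : ∀ᶠ k in nhds 0, L k * Q k = Q k * L k)
    (hHF : H * F = 1) (hHQ : H * Q 0 = H) (hQFH : Q 0 * F * H = Q 0)
    (hZ : (L 0 * (1 - Q 0) + Q 0).det ≠ 0) :
    ∃ T : (Fin n → ℂ) → Matrix (Fin r) ι ℂ, ∀ N, Set.BijOn (matOp T) (polySolSpace L N)
      (polySolSpace (fun k => H * L k * Q k * F) N) := by
  have cF : MatAnalytic fun _ : Fin n → ℂ => F := matAnalytic_const F
  have cH : MatAnalytic fun _ : Fin n → ℂ => H := matAnalytic_const H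
  have c1 : MatAnalytic fun _ : Fin n → ℂ => (1 : Matrix ι ι ℂ) := matAnalytic_const 1
  have hS : MatAnalytic fun k => H * Q k * F := (cH.mul hQ).mul cF
  have hS0 : (H * Q 0 * F).det ≠ 0 := by
    rw [hHQ, hHF, Matrix.det_one]
    exact one_ne_zero
  have hSi : MatAnalytic fun k => (H * Q k * F)⁻¹ := hS.inv hS0
  have hZa : MatAnalytic fun k => L k * (1 - Q k) + Q k := (hL.mul (c1.sub hQ)).add hQ
  have hZi : MatAnalytic fun k => (L k * (1 - Q k) + Q k)⁻¹ := hZa.inv hZ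
  have eS := hS.eventually_det_ne_zero hS0
  have eZ := hZa.eventually_det_ne_zero hZ
  have hU : MatAnalytic fun k => Q k * F := hQ.mul cF
  have hT : MatAnalytic fun k => (H * Q k * F)⁻¹ * (H * Q k) := hSi.mul (cH.mul hQ)
  have eQ : ∀ᶠ k in nhds 0, Q k = Q k * F * ((H * Q k * F)⁻¹ * (H * Q k)) := by
    have hD : MatAnalytic fun k => 1 - (Q k - Q k * F * ((H * Q k * F)⁻¹ * (H * Q k))) :=
      c1.sub (hQ.sub (hU.mul hT))
    have hD0 : (1 - (Q 0 - Q 0 * F * ((H * Q 0 * F)⁻¹ * (H * Q 0)))).det ≠ 0 := by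
      rw [hHQ, hHF, inv_one, Matrix.one_mul, hQFH, sub_self, sub_zero, Matrix.det_one]
      exact one_ne_zero
    filter_upwards [hQQ, eS, hD.eventually_det_ne_zero hD0] with k h1 h2 h3
    exact eq_compress_of_idempotent h1 h2 h3
  refine ⟨fun k => (H * Q k * F)⁻¹ * (H * Q k), bijOn_polySolSpace (B := fun k => H * Q k)
    (U := fun k => Q k * F) (C := fun k => Q k * F * (H * Q k * F)⁻¹)
    (W := fun k => (L k * (1 - Q k) + Q k)⁻¹ * (1 - Q k)) hL (hZi.mul (c1.sub hQ))
    (((cH.mul hL).mul hQ).mul cF) hT (cH.mul hQ) hU (hU.mul hSi) ?_ ?_ ?_ ?_⟩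
  · filter_upwards [hLQ, eQ] with k h1 h2
    rw [Matrix.mul_assoc (H * L k), Matrix.mul_assoc (H * L k), ← h2, Matrix.mul_assoc, h1,
      Matrix.mul_assoc]
  · filter_upwards [hLQ, eQ, hQQ] with k h1 h2 h3
    have h4 : L k * Q k = Q k * (L k * Q k) := by rw [h1, ← mul_assoc, h3]
    generalize (H * Q k * F)⁻¹ = W at *
    have h5 : Q k * F * W * (H * L k * Q k * F) = Q k * F * W * (H * (L k * Q k) * F) := by
      simp only [Matrix.mul_assoc]
    rw [h5, h4]
    have h6 : Q k * F * W * (H * (Q k * (L k * Q k)) * F) =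
        Q k * F * (W * (H * Q k)) * (L k * Q k) * F := by
      simp only [Matrix.mul_assoc]
    rw [h6, ← h2, ← h4, Matrix.mul_assoc]
  · filter_upwards [hQQ, eS] with k h1 h2
    have h3 : (H * Q k * F)⁻¹ * (H * Q k) * (Q k * F) =
        (H * Q k * F)⁻¹ * (H * (Q k * Q k) * F) := by
      simp only [Matrix.mul_assoc]
    rw [h3, h1]
    exact Matrix.nonsing_inv_mul _ (isUnit_iff_ne_zero.2 h2)
  · filter_upwards [hQQ, hLQ, eZ, eQ] with k h1 h2 h3 h4
    rw [← h4]
    exact (one_eq_of_idempotent h1 h2 h3).symm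

/-- The matrix `⟨e_j, A(k) Π(k) e_i⟩` describing `A(k)` on the spectral subspace. -/
def compression {r : ℕ} (A : (Fin n → ℂ) → Matrix ι ι ℂ) (δ : ℝ) (e : Fin r → ι → ℂ)
    (k : Fin n → ℂ) : Matrix (Fin r) (Fin r) ℂ :=
  Matrix.of fun i j => star (e j) ⬝ᵥ ((A k * rieszProjector (A k) δ).mulVec (e i))

/-- The index order in `⟨e_j, A Π e_i⟩` makes this matrix the transpose of the usual compression,
namely `Eᵀ Aᵀ Πᵀ Ē`. The reduction is therefore applied to `Aᵀ` with projector `Πᵀ`. -/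
lemma exists_bijOn_compression {r : ℕ} {A : (Fin n → ℂ) → Matrix ι ι ℂ} (hA : MatAnalytic A)
    {δ : ℝ} (hδ : 0 < δ) (hsep : Separates (A 0) δ) {e : Fin r → ι → ℂ}
    (horth : ∀ i j, star (e i) ⬝ᵥ e j = if i = j then 1 else 0)
    (hspan : Submodule.span ℂ (Set.range e) = Module.End.maxGenEigenspace (Matrix.toLin' (A 0)) 0) :
    MatAnalytic (compression A δ e) ∧
    ∃ T : (Fin n → ℂ) → Matrix (Fin r) ι ℂ, ∀ N,
      Set.BijOn (matOp T) (polySolSpace (fun k => (A k).transpose) N)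
        (polySolSpace (compression A δ e) N) := by
  have hreg0 := hsep.circleRegular hδ
  obtain ⟨hR, hreg⟩ := matAnalytic_rieszProjector hA hδ hreg0
  let E : Matrix ι (Fin r) ℂ := Matrix.of fun q i => e i q
  let R₀ := rieszProjector (A 0) δ
  have hmem : ∀ i, e i ∈ Module.End.maxGenEigenspace (Matrix.toLin' (A 0)) 0 := fun i => by
    rw [← hspan]
    exact Submodule.subset_span ⟨i, rfl⟩
  have hEE : E.conjTranspose * E = 1 := by
    ext i j
    rw [Matrix.one_apply]
    exact horth i j
  have hRE : R₀ * E = E := by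
    ext q i
    have := rieszProjector_mulVec_of_mem hδ hreg0 (hmem i)
    rw [norm_zero, if_pos hδ] at this
    exact congrFun this q
  have hEER : E * (E.conjTranspose * R₀) = R₀ := by
    refine Matrix.toLin'.injective (LinearMap.ext fun v => ?_)
    rw [Matrix.toLin'_apply, Matrix.toLin'_apply, ← Matrix.mul_assoc, ← Matrix.mulVec_mulVec]
    have h1 := hsep.rieszProjector_mulVec_mem hδ v
    rw [← hspan] at h1
    have h2 : Submodule.span ℂ (Set.range e) ≤
        LinearMap.eqLocus (Matrix.toLin' (E * E.conjTranspose)) LinearMap.id := by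
      rw [Submodule.span_le]
      rintro _ ⟨i, rfl⟩
      have h3 : E * E.conjTranspose * E = E := by rw [Matrix.mul_assoc, hEE, Matrix.mul_one]
      funext q
      exact congrFun (congrFun h3 q) i
    exact h2 h1
  -- For a null vector `v` of `(1 - Π) A + Π`, applying `Π` gives `Π v = 0`, whence `A v = 0`. But
  -- `Π` is the identity on the kernel of `A`, so `v = 0`.
  have hZ : ((A 0).transpose * (1 - R₀.transpose) + R₀.transpose).det ≠ 0 := by
    have h1 : ((A 0).transpose * (1 - R₀.transpose) + R₀.transpose) =
        ((1 - R₀) * A 0 + R₀).transpose := by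
      rw [Matrix.transpose_add, Matrix.transpose_mul, Matrix.transpose_sub, Matrix.transpose_one]
    rw [h1, Matrix.det_transpose]
    intro hdet
    obtain ⟨v, hv0, hv⟩ := Matrix.exists_mulVec_eq_zero_iff.2 hdet
    have hRR : R₀ * R₀ = R₀ := rieszProjector_mul_self hδ hreg0
    have hAR : A 0 * R₀ = R₀ * A 0 := rieszProjector_commute hδ hreg0
    have h2 : R₀.mulVec v = 0 := by
      have h3 := congrArg R₀.mulVec hv
      rw [Matrix.mulVec_zero, Matrix.mulVec_mulVec, mul_add, ← mul_assoc, mul_sub, mul_one, hRR,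
        sub_self, zero_mul, zero_add] at h3
      exact h3
    have h4 : (A 0).mulVec v = 0 := by
      rw [sub_mul, one_mul, ← hAR, Matrix.add_mulVec, Matrix.sub_mulVec, ← Matrix.mulVec_mulVec, h2,
        Matrix.mulVec_zero, sub_zero, add_zero] at hv
      exact hv
    have h5 : v ∈ Module.End.maxGenEigenspace (Matrix.toLin' (A 0)) 0 := by
      refine (Module.End.mem_maxGenEigenspace _ _ _).2 ⟨1, ?_⟩
      rw [pow_one, zero_smul, sub_zero]
      exact h4
    have h6 := rieszProjector_mulVec_of_mem hδ hreg0 h5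
    rw [norm_zero, if_pos hδ] at h6
    exact hv0 (h6.symm.trans h2)
  have heq : compression A δ e =ᶠ[nhds 0] fun k => E.transpose * (A k).transpose *
      (rieszProjector (A k) δ).transpose * E.conjTranspose.transpose := by
    filter_upwards [hreg] with k hk
    rw [← Matrix.transpose_mul, ← Matrix.transpose_mul, ← Matrix.transpose_mul]
    ext i j
    rw [Matrix.transpose_apply, ← Matrix.mul_assoc (rieszProjector (A k) δ),
      ← rieszProjector_commute hδ hk]
    rfl
  have hAt : MatAnalytic fun k => (A k).transpose := hA.transpose
  have hRt : MatAnalytic fun k => (rieszProjector (A k) δ).transpose := hR.transpose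
  refine ⟨fun i j => ?_, ?_⟩
  · have h1 := ((((matAnalytic_const (n := n) E.transpose).mul hAt).mul hRt).mul
      (matAnalytic_const E.conjTranspose.transpose)) i j
    exact h1.congr (heq.symm.mono fun k hk => congrFun (congrFun hk i) j)
  · rw [polySolSpace_congr heq]
    refine exists_bijOn_polySolSpace hAt hRt ?_ ?_ ?_ ?_ ?_ hZ
    · filter_upwards [hreg] with k hk
      rw [← Matrix.transpose_mul, rieszProjector_mul_self hδ hk]
    · filter_upwards [hreg] with k hk
      rw [← Matrix.transpose_mul, ← Matrix.transpose_mul, rieszProjector_commute hδ hk]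
    · rw [← Matrix.transpose_mul, hEE, Matrix.transpose_one]
    · rw [← Matrix.transpose_mul, hRE]
    · rw [← Matrix.transpose_mul, ← Matrix.transpose_mul, hEER]

end

end PeriodicGraph

/-! ### Counting monomials, the Fischer pairing and surjectivity -/

namespace PeriodicGraph

noncomputable section

open scoped Classical

variable {n : ℕ}

/-! ### The dimension of the space of polynomials -/

lemma polyDim_eq_choose (n N : ℕ) : polyDim n N = (n + N).choose N := by
  have h1 : polyDim n N = Nat.card {α : Fin n →₀ ℕ | (α.sum fun _ e => e) ≤ N} :=
    Module.finrank_eq_nat_card_basis (MvPolynomial.basisRestrictSupport ℂ _)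
  have h2 : {α : Fin n →₀ ℕ | (α.sum fun _ e => e) ≤ N} =
      ((Finset.range (N + 1)).biUnion fun m => Finset.finsuppAntidiag Finset.univ m :
        Finset (Fin n →₀ ℕ)) := by
    ext α
    simp [Finset.mem_finsuppAntidiag, Finsupp.sum_fintype]
  rw [h1, h2, Nat.card_eq_card_toFinset, Finset.toFinset_coe, Finset.card_biUnion]
  · simp only [Finset.card_finsuppAntidiag_nat_eq_multichoose, Finset.card_univ, Fintype.card_fin]
    rw [Nat.sum_range_multichoose, add_comm, Nat.choose_symm_add]
  · intro a _ b _ hab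
    refine Finset.disjoint_left.2 fun α ha hb => hab ?_
    rw [Finset.mem_finsuppAntidiag] at ha hb
    exact ha.1.symm.trans hb.1

/-! ### Surjectivity of homogeneous differential operators -/

/-- The bilinear pairing `⟨p, q⟩ = (p(D) q)(0)`. -/
def fischer (p q : MvPolynomial (Fin n) ℂ) : ℂ := (symbolHom p q).coeff 0

lemma fischer_sum_left {κ : Type*} (s : Finset κ) (p : κ → MvPolynomial (Fin n) ℂ)
    (q : MvPolynomial (Fin n) ℂ) : fischer (∑ i ∈ s, p i) q = ∑ i ∈ s, fischer (p i) q := by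
  rw [fischer, map_sum, LinearMap.sum_apply, MvPolynomial.coeff_sum]; rfl

lemma fischer_mul (p d q : MvPolynomial (Fin n) ℂ) :
    fischer (p * d) q = fischer p (symbolHom d q) := by
  rw [fischer, map_mul]; rfl

/-- Monomials are orthogonal with nonzero norms. Peeling off one derivative in the variable `i`
contributes the factor `-i(γ_i + 1)`. -/
lemma exists_fischer_monomial (α : Fin n →₀ ℕ) : ∃ w : ℂ, w ≠ 0 ∧ ∀ (β : Fin n →₀ ℕ) (a : ℂ),
    fischer (MvPolynomial.monomial α a) (MvPolynomial.monomial β 1) = if α = β then a * w else 0 := by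
  suffices h : ∀ (l : ℕ) (α : Fin n →₀ ℕ), α.degree = l → ∃ w : ℂ, w ≠ 0 ∧ ∀ (β : Fin n →₀ ℕ) (a : ℂ),
      fischer (MvPolynomial.monomial α a) (MvPolynomial.monomial β 1) =
        if α = β then a * w else 0 from h _ α rfl
  intro l
  induction l with
  | zero =>
    intro α hα
    obtain rfl : α = 0 := (Finsupp.degree_eq_zero_iff α).1 hα
    refine ⟨1, one_ne_zero, fun β a => ?_⟩
    rw [fischer, ← MvPolynomial.C_apply, symbolHom_C, LinearMap.smul_apply, Module.End.one_apply,
      MvPolynomial.coeff_smul, MvPolynomial.coeff_monomial]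
    simp [eq_comm]
  | succ l ih =>
    intro α hα
    obtain ⟨i, hi⟩ : ∃ i, α i ≠ 0 := by
      by_contra h
      push Not at h
      rw [Finsupp.ext (g := 0) h] at hα
      simp at hα
    have hle : Finsupp.single i 1 ≤ α := by
      rw [Finsupp.single_le_iff]
      exact Nat.one_le_iff_ne_zero.2 hi
    obtain ⟨γ, rfl⟩ := exists_add_of_le hle
    have hγ : γ.degree = l := by
      rw [map_add, Finsupp.degree_single] at hα
      omega
    obtain ⟨w, hw, hwγ⟩ := ih γ hγ
    refine ⟨-Complex.I * (γ i + 1) * w, mul_ne_zero (mul_ne_zero (neg_ne_zero.2 Complex.I_ne_zero)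
      (by exact_mod_cast Nat.succ_ne_zero (γ i))) hw, fun β a => ?_⟩
    have h1 : MvPolynomial.monomial (Finsupp.single i 1 + γ) a =
        MvPolynomial.monomial γ a * MvPolynomial.X i := by
      rw [MvPolynomial.X, MvPolynomial.monomial_mul, mul_one, add_comm]
    have h2 : symbolHom (MvPolynomial.X i) (MvPolynomial.monomial β 1) =
        MvPolynomial.monomial (β - Finsupp.single i 1) (-Complex.I * β i) := by
      rw [symbolHom_X, LinearMap.smul_apply]
      change (-Complex.I) • MvPolynomial.pderiv i (MvPolynomial.monomial β 1) = _
      rw [MvPolynomial.pderiv_monomial, MvPolynomial.smul_monomial, one_mul, smul_eq_mul]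
    have h3 : fischer (MvPolynomial.monomial γ a)
        (MvPolynomial.monomial (β - Finsupp.single i 1) (-Complex.I * β i)) =
        (-Complex.I * β i) * fischer (MvPolynomial.monomial γ a)
          (MvPolynomial.monomial (β - Finsupp.single i 1) 1) := by
      rw [← mul_one (-Complex.I * (β i : ℂ)), ← smul_eq_mul, ← MvPolynomial.smul_monomial, fischer,
        map_smul, MvPolynomial.coeff_smul]
      simp [fischer]
    rw [h1, fischer_mul, h2, h3, hwγ]
    rcases Nat.eq_zero_or_pos (β i) with hβ | hβ
    · have hne : Finsupp.single i 1 + γ ≠ β := by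
        rintro rfl
        simp at hβ
      rw [if_neg hne, hβ]
      simp
    · have hle' : Finsupp.single i 1 ≤ β := by
        rw [Finsupp.single_le_iff]
        exact hβ
      obtain ⟨β', rfl⟩ := exists_add_of_le hle'
      rw [add_tsub_cancel_left]
      by_cases h : γ = β'
      · subst h
        rw [if_pos rfl, if_pos rfl, Finsupp.add_apply, Finsupp.single_eq_same]
        push_cast
        ring
      · rw [if_neg h, if_neg (fun h' => h (add_left_cancel h')), mul_zero]

/-- The norm of a monomial for the pairing. -/
def fischerWeight (α : Fin n →₀ ℕ) : ℂ := (exists_fischer_monomial α).choose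

lemma fischerWeight_ne_zero (α : Fin n →₀ ℕ) : fischerWeight α ≠ 0 :=
  (exists_fischer_monomial α).choose_spec.1

lemma fischer_monomial (p : MvPolynomial (Fin n) ℂ) (β : Fin n →₀ ℕ) :
    fischer p (MvPolynomial.monomial β 1) = p.coeff β * fischerWeight β := by
  conv_lhs => rw [p.as_sum]
  rw [fischer_sum_left,
    Finset.sum_congr rfl fun α _ => (exists_fischer_monomial α).choose_spec.2 β _,
    Finset.sum_ite_eq']
  split_ifs with h
  · rfl
  · rw [MvPolynomial.notMem_support_iff.1 h, zero_mul]

lemma fischer_eq_sum (p q : MvPolynomial (Fin n) ℂ) :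
    fischer p q = ∑ β ∈ q.support, q.coeff β * (p.coeff β * fischerWeight β) := by
  have h1 : symbolHom p q = ∑ β ∈ q.support, q.coeff β • symbolHom p (MvPolynomial.monomial β 1) := by
    conv_lhs => rw [q.as_sum, map_sum]
    refine Finset.sum_congr rfl fun β _ => ?_
    rw [← map_smul, MvPolynomial.smul_monomial, smul_eq_mul, mul_one]
  rw [fischer, h1, MvPolynomial.coeff_sum]
  refine Finset.sum_congr rfl fun β _ => ?_
  rw [MvPolynomial.coeff_smul, ← fischer_monomial]
  rfl

/-- Under the Fischer pairing `d(D)` is adjoint to multiplication by `d`, which is injective. A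
functional vanishing on the image is represented by some `p₀` with `p₀ d = 0`, hence is zero. -/
lemma exists_symbolHom_eq {d : MvPolynomial (Fin n) ℂ} {t : ℕ} (hd : d.IsHomogeneous t) (hd0 : d ≠ 0)
    {p : MvPolynomial (Fin n) ℂ} {l : ℕ} (hp : p.IsHomogeneous l) :
    ∃ q : MvPolynomial (Fin n) ℂ, q.IsHomogeneous (l + t) ∧ symbolHom d q = p := by
  let A := MvPolynomial.homogeneousSubmodule (Fin n) ℂ (l + t)
  let B := MvPolynomial.homogeneousSubmodule (Fin n) ℂ l
  let T : A →ₗ[ℂ] B := (symbolHom d).restrict fun q hq => by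
    have := (symbolHom_homogeneous hd hq).1
    rwa [Nat.add_sub_cancel] at this
  suffices hT : Function.Surjective T by
    obtain ⟨q, hq⟩ := hT ⟨p, hp⟩
    exact ⟨q, q.2, congrArg Subtype.val hq⟩
  rw [← LinearMap.dualMap_injective_iff, injective_iff_map_eq_zero]
  intro f hf
  -- represent the functional by a polynomial
  have hmon : ∀ α ∈ Finset.finsuppAntidiag (Finset.univ : Finset (Fin n)) l,
      MvPolynomial.monomial α (1 : ℂ) ∈ B := by
    intro α hα
    rw [Finset.mem_finsuppAntidiag] at hα
    refine MvPolynomial.isHomogeneous_monomial _ ?_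
    rw [Finsupp.degree_eq_sum]
    exact hα.1
  let F : (Fin n →₀ ℕ) → ℂ := fun α => if h : MvPolynomial.monomial α (1 : ℂ) ∈ B then f ⟨_, h⟩ else 0
  let p₀ : MvPolynomial (Fin n) ℂ := ∑ α ∈ Finset.finsuppAntidiag (Finset.univ : Finset (Fin n)) l,
    MvPolynomial.monomial α (F α / fischerWeight α)
  have hp₀ : p₀.IsHomogeneous l := MvPolynomial.IsHomogeneous.sum _ _ _ fun α hα => by
    refine MvPolynomial.isHomogeneous_monomial _ ?_
    rw [Finsupp.degree_eq_sum]
    exact (Finset.mem_finsuppAntidiag.1 hα).1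
  have hrep : ∀ q : B, fischer p₀ q = f q := by
    intro q
    have hdeg : ∀ β ∈ (q : MvPolynomial (Fin n) ℂ).support,
        β ∈ Finset.finsuppAntidiag (Finset.univ : Finset (Fin n)) l := by
      intro β hβ
      rw [Finset.mem_finsuppAntidiag]
      refine ⟨?_, Finset.subset_univ _⟩
      have := q.2 (MvPolynomial.mem_support_iff.1 hβ)
      rw [← this, ← Finsupp.degree_eq_sum, Finsupp.degree_eq_weight_one]
      rfl
    have hcoeff : ∀ β ∈ (q : MvPolynomial (Fin n) ℂ).support,
        p₀.coeff β * fischerWeight β = F β := by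
      intro β hβ
      rw [MvPolynomial.coeff_sum, Finset.sum_eq_single β]
      · rw [MvPolynomial.coeff_monomial, if_pos rfl, div_mul_cancel₀ _ (fischerWeight_ne_zero β)]
      · intro α _ hα
        rw [MvPolynomial.coeff_monomial, if_neg hα]
      · intro h
        exact absurd (hdeg β hβ) h
    have hq : q = ∑ β ∈ (q : MvPolynomial (Fin n) ℂ).support.attach,
        (q : MvPolynomial (Fin n) ℂ).coeff β.1 •
          (⟨MvPolynomial.monomial β.1 (1 : ℂ), hmon _ (hdeg _ β.2)⟩ : B) := by
      refine Subtype.ext ?_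
      rw [AddSubmonoidClass.coe_finsetSum]
      simp only [Submodule.coe_smul, MvPolynomial.smul_monomial, smul_eq_mul, mul_one]
      rw [Finset.sum_attach _ fun β => MvPolynomial.monomial β ((q : MvPolynomial (Fin n) ℂ).coeff β)]
      exact MvPolynomial.as_sum _
    conv_rhs => rw [hq, map_sum]
    rw [fischer_eq_sum, ← Finset.sum_attach]
    refine Finset.sum_congr rfl fun β _ => ?_
    rw [hcoeff β.1 β.2, map_smul, smul_eq_mul]
    congr 1
    exact dif_pos (hmon _ (hdeg _ β.2))
  have hzero : p₀ * d = 0 := by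
    refine MvPolynomial.ext _ _ fun β => ?_
    rw [MvPolynomial.coeff_zero]
    by_contra hβ
    have hβd : β.degree = l + t := by
      rw [Finsupp.degree_eq_weight_one]
      exact (hp₀.mul hd) hβ
    have hmem : MvPolynomial.monomial β (1 : ℂ) ∈ A := MvPolynomial.isHomogeneous_monomial _ hβd
    have h1 := hrep (T ⟨_, hmem⟩)
    have h2 : f (T ⟨_, hmem⟩) = 0 := LinearMap.congr_fun hf ⟨_, hmem⟩
    have h3 : fischer p₀ (T ⟨_, hmem⟩ : B) = fischer (p₀ * d) (MvPolynomial.monomial β 1) :=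
      (fischer_mul _ _ _).symm
    rw [h2, h3, fischer_monomial] at h1
    exact (mul_ne_zero hβ (fischerWeight_ne_zero β)) h1
  have hp₀0 : p₀ = 0 := (mul_eq_zero.1 hzero).resolve_right hd0
  refine LinearMap.ext fun q => ?_
  rw [← hrep, hp₀0, fischer, map_zero]
  rfl

end

end PeriodicGraph

/-! ### Right inverses, harmonic polynomials and lower order perturbations -/

namespace PeriodicGraph

noncomputable section

open scoped Classical

variable {n r : ℕ}

/-! ### Determinants of matrices of homogeneous polynomials -/

lemma isHomogeneous_det {M : Matrix (Fin r) (Fin r) (MvPolynomial (Fin n) ℂ)} {w : Fin r → ℕ}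
    (h : ∀ i j, (M i j).IsHomogeneous (w i)) : M.det.IsHomogeneous (∑ i, w i) := by
  rw [Matrix.det_apply]
  refine MvPolynomial.IsHomogeneous.sum _ _ _ fun σ _ => ?_
  have h1 : (∏ i, M (σ i) i).IsHomogeneous (∑ i, w i) := by
    rw [← Equiv.sum_comp σ w]
    exact MvPolynomial.IsHomogeneous.prod _ _ _ fun i _ => h _ _
  rcases Int.units_eq_one_or (Equiv.Perm.sign σ) with hσ | hσ
  · rw [hσ, one_smul]
    exact h1
  · rw [hσ, Units.neg_smul, one_smul]
    exact h1.neg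

lemma isHomogeneous_adjugate {M : Matrix (Fin r) (Fin r) (MvPolynomial (Fin n) ℂ)} {s : ℕ}
    (h : ∀ i j, (M i j).IsHomogeneous s) (i j : Fin r) :
    (M.adjugate i j).IsHomogeneous (s * (r - 1)) := by
  have h1 : s * (r - 1) = ∑ k, Function.update (fun _ : Fin r => s) j 0 k := by
    rw [Finset.sum_update_of_mem (Finset.mem_univ j), zero_add, Finset.sum_const, smul_eq_mul,
      Finset.card_sdiff_of_subset (Finset.subset_univ _), Finset.card_singleton, Finset.card_univ,
      Fintype.card_fin, mul_comm]
  rw [Matrix.adjugate_apply, h1]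
  refine isHomogeneous_det fun k l => ?_
  by_cases hk : k = j
  · subst hk
    rw [Matrix.updateRow_self, Function.update_self]
    by_cases hl : l = i
    · subst hl
      rw [Pi.single_eq_same]
      exact MvPolynomial.isHomogeneous_one _ _
    · rw [Pi.single_eq_of_ne hl]
      exact MvPolynomial.isHomogeneous_zero _ _ _
  · rw [Matrix.updateRow_ne hk, Function.update_of_ne hk]
    exact h _ _

/-! ### Homogeneous right inverses -/

lemma matrixOp_mul (A B : Matrix (Fin r) (Fin r) (MvPolynomial (Fin n) ℂ))
    (p : Fin r → MvPolynomial (Fin n) ℂ) : matrixOp (A * B) p = matrixOp A (matrixOp B p) := by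
  funext i
  simp only [matrixOp_apply, Matrix.mul_apply, map_sum, map_mul, LinearMap.sum_apply,
    Module.End.mul_apply]
  exact Finset.sum_comm

lemma matrixOp_smul_one (d : MvPolynomial (Fin n) ℂ) (p : Fin r → MvPolynomial (Fin n) ℂ) :
    matrixOp (d • (1 : Matrix (Fin r) (Fin r) (MvPolynomial (Fin n) ℂ))) p =
      fun i => symbolHom d (p i) := by
  funext i
  rw [matrixOp_apply, Finset.sum_eq_single i]
  · rw [Matrix.smul_apply, Matrix.one_apply_eq, smul_eq_mul, mul_one]
  · intro j _ hj
    rw [Matrix.smul_apply, Matrix.one_apply_ne hj.symm, smul_zero, map_zero, LinearMap.zero_apply]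
  · exact fun h => absurd (Finset.mem_univ i) h

/-- Since `Q adj Q = det Q`, it suffices to solve the scalar equations `det Q(D) q_i = p_i` and
apply `adj Q(D)`. -/
lemma exists_matrixOp_eq {Q : Matrix (Fin r) (Fin r) (MvPolynomial (Fin n) ℂ)} {s : ℕ}
    (hQ : ∀ i j, (Q i j).IsHomogeneous s) (hdet : Q.det ≠ 0)
    {p : Fin r → MvPolynomial (Fin n) ℂ} {l : ℕ} (hp : ∀ i, (p i).IsHomogeneous l) :
    ∃ q : Fin r → MvPolynomial (Fin n) ℂ, (∀ i, (q i).IsHomogeneous (l + s)) ∧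
      matrixOp Q q = p := by
  have hd : Q.det.IsHomogeneous (s * r) := by
    have := isHomogeneous_det (w := fun _ => s) hQ
    rwa [Finset.sum_const, Finset.card_univ, Fintype.card_fin, smul_eq_mul, mul_comm] at this
  choose q hq hqp using fun i => exists_symbolHom_eq hd hdet (hp i)
  refine ⟨matrixOp Q.adjugate q, fun i => ?_, ?_⟩
  · rw [matrixOp_apply]
    refine MvPolynomial.IsHomogeneous.sum _ _ _ fun j _ => ?_
    have := (symbolHom_homogeneous (isHomogeneous_adjugate hQ i j) (hq j)).1
    -- The degree count `(l + s r) - s (r - 1) = l + s` needs `r ≥ 1`, which holds because the index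
    -- `i` exists.
    have hr : r = (r - 1) + 1 := by have := i.pos; omega
    have h2 : l + s * r - s * (r - 1) = l + s := by
      conv_lhs => rw [hr, Nat.mul_succ]
      simp only [Nat.add_sub_cancel]
      omega
    rwa [h2] at this
  · rw [← matrixOp_mul, Matrix.mul_adjugate, matrixOp_smul_one]
    exact funext hqp

/-- The equation is solved on each monomial basis vector and the solutions are extended linearly. -/
lemma exists_isHomogeneousRightInverse {Q : Matrix (Fin r) (Fin r) (MvPolynomial (Fin n) ℂ)} {s : ℕ}
    (hQ : ∀ i j, (Q i j).IsHomogeneous s) (hdet : Q.det ≠ 0) :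
    ∃ R, IsHomogeneousRightInverse Q s R := by
  let B := Pi.basis fun _ : Fin r => MvPolynomial.basisMonomials (Fin n) ℂ
  have hB : ∀ x i, (B x i).IsHomogeneous x.2.degree := by
    intro x i
    rw [Pi.basis_apply, MvPolynomial.coe_basisMonomials]
    by_cases hi : i = x.1
    · subst hi
      rw [Pi.single_eq_same]
      exact MvPolynomial.isHomogeneous_monomial _ rfl
    · rw [Pi.single_eq_of_ne hi]
      exact MvPolynomial.isHomogeneous_zero _ _ _
  choose q hq hqB using fun x => exists_matrixOp_eq hQ hdet (hB x)
  refine ⟨B.constr ℂ q, fun p => ?_, fun p l hp i => ?_⟩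
  · have h1 : (matrixOp Q).comp (B.constr ℂ q) = LinearMap.id := B.ext fun x => by
      rw [LinearMap.comp_apply, Module.Basis.constr_basis, hqB]
      rfl
    exact LinearMap.congr_fun h1 p
  · rw [Module.Basis.constr_apply, Finsupp.sum, Finset.sum_apply]
    refine MvPolynomial.IsHomogeneous.sum _ _ _ fun x hx => ?_
    have h1 : (p x.1).coeff x.2 ≠ 0 := by
      have := Finsupp.mem_support_iff.1 hx
      rwa [Pi.basis_repr] at this
    have h2 : x.2.degree = l := by
      rw [Finsupp.degree_eq_weight_one]
      exact hp x.1 h1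
    rw [Pi.smul_apply, MvPolynomial.smul_eq_C_mul, ← h2]
    have := (MvPolynomial.isHomogeneous_C (Fin n) (B.repr p x)).mul (hq x i)
    rwa [zero_add] at this

lemma matrixOp_totalDegree_le {Q : Matrix (Fin r) (Fin r) (MvPolynomial (Fin n) ℂ)} {l M : ℕ}
    (hQ : ∀ i j, (Q i j).IsHomogeneous l) {p : Fin r → MvPolynomial (Fin n) ℂ}
    (hp : p ∈ polyLE n r M) :
    matrixOp Q p ∈ polyLE n r (M - l) ∧ (M < l → matrixOp Q p = 0) := by
  rw [mem_polyLE] at hp ⊢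
  refine ⟨fun i => ?_, fun h => funext fun i => ?_⟩
  · rw [matrixOp_apply]
    exact MvPolynomial.totalDegree_finsetSum_le fun j _ => (symbolHom_totalDegree_le (hQ i j) (hp j)).1
  · rw [matrixOp_apply]
    exact Finset.sum_eq_zero fun j _ => (symbolHom_totalDegree_le (hQ i j) (hp j)).2 h

lemma IsHomogeneousRightInverse.mem_polyLE {Q : Matrix (Fin r) (Fin r) (MvPolynomial (Fin n) ℂ)}
    {s M : ℕ} {R : (Fin r → MvPolynomial (Fin n) ℂ) →ₗ[ℂ] (Fin r → MvPolynomial (Fin n) ℂ)}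
    (hR : IsHomogeneousRightInverse Q s R) {p : Fin r → MvPolynomial (Fin n) ℂ}
    (hp : p ∈ polyLE n r M) : R p ∈ polyLE n r (M + s) := by
  rw [PeriodicGraph.mem_polyLE] at hp
  have h1 : p = ∑ m ∈ Finset.range (M + 1), fun i => MvPolynomial.homogeneousComponent m (p i) := by
    funext i
    rw [Finset.sum_apply, sum_homogeneousComponent_of_le (hp i)]
  rw [h1, map_sum]
  refine Submodule.sum_mem _ fun m hm => PeriodicGraph.mem_polyLE.2 fun i => ?_
  have h2 := hR.2 (fun i => MvPolynomial.homogeneousComponent m (p i)) m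
    (fun i => MvPolynomial.homogeneousComponent_isHomogeneous m (p i)) i
  have := Finset.mem_range.1 hm
  exact h2.totalDegree_le.trans (by omega)

/-! ### Harmonic polynomials -/

/-- Vector-valued polynomials of bounded degree are vectors of such polynomials. -/
def polyLEEquiv (n r N : ℕ) :
    polyLE n r N ≃ₗ[ℂ] (Fin r → MvPolynomial.restrictTotalDegree (Fin n) ℂ N) where
  toFun φ i := ⟨φ.1 i, φ.2 i (Set.mem_univ i)⟩
  invFun φ := ⟨fun i => φ i, fun i _ => (φ i).2⟩
  map_add' _ _ := rfl
  map_smul' _ _ := rfl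
  left_inv _ := rfl
  right_inv _ := rfl

instance finiteDimensional_polyLE (n r N : ℕ) : FiniteDimensional ℂ (polyLE n r N) :=
  Module.Finite.equiv (polyLEEquiv n r N).symm

lemma finrank_polyLE (n r N : ℕ) :
    Module.finrank ℂ (polyLE n r N) = r * (n + N).choose N := by
  rw [(polyLEEquiv n r N).finrank_eq, Module.finrank_pi_fintype, Finset.sum_const, Finset.card_univ,
    Fintype.card_fin, smul_eq_mul, ← polyDim_eq_choose]
  rfl

/-- Rank-nullity: the right inverse shows that `Q(D)` maps degree at most `N` onto degree at most `N
- l`. For `N < l` every polynomial is harmonic. -/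
lemma finrank_harmonic {Q : Matrix (Fin r) (Fin r) (MvPolynomial (Fin n) ℂ)} {l : ℕ}
    (hQ : ∀ i j, (Q i j).IsHomogeneous l) (hdet : Q.det ≠ 0) (N : ℕ) :
    (Module.finrank ℂ (harmonic Q N) : ℤ) = dimFormula n N r l := by
  rcases lt_or_ge N l with hN | hN
  · have h1 : harmonic Q N = polyLE n r N := by
      refine inf_eq_right.2 fun p hp => ?_
      exact LinearMap.mem_ker.2 ((matrixOp_totalDegree_le hQ hp).2 hN)
    rw [h1, finrank_polyLE, dimFormula, if_neg (not_le.2 hN)]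
    push_cast
    ring
  · obtain ⟨R, hR⟩ := exists_isHomogeneousRightInverse hQ hdet
    let g := (matrixOp Q).domRestrict (polyLE n r N)
    have hrange : LinearMap.range g = polyLE n r (N - l) := by
      refine le_antisymm ?_ fun p hp => ?_
      · rintro _ ⟨p, rfl⟩
        exact (matrixOp_totalDegree_le hQ p.2).1
      · have h1 := hR.mem_polyLE hp
        rw [Nat.sub_add_cancel hN] at h1
        exact ⟨⟨R p, h1⟩, hR.1 p⟩
    have hker : Module.finrank ℂ (LinearMap.ker g) = Module.finrank ℂ (harmonic Q N) := by
      rw [← Submodule.finrank_map_subtype_eq, LinearMap.ker_domRestrict, Submodule.map_comap_subtype,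
        inf_comm, harmonic]
    have h := LinearMap.finrank_range_add_finrank_ker g
    rw [hrange, hker, finrank_polyLE, finrank_polyLE] at h
    rw [dimFormula, if_pos hN, Nat.add_sub_assoc hN]
    have h' := congrArg (Nat.cast : ℕ → ℤ) h
    push_cast at h'
    linear_combination h'

/-! ### The polynomial solutions of a system with nondegenerate leading term -/

variable {Λ : ℕ → Matrix (Fin r) (Fin r) (MvPolynomial (Fin n) ℂ)} {l₀ : ℕ}
  {R : (Fin r → MvPolynomial (Fin n) ℂ) →ₗ[ℂ] (Fin r → MvPolynomial (Fin n) ℂ)}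

/-- `Λ_l(D)` lowers the degree by `l > l₀` and `R` raises it by only `l₀`. The correction therefore
strictly lowers the degree, and vanishes on constants. -/
lemma higher_mem_polyLE (hΛ : ∀ l i j, (Λ l i j).IsHomogeneous l)
    (hR : IsHomogeneousRightInverse (Λ l₀) l₀ R) (N : ℕ) {M : ℕ} {p : Fin r → MvPolynomial (Fin n) ℂ}
    (hp : p ∈ polyLE n r M) :
    R (∑ l ∈ Finset.Ioc l₀ N, matrixOp (Λ l) p) ∈ polyLE n r (M - 1) ∧
      (M = 0 → R (∑ l ∈ Finset.Ioc l₀ N, matrixOp (Λ l) p) = 0) := by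
  rw [map_sum]
  refine ⟨Submodule.sum_mem _ fun l hl => ?_, fun hM => Finset.sum_eq_zero fun l hl => ?_⟩
  · have hl' := (Finset.mem_Ioc.1 hl).1
    obtain ⟨h1, h2⟩ := matrixOp_totalDegree_le (hΛ l) hp
    rcases lt_or_ge M l with hM | hM
    · rw [h2 hM, map_zero]
      exact Submodule.zero_mem _
    · have h3 := PeriodicGraph.mem_polyLE.1 (hR.mem_polyLE h1)
      exact mem_polyLE.2 fun i => (h3 i).trans (by omega)
  · have hl' := (Finset.mem_Ioc.1 hl).1
    rw [(matrixOp_totalDegree_le (hΛ l) hp).2 (by omega), map_zero]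

lemma eq_zero_of_add_higher_eq_zero (hΛ : ∀ l i j, (Λ l i j).IsHomogeneous l)
    (hR : IsHomogeneousRightInverse (Λ l₀) l₀ R) (N : ℕ) {M : ℕ} {p : Fin r → MvPolynomial (Fin n) ℂ}
    (hp : p ∈ polyLE n r M) (h : p + R (∑ l ∈ Finset.Ioc l₀ N, matrixOp (Λ l) p) = 0) : p = 0 := by
  induction M with
  | zero => rwa [(higher_mem_polyLE hΛ hR N hp).2 rfl, add_zero] at h
  | succ M ih =>
    refine ih ?_
    rw [eq_neg_of_add_eq_zero_left h]
    exact Submodule.neg_mem _ (higher_mem_polyLE hΛ hR N hp).1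

/-- `Λ_{l₀}(D)` cancels `R`, leaving all terms of order at least `l₀`. The terms below vanish by
hypothesis, and for `N < l₀` both sides are zero. -/
lemma matrixOp_add_higher (hΛ : ∀ l i j, (Λ l i j).IsHomogeneous l) (hvan : ∀ l < l₀, Λ l = 0)
    (hR : IsHomogeneousRightInverse (Λ l₀) l₀ R) {N : ℕ} {p : Fin r → MvPolynomial (Fin n) ℂ}
    (hp : p ∈ polyLE n r N) :
    matrixOp (Λ l₀) (p + R (∑ l ∈ Finset.Ioc l₀ N, matrixOp (Λ l) p)) =
      (∑ l ∈ Finset.range (N + 1), matrixOp (Λ l)) p := by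
  have hlow : ∀ l < l₀, matrixOp (Λ l) p = 0 := fun l hl => by
    rw [hvan l hl]
    funext i
    rw [matrixOp_apply]
    simp
  rw [map_add, hR.1, LinearMap.sum_apply]
  rcases lt_or_ge N l₀ with hN | hN
  · rw [(matrixOp_totalDegree_le (hΛ l₀) hp).2 hN, Finset.Ioc_eq_empty (by omega), Finset.sum_empty,
      add_zero, Finset.sum_eq_zero fun l hl => hlow l (by have := Finset.mem_range.1 hl; omega)]
  · have hsub : insert l₀ (Finset.Ioc l₀ N) ⊆ Finset.range (N + 1) := fun l hl => by
      simp only [Finset.mem_insert, Finset.mem_Ioc, Finset.mem_range] at hl ⊢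
      omega
    rw [← Finset.sum_subset hsub, Finset.sum_insert (by simp)]
    intro l hl hl'
    simp only [Finset.mem_insert, Finset.mem_Ioc, Finset.mem_range] at hl hl'
    exact hlow l (by omega)

/-- The map is the identity plus a degree-lowering map, hence injective and so bijective on the
finite dimensional space of degree at most `N`. The leading operator composed with it is the full
operator, so the kernels correspond. -/
lemma bijOn_add_higher (hΛ : ∀ l i j, (Λ l i j).IsHomogeneous l) (hvan : ∀ l < l₀, Λ l = 0)
    (hR : IsHomogeneousRightInverse (Λ l₀) l₀ R) (N : ℕ) :
    Set.BijOn (fun p => p + R (∑ l ∈ Finset.Ioc l₀ N, matrixOp (Λ l) p)) (seriesKer Λ N)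
      (harmonic (Λ l₀) N) := by
  let F : (Fin r → MvPolynomial (Fin n) ℂ) →ₗ[ℂ] (Fin r → MvPolynomial (Fin n) ℂ) :=
    LinearMap.id + R.comp (∑ l ∈ Finset.Ioc l₀ N, matrixOp (Λ l))
  have hF : ∀ p, F p = p + R (∑ l ∈ Finset.Ioc l₀ N, matrixOp (Λ l) p) := fun p => by
    simp [F]
  have hmaps : ∀ p ∈ polyLE n r N, F p ∈ polyLE n r N := fun p hp => by
    rw [hF]
    refine Submodule.add_mem _ hp (mem_polyLE.2 fun i => ?_)
    exact (mem_polyLE.1 (higher_mem_polyLE hΛ hR N hp).1 i).trans (Nat.sub_le _ _)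
  have hinj : ∀ p ∈ polyLE n r N, F p = 0 → p = 0 := fun p hp h =>
    eq_zero_of_add_higher_eq_zero hΛ hR N hp ((hF p).symm.trans h)
  have hinj' : Function.Injective (F.restrict hmaps) := by
    refine (injective_iff_map_eq_zero _).2 fun p hp => Subtype.ext (hinj p p.2 ?_)
    exact congrArg Subtype.val hp
  have hop : ∀ p ∈ polyLE n r N, matrixOp (Λ l₀) (F p) =
      (∑ l ∈ Finset.range (N + 1), matrixOp (Λ l)) p := fun p hp => by
    rw [hF]
    exact matrixOp_add_higher hΛ hvan hR hp
  suffices h : Set.BijOn F (seriesKer Λ N) (harmonic (Λ l₀) N) from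
    h.congr fun p _ => hF p
  refine ⟨fun p hp => ⟨?_, hmaps p hp.2⟩, fun p hp q hq h => ?_, fun p hp => ?_⟩
  · exact (hop p hp.2).trans hp.1
  · refine sub_eq_zero.1 (hinj _ (Submodule.sub_mem _ hp.2 hq.2) ?_)
    rw [map_sub, h, sub_self]
  · obtain ⟨q, hq⟩ := LinearMap.injective_iff_surjective.1 hinj' ⟨p, hp.2⟩
    have hq' : F q = p := congrArg Subtype.val hq
    refine ⟨q, ⟨(hop q q.2).symm.trans ?_, q.2⟩, hq'⟩
    rw [hq']
    exact hp.1

lemma finrank_eq_of_bijOn {E F : Type*} [AddCommGroup E] [Module ℂ E] [AddCommGroup F] [Module ℂ F]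
    (f : E →ₗ[ℂ] F) {p : Submodule ℂ E} {q : Submodule ℂ F} (h : Set.BijOn f p q) :
    Module.finrank ℂ p = Module.finrank ℂ q :=
  (LinearEquiv.ofBijective (f.restrict h.mapsTo) h.bijective).finrank_eq

lemma finrank_seriesKer (hΛ : ∀ l i j, (Λ l i j).IsHomogeneous l) (hvan : ∀ l < l₀, Λ l = 0)
    (hR : IsHomogeneousRightInverse (Λ l₀) l₀ R) (N : ℕ) :
    Module.finrank ℂ (seriesKer Λ N) = Module.finrank ℂ (harmonic (Λ l₀) N) := by
  refine finrank_eq_of_bijOn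
    (LinearMap.id + R.comp (∑ l ∈ Finset.Ioc l₀ N, matrixOp (Λ l))) ?_
  refine (bijOn_add_higher hΛ hvan hR N).congr fun p _ => ?_
  simp

end

end PeriodicGraph

/-! ### Floquet solutions in terms of the reduced system, and the main theorem -/

namespace PeriodicGraph

noncomputable section

open scoped Classical

variable {G V : Type*} [AddCommGroup G] [AddAction G V] [Fintype (Orbits G V)] {n : ℕ}

lemma HasSymbol.exists_eq_sum_floquetSol {P : (V → ℂ) →ₗ[ℂ] (V → ℂ)}
    {D : Matrix (Orbits G V) (Orbits G V) (AddMonoidAlgebra ℂ G)} (hD : HasSymbol P D)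
    (hfree : ∀ (g : G) (v : V), g +ᵥ v = v → g = 0) {c : G →+ (Fin n → ℤ)}
    (hc : Function.Surjective c) (hc' : Finite c.ker) (hfin : (fermi G P).Finite)
    {ξ : V → Fin n → ℝ} (hξ : IsCoordinates c ξ) {N : ℕ} {u : V → ℂ} (hu : u ∈ polySol c P N) :
    ∃ (s : Finset (AddChar G Circle)) (f : AddChar G Circle → V → ℂ),
      (∀ χ ∈ s, χ ∈ fermi G P ∧ f χ ∈ floquetSol P ξ χ N) ∧ u = ∑ χ ∈ s, f χ := by
  rw [hD.polySol_eq_iSup hfree c hc' hfin N, Submodule.mem_iSup_iff_exists_finsupp] at hu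
  obtain ⟨f, hf, rfl⟩ := hu
  refine ⟨f.support.map (Function.Embedding.subtype _),
    fun χ => if h : χ ∈ fermi G P then f ⟨χ, h⟩ else 0, fun χ hχ => ?_, ?_⟩
  · obtain ⟨χ, -, rfl⟩ := Finset.mem_map.1 hχ
    refine ⟨χ.2, ?_⟩
    have h1 := hf χ
    rw [hD.polySol_inf_genSpace hfree c hc hc' χ.1 N] at h1
    rw [hD.floquetSol_eq hfree hc hξ]
    simpa using h1
  · rw [Finset.sum_map]
    refine Finset.sum_congr rfl fun χ _ => ?_
    change f χ = if h : χ.1 ∈ fermi G P then f ⟨χ.1, h⟩ else 0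
    rw [dif_pos χ.2]

/-- The Bloch matrix of `P` is the transpose of the dual one, so its reduction is the matrix `λ`. On
degree at most `N` only the Taylor terms up to `N` act. -/
lemma HasSymbol.exists_bijOn_seriesKer {P : (V → ℂ) →ₗ[ℂ] (V → ℂ)}
    {D : Matrix (Orbits G V) (Orbits G V) (AddMonoidAlgebra ℂ G)} (hD : HasSymbol P D)
    (hfree : ∀ (g : G) (v : V), g +ᵥ v = v → g = 0) (c : G →+ (Fin n → ℤ))
    {χ : AddChar G Circle} {δ : ℝ} {e : Fin (mult c P χ) → Orbits G V → ℂ} {l₀ : ℕ}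
    (h : IsNondegenerate c P χ δ e l₀) :
    ∃ T : (Orbits G V → MvPolynomial (Fin n) ℂ) →ₗ[ℂ] (Fin (mult c P χ) → MvPolynomial (Fin n) ℂ),
      ∀ N, Set.BijOn T (polySolSpace (bloch c D χ) N)
        (seriesKer (taylorMatrix (dispersion c P χ δ e)) N) := by
  have hA : dualBloch c P χ = fun k => (bloch c D χ k).transpose :=
    funext fun k => hD.dualBloch_eq hfree c χ k
  have hAan : MatAnalytic (dualBloch c P χ) := by
    rw [hA]
    exact (matAnalytic_bloch c D χ).transpose
  obtain ⟨-, T, hT⟩ := exists_bijOn_compression hAan h.radius_pos h.separates h.orthonormal h.span_eq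
  refine ⟨matOp T, fun N => ?_⟩
  have h1 : (fun k => (dualBloch c P χ k).transpose) = bloch c D χ := by
    rw [hA]
    rfl
  have h2 : polySolSpace (dispersion c P χ δ e) N =
      seriesKer (taylorMatrix (dispersion c P χ δ e)) N := by
    ext φ
    rw [mem_polySolSpace, ← mem_polyLE]
    refine and_congr_left fun hφ => ?_
    rw [matOp_eq_sum_taylorMatrix _ hφ]
    rfl
  rw [← h2, ← h1]
  exact hT N

/-- `T` has to be defined on all functions and be the same for every `N`, so a linear left inverse
of `polyFn` is fixed once and composed with the reduction. -/
lemma HasSymbol.exists_bijOn_floquetSol {P : (V → ℂ) →ₗ[ℂ] (V → ℂ)}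
    {D : Matrix (Orbits G V) (Orbits G V) (AddMonoidAlgebra ℂ G)} (hD : HasSymbol P D)
    (hfree : ∀ (g : G) (v : V), g +ᵥ v = v → g = 0) {c : G →+ (Fin n → ℤ)}
    (hc : Function.Surjective c) {χ : AddChar G Circle} {δ : ℝ}
    {e : Fin (mult c P χ) → Orbits G V → ℂ} {l₀ : ℕ} (h : IsNondegenerate c P χ δ e l₀)
    {ξ : V → Fin n → ℝ} (hξ : IsCoordinates c ξ) :
    ∃ T : (V → ℂ) →ₗ[ℂ] (Fin (mult c P χ) → MvPolynomial (Fin n) ℂ),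
      ∀ N, Set.BijOn T (floquetSol P ξ χ N)
        (seriesKer (taylorMatrix (dispersion c P χ δ e)) N) := by
  obtain ⟨T, hT⟩ := hD.exists_bijOn_seriesKer hfree c h
  obtain ⟨S, hS⟩ := LinearMap.exists_leftInverse_of_injective (polyFn c χ)
    (LinearMap.ker_eq_bot.2 (polyFn_injective hfree c hc χ))
  have hS' : Function.LeftInverse S (polyFn c χ) := fun φ => LinearMap.congr_fun hS φ
  refine ⟨T.comp S, fun N => ?_⟩
  rw [hD.floquetSol_eq hfree hc hξ, LinearMap.coe_comp]
  refine (hT N).comp ⟨?_, ?_, ?_⟩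
  · rintro _ ⟨φ, hφ, rfl⟩
    rwa [hS' φ]
  · rintro _ ⟨φ, _, rfl⟩ _ ⟨ψ, _, rfl⟩ hφψ
    rw [hS' φ, hS' ψ] at hφψ
    rw [hφψ]
  · exact fun φ hφ => ⟨_, ⟨φ, hφ, rfl⟩, hS' φ⟩

lemma taylorMatrix_isHomogeneous {r : ℕ} (F : (Fin n → ℂ) → Matrix (Fin r) (Fin r) ℂ) (l : ℕ)
    (i j : Fin r) : (taylorMatrix F l i j).IsHomogeneous l :=
  taylorTerm_isHomogeneous _ l

end

end PeriodicGraph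

theorem theorem31 {G V : Type*} [AddCommGroup G] [AddAction G V]
    [Fintype (PeriodicGraph.Orbits G V)] {n : ℕ}
    (c : G →+ (Fin n → ℤ)) (hc : Function.Surjective c) (hc' : Finite c.ker)
    (Γ : SimpleGraph V) (hΓ : PeriodicGraph.IsFreeCocompact G Γ)
    (m : ℕ) (P : (V → ℂ) →ₗ[ℂ] (V → ℂ))
    (hP : PeriodicGraph.IsDifferenceOperator Γ m P)
    (hPper : PeriodicGraph.IsPeriodicOperator G P) :
    -- the Liouville theorem of some order implies the Liouville theorem of any order
    (∀ N, PeriodicGraph.LiouvilleOfOrder c P N → PeriodicGraph.Liouville c P) ∧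
    -- the Liouville theorem holds if and only if the real Fermi surface is finite
    (PeriodicGraph.Liouville c P ↔ (PeriodicGraph.fermi G P).Finite) ∧
    (PeriodicGraph.Liouville c P →
      -- polynomially growing solutions are finite sums of Floquet solutions
      (∀ ξ : V → Fin n → ℝ, PeriodicGraph.IsCoordinates c ξ →
        ∀ N, ∀ u ∈ PeriodicGraph.polySol c P N,
          ∃ (s : Finset (AddChar G Circle)) (f : AddChar G Circle → V → ℂ),
            (∀ χ ∈ s, χ ∈ PeriodicGraph.fermi G P ∧ f χ ∈ PeriodicGraph.floquetSol P ξ χ N) ∧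
            u = ∑ χ ∈ s, f χ) ∧
      -- the upper bound for the dimensions
      (∀ N, Module.finrank ℂ (PeriodicGraph.polySol c P N) ≤
        Module.finrank ℂ (PeriodicGraph.polySol c P 0) * PeriodicGraph.polyDim n N) ∧
      -- the nondegenerate case
      (∀ (δ : AddChar G Circle → ℝ) (l₀ : AddChar G Circle → ℕ)
        (e : ∀ χ : AddChar G Circle,
          Fin (PeriodicGraph.mult c P χ) → PeriodicGraph.Orbits G V → ℂ),
        (∀ χ ∈ PeriodicGraph.fermi G P,
          PeriodicGraph.IsNondegenerate c P χ (δ χ) (e χ) (l₀ χ)) →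
        -- the dimension formula
        (∀ N, (Module.finrank ℂ (PeriodicGraph.polySol c P N) : ℤ) =
          ∑ᶠ χ ∈ PeriodicGraph.fermi G P,
            PeriodicGraph.dimFormula n N (PeriodicGraph.mult c P χ) (l₀ χ)) ∧
        ∀ χ ∈ PeriodicGraph.fermi G P,
          ∀ Λ : ℕ → Matrix (Fin (PeriodicGraph.mult c P χ)) (Fin (PeriodicGraph.mult c P χ))
              (MvPolynomial (Fin n) ℂ),
            Λ = PeriodicGraph.taylorMatrix (PeriodicGraph.dispersion c P χ (δ χ) (e χ)) →
          -- the terms of the sum are the dimensions of the spaces of harmonic polynomials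
          (∀ N, (Module.finrank ℂ (PeriodicGraph.harmonic (Λ (l₀ χ)) N) : ℤ) =
            PeriodicGraph.dimFormula n N (PeriodicGraph.mult c P χ) (l₀ χ)) ∧
          -- homogeneous right inverses of the leading term exist
          (∃ R, PeriodicGraph.IsHomogeneousRightInverse (Λ (l₀ χ)) (l₀ χ) R) ∧
          -- Floquet solutions correspond to polynomial solutions of the full system, and
          -- any such right inverse turns these into harmonic polynomials
          (∀ ξ : V → Fin n → ℝ, PeriodicGraph.IsCoordinates c ξ →
            ∃ T : (V → ℂ) →ₗ[ℂ] (Fin (PeriodicGraph.mult c P χ) → MvPolynomial (Fin n) ℂ),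
              ∀ N,
                Set.BijOn T (PeriodicGraph.floquetSol P ξ χ N) (PeriodicGraph.seriesKer Λ N) ∧
                ∀ R, PeriodicGraph.IsHomogeneousRightInverse (Λ (l₀ χ)) (l₀ χ) R →
                  Set.BijOn
                    (fun u => T u + R (∑ l ∈ Finset.Ioc (l₀ χ) N,
                      PeriodicGraph.matrixOp (Λ l) (T u)))
                    (PeriodicGraph.floquetSol P ξ χ N)
                    (PeriodicGraph.harmonic (Λ (l₀ χ)) N)))) := by
  have hfree := hΓ.free
  obtain ⟨D, hD⟩ := PeriodicGraph.exists_hasSymbol hΓ hP hPper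
  have hliou : (PeriodicGraph.fermi G P).Finite → PeriodicGraph.Liouville c P := fun hfin N =>
    hD.finiteDimensional_polySol hfree c hc' hfin N
  have hfin_of : ∀ N, PeriodicGraph.LiouvilleOfOrder c P N → (PeriodicGraph.fermi G P).Finite :=
    fun N h => PeriodicGraph.finite_fermi_of_liouvilleOfOrder h
  -- Finiteness of the Fermi surface does not involve `N`, which is how one order implies all
  -- others.
  refine ⟨fun N h => hliou (hfin_of N h), ⟨fun h => hfin_of 0 (h 0), hliou⟩, fun hL => ?_⟩
  have hfin := hfin_of 0 (hL 0)
  refine ⟨fun ξ hξ N u hu => hD.exists_eq_sum_floquetSol hfree hc hc' hfin hξ hu,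
    hD.finrank_polySol_le hfree c hc hc' hfin, fun δ l₀ e hnd => ⟨fun N => ?_, ?_⟩⟩
  · rw [hD.finrank_polySol hfree c hc hc' hfin, finsum_mem_eq_finite_toFinset_sum _ hfin,
      Nat.cast_sum]
    refine Finset.sum_congr rfl fun χ hχ => ?_
    have h := hnd χ (hfin.mem_toFinset.1 hχ)
    obtain ⟨T, hT⟩ := hD.exists_bijOn_seriesKer hfree c h
    have hhom := PeriodicGraph.taylorMatrix_isHomogeneous
      (PeriodicGraph.dispersion c P χ (δ χ) (e χ))
    obtain ⟨R, hR⟩ := PeriodicGraph.exists_isHomogeneousRightInverse (hhom (l₀ χ)) h.det_ne_zero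
    rw [PeriodicGraph.finrank_eq_of_bijOn T (hT N),
      PeriodicGraph.finrank_seriesKer hhom h.vanishing hR N,
      PeriodicGraph.finrank_harmonic (hhom (l₀ χ)) h.det_ne_zero]
  · rintro χ hχ _ rfl
    have h := hnd χ hχ
    have hhom := PeriodicGraph.taylorMatrix_isHomogeneous
      (PeriodicGraph.dispersion c P χ (δ χ) (e χ))
    refine ⟨PeriodicGraph.finrank_harmonic (hhom (l₀ χ)) h.det_ne_zero,
      PeriodicGraph.exists_isHomogeneousRightInverse (hhom (l₀ χ)) h.det_ne_zero, fun ξ hξ => ?_⟩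
    obtain ⟨T, hT⟩ := hD.exists_bijOn_floquetSol hfree hc h hξ
    exact ⟨T, fun N => ⟨hT N, fun R hR =>
      (PeriodicGraph.bijOn_add_higher hhom h.vanishing hR N).comp (hT N)⟩⟩
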